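/- Let $a,b\in\mathbb{R}$, $c>0$, $\Gamma>0$, $L>0$, $\nu>0$, $d=2$, and let $S_0$ be the space of symmetric traceless $N\times N$ real matrices, where $N=2$ or $N=3$. For $u:\mathbb{R}_+\times\mathbb{R}^2\to\mathbb{R}^2$ write $u_{\alpha,\beta}=\partial_\beta u_\alpha$ and $\Omega_{\alpha\beta}=\tfrac12(u_{\alpha,\beta}-u_{\beta,\alpha})$; when $N=3$, planar tensors such as $\Omega$ and $\nabla\psi$ are extended by zero to $3\times3$ matrices. Write $A\cdot B=\mathrm{tr}(AB)$ for $A,B\in\mathbb{R}^{N\times N}$, and sum over repeated indices. Consider on $\mathbb{R}_+\times\mathbb{R}^2$ the system $$\begin{aligned} &\partial_tQ+u\cdot\nabla Q-\Omega Q+Q\Omega=\Gamma\Big(L\Delta Q-aQ+b\big[Q^2-\tfrac{\mathrm{tr}(Q^2)}{d}\mathrm{Id}\big]-cQ\,\mathrm{tr}(Q^2)\Big),\\ &\partial_tu_\alpha+u_\beta\partial_\beta u_\alpha=\nu\Delta u_\alpha+\partial_\alpha p-L\partial_\beta\Big(\partial_\alpha Q_{\zeta\delta}\partial_\beta Q_{\zeta\delta}-\tfrac{\delta_{\alpha\beta}}{d}\partial_\lambda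 Q_{\zeta\delta}\partial_\lambda Q_{\zeta\delta}\Big)+L\partial_\beta\big(Q_{\alpha\gamma}\Delta Q_{\gamma\beta}-\Delta Q_{\alpha\gamma}Q_{\gamma\beta}\big),\\ &\nabla\cdot u=0. \end{aligned}$$ Given data $\bar Q\in L^2(\mathbb{R}^2;S_0)$ and $\bar u\in L^2(\mathbb{R}^2;\mathbb{R}^2)$ with $\nabla\cdot\bar u=0$ in $\mathcal{D}'(\mathbb{R}^2)$, a pair $(Q,u)$ is a weak solution with data $(\bar Q,\bar u)$ if $Q\in L^\infty_{loc}(\mathbb{R}_+;H^1(\mathbb{R}^2;S_0))\cap L^2_{loc}(\mathbb{R}_+;H^2(\mathbb{R}^2;S_0))$, $u\in L^\infty_{loc}(\mathbb{R}_+;L^2(\mathbb{R}^2;\mathbb{R}^2))\cap L^2_{loc}(\mathbb{R}_+;H^1(\mathbb{R}^2;\mathbb{R}^2))$, $\nabla\cdot u=0$, and for all compactly supported $\varphi\in C^\infty([0,\infty)\times\mathbb{R}^2;S_0)$ and all compactly supported $\psi\in C^\infty([0,\infty)\times\mathbb{R}^2;\mathbb{R}^2)$ with $\nabla\cdot\psi=0$,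 $$\int_0^\infty\!\!\int_{\mathbb{R}^2}-Q\cdot\partial_t\varphi-\Gamma L\Delta Q\cdot\varphi-u_\gamma\,Q\cdot\partial_\gamma\varphi-\Omega Q\cdot\varphi+Q\Omega\cdot\varphi\,dx\,dt=\int_{\mathbb{R}^2}\bar Q\cdot\varphi(0,x)\,dx+\Gamma\int_0^\infty\!\!\int_{\mathbb{R}^2}\Big\{-aQ+b\big[Q^2-\tfrac{\mathrm{tr}(Q^2)}{d}\mathrm{Id}\big]-cQ\,\mathrm{tr}(Q^2)\Big\}\cdot\varphi\,dx\,dt,$$ $$\int_0^\infty\!\!\int_{\mathbb{R}^2}-u_\alpha\partial_t\psi_\alpha-u_\alpha u_\beta\partial_\alpha\psi_\beta+\nu u_{\alpha,\beta}\psi_{\alpha,\beta}\,dx\,dt-\int_{\mathbb{R}^2}\bar u_\alpha\psi_\alpha(0,x)\,dx=L\int_0^\infty\!\!\int_{\mathbb{R}^2}\partial_\alpha Q_{\gamma\delta}\,\partial_\beta Q_{\gamma\delta}\,\psi_{\alpha,\beta}-Q_{\alpha\gamma}\Delta Q_{\gamma\beta}\psi_{\alpha,\beta}+\Delta Q_{\alpha\gamma}Q_{\gamma\beta}\psi_{\alpha,\beta}\,dx\,dt.$$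 (Multiples of $\mathrm{Id}$ do not contribute, since $\varphi$ is traceless and $\psi$ is divergence-free.) **Weak-strong uniqueness.** Let $s>1$, $\bar Q\in H^{s+1}(\mathbb{R}^2;S_0)$, $\bar u\in H^s(\mathbb{R}^2;\mathbb{R}^2)$ with $\nabla\cdot\bar u=0$. Let $(Q_1,u_1)$ be a weak solution with data $(\bar Q,\bar u)$, and let $(Q_2,u_2)$ be a strong solution with the same data, that is, a weak solution which in addition satisfies $$Q_2\in L^\infty_{loc}(\mathbb{R}_+;H^{s+1}(\mathbb{R}^2))\cap L^2_{loc}(\mathbb{R}_+;H^{s+2}(\mathbb{R}^2)),\qquad u_2\in L^\infty_{loc}(\mathbb{R}_+;H^s(\mathbb{R}^2))\cap L^2_{loc}(\mathbb{R}_+;H^{s+1}(\mathbb{R}^2)).$$ Then $(Q_1,u_1)=(Q_2,u_2)$, i.e. $Q_1(t,x)=Q_2(t,x)$ and $u_1(t,x)=u_2(t,x)$ for almost every $t>0$ and almost every $x\in\mathbb{R}^2$. -/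

import Mathlib

open MeasureTheory
open scoped ENNReal NNReal ContDiff FourierTransform

noncomputable section

/-- The Euclidean plane `ℝ²`. -/
abbrev Plane : Type := EuclideanSpace ℝ (Fin 2)

/-- Square real matrices of size `N`. -/
abbrev Mat (N : ℕ) : Type := Matrix (Fin N) (Fin N) ℝ

/-- The `Q`-tensors: symmetric traceless matrices. -/
def IsQTensor {N : ℕ} (A : Mat N) : Prop := A.IsSymm ∧ A.trace = 0

/-- A planar `2 × 2` tensor regarded as an `N × N` tensor: fields depend on the planar variables only
and the velocity is planar, so all other entries vanish. For `N = 2` this is the tensor itself. -/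
def pad (N : ℕ) (A : Mat 2) : Mat N := fun i j =>
  if h : i.val < 2 ∧ j.val < 2 then A ⟨i.val, h.1⟩ ⟨j.val, h.2⟩ else 0

/-! ### Calculus in the plane -/

/-- Classical partial derivative `∂ₖ η`. -/
def pd (k : Fin 2) (η : Plane → ℝ) (x : Plane) : ℝ :=
  fderiv ℝ η x (EuclideanSpace.single k 1)

/-- `g` is the weak partial derivative `∂ₖ f` on `ℝ²`. -/
def HasWeakPartial (k : Fin 2) (f g : Plane → ℝ) : Prop :=
  LocallyIntegrable f ∧ LocallyIntegrable g ∧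
    ∀ η : Plane → ℝ, ContDiff ℝ ∞ η → HasCompactSupport η →
      ∫ x, f x * pd k η x = -∫ x, g x * η x

/-- `∇ · v = 0` in the sense of distributions on `ℝ²`. -/
def WeakDivFree (v : Plane → Plane) : Prop :=
  ∀ η : Plane → ℝ, ContDiff ℝ ∞ η → HasCompactSupport η →
    ∫ x, ∑ k, v x k * pd k η x = 0

/-- The `L²(ℝ²)` norm, with values in `[0, ∞]`. -/
def normL2 (f : Plane → ℝ) : ℝ≥0∞ := eLpNorm f 2 volume

open Classical in
/-- The norm of `Hˢ(ℝ²)` for real `s ≥ 0`, with values in `[0, ∞]`, through the Fourier transform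
on `L²`:  `(∫ (1 + |ξ|²)ˢ |f̂(ξ)|² dξ)^(1/2)`, and `∞` if `f ∉ L²`. -/
def normHs (s : ℝ) (f : Plane → ℝ) : ℝ≥0∞ :=
  if h : MemLp (fun x => (f x : ℂ)) 2 (volume : Measure Plane) then
    (∫⁻ ξ : Plane, ENNReal.ofReal ((1 + ‖ξ‖ ^ 2) ^ s) *
      ‖(𝓕 (h.toLp (fun x => (f x : ℂ))) : Lp ℂ 2 (volume : Measure Plane)) ξ‖ₑ ^ 2) ^ (1 / 2 : ℝ)
  else ⊤

/-- Membership in `Hˢ(ℝ²)`, `s ≥ 0`. -/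
def MemHs (s : ℝ) (f : Plane → ℝ) : Prop := normHs s f < ⊤

/-! ### Functions of time and space -/

/-- Lebesgue measure on the time half-line. -/
def timeMeasure : Measure ℝ := volume.restrict (Set.Ioi 0)

/-- Joint measurability on `(0, ∞) × ℝ²`. -/
def SpaceTimeMeasurable (f : ℝ → Plane → ℝ) : Prop :=
  AEStronglyMeasurable (fun z : ℝ × Plane => f z.1 z.2)
    (timeMeasure.prod (volume : Measure Plane))

/-- `f ∈ L^∞_loc(ℝ₊; X)`, where `nrm` is the norm of `X` (equal to `∞` off `X`). -/
def InLinftyLoc (nrm : (Plane → ℝ) → ℝ≥0∞) (f : ℝ → Plane → ℝ) : Prop :=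
  SpaceTimeMeasurable f ∧
    ∀ T : ℝ, ∃ M : ℝ≥0, ∀ᵐ t ∂(volume.restrict (Set.Ioc 0 T)), nrm (f t) ≤ M

/-- `f ∈ L²_loc(ℝ₊; X)`, where `nrm` is the norm of `X` (equal to `∞` off `X`). -/
def InL2Loc (nrm : (Plane → ℝ) → ℝ≥0∞) (f : ℝ → Plane → ℝ) : Prop :=
  SpaceTimeMeasurable f ∧
    ∀ T : ℝ, ∫⁻ t in Set.Ioc 0 T, nrm (f t) ^ 2 < ⊤

/-- `g = ∂ₖ f` weakly in space, for almost every positive time. -/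
def HasWeakSpacePartial (k : Fin 2) (f g : ℝ → Plane → ℝ) : Prop :=
  ∀ᵐ t ∂timeMeasure, HasWeakPartial k (f t) (g t)

/-- `Q ∈ L^∞_loc(ℝ₊; H¹(ℝ²; S₀)) ∩ L²_loc(ℝ₊; H²(ℝ²; S₀))`, where `DQ k = ∂ₖ Q` and
`D2Q k l = ∂ₗ ∂ₖ Q` are its weak spatial derivatives. -/
structure QEnergyClass {N : ℕ} (Q : ℝ → Plane → Mat N)
    (DQ : Fin 2 → ℝ → Plane → Mat N) (D2Q : Fin 2 → Fin 2 → ℝ → Plane → Mat N) : Prop where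
  qtensor : ∀ᵐ t ∂timeMeasure, ∀ᵐ x : Plane, IsQTensor (Q t x)
  weak_first : ∀ k i j,
    HasWeakSpacePartial k (fun t x => Q t x i j) (fun t x => DQ k t x i j)
  weak_second : ∀ k l i j,
    HasWeakSpacePartial l (fun t x => DQ k t x i j) (fun t x => D2Q k l t x i j)
  bound_zero : ∀ i j, InLinftyLoc normL2 (fun t x => Q t x i j)
  bound_first : ∀ k i j, InLinftyLoc normL2 (fun t x => DQ k t x i j)
  bound_second : ∀ k l i j, InL2Loc normL2 (fun t x => D2Q k l t x i j)

/-- `u ∈ L^∞_loc(ℝ₊; L²(ℝ²; ℝ²)) ∩ L²_loc(ℝ₊; H¹(ℝ²; ℝ²))`, with `∇ · u = 0`, where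
`Du t x α β = ∂_β u_α` is the weak velocity gradient. -/
structure UEnergyClass (u : ℝ → Plane → Plane) (Du : ℝ → Plane → Mat 2) : Prop where
  weak_grad : ∀ α β, HasWeakSpacePartial β (fun t x => u t x α) (fun t x => Du t x α β)
  bound_zero : ∀ α, InLinftyLoc normL2 (fun t x => u t x α)
  bound_grad : ∀ α β, InL2Loc normL2 (fun t x => Du t x α β)
  div_free : ∀ᵐ t ∂timeMeasure, ∀ᵐ x : Plane, (Du t x).trace = 0

/-- The antisymmetric part `Ω_{αβ} = (∂_β u_α - ∂_α u_β) / 2` of the velocity gradient. -/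
def vorticity (Du : ℝ → Plane → Mat 2) (t : ℝ) (x : Plane) : Mat 2 :=
  (1 / 2 : ℝ) • (Du t x - (Du t x).transpose)

/-- `ΔQ`. -/
def lap {N : ℕ} (D2Q : Fin 2 → Fin 2 → ℝ → Plane → Mat N) (t : ℝ) (x : Plane) : Mat N :=
  ∑ k, D2Q k k t x

/-! ### Test functions -/

/-- Compactly supported smooth `φ : [0, ∞) × ℝ² → S₀` (given as restrictions to `t ≥ 0` of such
functions on `ℝ × ℝ²`). -/
structure IsQTest {N : ℕ} (φ : ℝ → Plane → Mat N) : Prop where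
  smooth : ∀ i j, ContDiff ℝ ∞ (fun z : ℝ × Plane => φ z.1 z.2 i j)
  compact : ∀ i j, HasCompactSupport (fun z : ℝ × Plane => φ z.1 z.2 i j)
  qtensor : ∀ t x, IsQTensor (φ t x)

/-- Compactly supported smooth `ψ : [0, ∞) × ℝ² → ℝ²` with `∇ · ψ = 0` (given as restrictions to
`t ≥ 0` of such functions on `ℝ × ℝ²`). -/
structure IsUTest (ψ : ℝ → Plane → Plane) : Prop where
  smooth : ∀ α, ContDiff ℝ ∞ (fun z : ℝ × Plane => ψ z.1 z.2 α)
  compact : ∀ α, HasCompactSupport (fun z : ℝ × Plane => ψ z.1 z.2 α)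
  div_free : ∀ t x, ∑ k, pd k (fun y => ψ t y k) x = 0

/-- `∂ₜ φ`, entrywise. -/
def matDt {N : ℕ} (φ : ℝ → Plane → Mat N) (t : ℝ) (x : Plane) : Mat N :=
  fun i j => deriv (fun r => φ r x i j) t

/-- `∂ₖ φ`, entrywise. -/
def matDx {N : ℕ} (k : Fin 2) (φ : ℝ → Plane → Mat N) (t : ℝ) (x : Plane) : Mat N :=
  fun i j => pd k (fun y => φ t y i j) x

/-- The gradient `ψ_{α,β} = ∂_β ψ_α`. -/
def vecGrad (ψ : ℝ → Plane → Plane) (t : ℝ) (x : Plane) : Mat 2 :=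
  fun α β => pd β (fun y => ψ t y α) x

/-! ### The coupled system for `d = 2` -/

/-- The zeroth order part of the molecular field,
`-a Q + b (Q² - (tr Q² / d) Id) - c Q tr Q²` with `d = 2`. -/
def bulk {N : ℕ} (a b c : ℝ) (A : Mat N) : Mat N :=
  -(a • A) + b • (A * A - ((A * A).trace / 2) • (1 : Mat N)) - (c * (A * A).trace) • A

/-- The weak form of
`∂ₜ Q + u · ∇Q - ΩQ + QΩ = Γ (L ΔQ - aQ + b (Q² - (tr Q² / d) Id) - c Q tr Q²)`, `Q(0) = Qbar`. -/
def QEquation {N : ℕ} (a b c Γ L : ℝ) (Qbar : Plane → Mat N) (Q : ℝ → Plane → Mat N)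
    (D2Q : Fin 2 → Fin 2 → ℝ → Plane → Mat N) (u : ℝ → Plane → Plane)
    (Du : ℝ → Plane → Mat 2) : Prop :=
  ∀ φ : ℝ → Plane → Mat N, IsQTest φ →
    ∫ t in Set.Ioi (0 : ℝ), ∫ x : Plane,
        (-(Q t x * matDt φ t x).trace
          - Γ * L * (lap D2Q t x * φ t x).trace
          - ∑ k, u t x k * (Q t x * matDx k φ t x).trace
          - (pad N (vorticity Du t x) * Q t x * φ t x).trace
          + (Q t x * pad N (vorticity Du t x) * φ t x).trace)
      = (∫ x : Plane, (Qbar x * φ 0 x).trace)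
        + Γ * ∫ t in Set.Ioi (0 : ℝ), ∫ x : Plane, (bulk a b c (Q t x) * φ t x).trace

/-- The weak form of `∂ₜ u + u · ∇u = ν Δu + ∇p - L ∇ · (∇Q ⊙ ∇Q - (|∇Q|² / d) Id)
+ L ∇ · (Q ΔQ - ΔQ Q)`, `u(0) = ubar`, tested against solenoidal fields. -/
def UEquation {N : ℕ} (L ν : ℝ) (ubar : Plane → Plane) (Q : ℝ → Plane → Mat N)
    (DQ : Fin 2 → ℝ → Plane → Mat N) (D2Q : Fin 2 → Fin 2 → ℝ → Plane → Mat N)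
    (u : ℝ → Plane → Plane) (Du : ℝ → Plane → Mat 2) : Prop :=
  ∀ ψ : ℝ → Plane → Plane, IsUTest ψ →
    (∫ t in Set.Ioi (0 : ℝ), ∫ x : Plane,
        (-(∑ α, u t x α * deriv (fun r => ψ r x α) t)
          - (∑ α, ∑ β, u t x α * u t x β * vecGrad ψ t x β α)
          + ν * ∑ α, ∑ β, Du t x α β * vecGrad ψ t x α β))
      - (∫ x : Plane, ∑ α, ubar x α * ψ 0 x α)
      = L * ∫ t in Set.Ioi (0 : ℝ), ∫ x : Plane,
          ((∑ α, ∑ β, (∑ i, ∑ j, DQ α t x i j * DQ β t x i j) * vecGrad ψ t x α β)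
            - (∑ i, ∑ j, (Q t x * lap D2Q t x) i j * pad N (vecGrad ψ t x) i j)
            + ∑ i, ∑ j, (lap D2Q t x * Q t x) i j * pad N (vecGrad ψ t x) i j)

/-- `(Q, u)` is a weak solution on `[0, ∞) × ℝ²` with initial data `(Qbar, ubar)`. -/
def IsWeakSolution {N : ℕ} (a b c Γ L ν : ℝ) (Qbar : Plane → Mat N) (ubar : Plane → Plane)
    (Q : ℝ → Plane → Mat N) (u : ℝ → Plane → Plane) : Prop :=
  ∃ (DQ : Fin 2 → ℝ → Plane → Mat N) (D2Q : Fin 2 → Fin 2 → ℝ → Plane → Mat N)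
    (Du : ℝ → Plane → Mat 2),
    QEnergyClass Q DQ D2Q ∧ UEnergyClass u Du ∧
      QEquation a b c Γ L Qbar Q D2Q u Du ∧ UEquation L ν ubar Q DQ D2Q u Du

/-- `(Q, u)` is a solution with initial data `(Qbar, ubar)` and the additional regularity
`Q ∈ L^∞_loc(ℝ₊; H^{s+1}) ∩ L²_loc(ℝ₊; H^{s+2})`, `u ∈ L^∞_loc(ℝ₊; H^s) ∩ L²_loc(ℝ₊; H^{s+1})`. -/
structure IsStrongSolution {N : ℕ} (s a b c Γ L ν : ℝ) (Qbar : Plane → Mat N)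
    (ubar : Plane → Plane) (Q : ℝ → Plane → Mat N) (u : ℝ → Plane → Plane) : Prop where
  solves : IsWeakSolution a b c Γ L ν Qbar ubar Q u
  Q_bounded : ∀ i j, InLinftyLoc (normHs (s + 1)) (fun t x => Q t x i j)
  Q_square : ∀ i j, InL2Loc (normHs (s + 2)) (fun t x => Q t x i j)
  u_bounded : ∀ α, InLinftyLoc (normHs s) (fun t x => u t x α)
  u_square : ∀ α, InL2Loc (normHs (s + 1)) (fun t x => u t x α)

end

/-!
Let `R = Q₁ - Q₂`, `v = u₁ - u₂` and `w = (1 - Δ)⁻¹ v`. The two solutions are compared in a norm one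
derivative below the natural energy: the relative energy is `L ‖R‖² + ⟨v, w⟩`, an `L²` norm for the
tensor and an `H⁻¹` norm for the velocity, and its dissipation is
`Γ L² ‖∇R‖² + ν (‖∇w‖² + ‖∇²w‖²)`, up to a factor two.

At this level almost every term of the energy balance is trilinear, with one factor bounded by the
energy, one by the dissipation or the energy, and a coefficient taken from the two solutions. Such
terms are absorbed by Hölder's inequality, Ladyzhenskaya's inequality `‖f‖₄² ≲ ‖f‖₂ ‖∇f‖₂` in the
plane (`exists_ladyzhenskaya`) and Young's inequality; `Scale.Ctrl` is the class of terms bounded by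
`ε (d + e) + C(ε) a e`, for the dissipation `d`, the energy `e` and a coefficient `a` that is
integrable in time (`WeakFlow.timeLp_weight`). Two terms are of too high an order: the corotational
term `[Ω₁ - Ω₂, Q₂] · R` and the elastic stress `[Q₂, ΔR] : ∇w`. After two integrations by parts the
Laplacian in the second falls on `∇w`, and `-Δ∇w = ∇v - ∇w` turns it into `[Q₂, R] : ∇v` up to
controlled terms (`WeakFlow.ctrl_laplacian`). As the corotational term is the adjoint of the
antisymmetric stress (`WeakFlow.frob_comm_antisymm`), the two cancel; this is
`WeakFlow.ctrl_balance`.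

The energy balance has to be derived from the distributional equations. For the tensor the identity
is `WeakFlow.energy_identity_Q`. For the velocity only divergence free test functions are available,
so the equation is tested with `∇^⊥η`, which gives the distributional equation for the curl and
removes the pressure. On the Fourier side the operator `(-Δ)^{-1/2} (1 - Δ)^{-1/2} curl` maps a
solenoidal `v` to a function whose `L²` norm squared is `⟨v, w⟩` (`norm_sq_curlOp`), while the same
operator applied to the divergence of a stress in `L²` is again in `L²`, and pairs with the former
as the stress with `∇w` (`inner_curlOp_curlDivOp`); hence `WeakFlow.energy_identity_u`. Regularity
in time is obtained from the equations as well: a path in a Hilbert space whose distributional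
derivative is integrable and whose initial value vanishes is almost everywhere the primitive of that
derivative (`ae_eq_primitive_of_forall_test`), so that the chain rule of `norm_sq_primitive`
applies. The right-hand sides are integrable in time with values in `L²` by Ladyzhenskaya's
inequality and by the embedding `H² ⊂ L^∞`, which follows from the square integrability of the
symbol of `(1 - Δ)⁻¹` (`exists_res_bound`).

Gronwall's inequality, for functions that satisfy it only almost everywhere, shows that the relative
energy vanishes (`WeakFlow.ae_energy_eq_zero`), and the resolvent is injective.
-/

open scoped ENNReal NNReal ContDiff FourierTransform

noncomputable section

open SchwartzMap Filter Topology LineDeriv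

/-! ### Compactly supported functions in Schwartz space -/

/-- Smooth compactly supported functions are dense in Schwartz space: `κ` is the limit of
`χ(x/n) κ` for a bump function `χ`. -/
theorem schwartz_dense_hasCompactSupport :
    Dense {κ : 𝓢(Plane, ℂ) | HasCompactSupport κ} := by
  intro κ
  let b : ContDiffBump (0 : Plane) := ⟨1, 2, one_pos, one_lt_two⟩
  have hbs : ContDiff ℝ ∞ (b : Plane → ℝ) := b.contDiff
  let β : Plane → ℝ := fun x => b x - 1
  have hβs : ContDiff ℝ ∞ β := hbs.sub contDiff_const
  have hbd : ∀ i : ℕ, ∃ C, ∀ x, ‖iteratedFDeriv ℝ i β x‖ ≤ C := by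
    intro i
    have hb : ∃ C, ∀ x, ‖iteratedFDeriv ℝ i (b : Plane → ℝ) x‖ ≤ C :=
      (b.hasCompactSupport.iteratedFDeriv i).exists_bound_of_continuous
        (hbs.of_le (mod_cast le_top)).continuous_iteratedFDeriv'
    obtain ⟨C, hC⟩ := hb
    rcases Nat.eq_zero_or_pos i with rfl | hi
    · refine ⟨1, fun x => ?_⟩
      have h1 := b.nonneg (x := x)
      have h2 := b.le_one (x := x)
      simp only [norm_iteratedFDeriv_zero, β, Real.norm_eq_abs]
      rw [abs_le]; constructor <;> linarith
    · refine ⟨C, fun x => ?_⟩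
      have hsub : iteratedFDeriv ℝ i β x = iteratedFDeriv ℝ i (b : Plane → ℝ) x := by
        have := iteratedFDeriv_sub_apply (𝕜 := ℝ) (i := i) (x := x)
          (f := (b : Plane → ℝ)) (g := fun _ => (1 : ℝ))
          ((hbs.of_le (mod_cast le_top)).contDiffAt) contDiffAt_const
        rw [iteratedFDeriv_const_of_ne hi.ne'] at this
        simpa [β, Pi.sub_def] using this
      rw [hsub]; exact hC x
  choose C hC using hbd
  have hC0 : ∀ i, 0 ≤ C i := fun i => (norm_nonneg _).trans (hC i 0)
  let χ : ℕ → Plane → ℝ := fun n x => b (((n : ℝ) + 1)⁻¹ • x)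
  have hχs : ∀ n, ContDiff ℝ ∞ (χ n) := fun n => hbs.comp (contDiff_const_smul _)
  have hχc : ∀ n, HasCompactSupport (χ n) := fun n =>
    b.hasCompactSupport.comp_smul (inv_ne_zero (by positivity))
  have hp : ∀ n, HasCompactSupport (fun x => χ n x • κ x) := fun n => (hχc n).smul_right
  have hps : ∀ n, ContDiff ℝ ∞ (fun x => χ n x • κ x) := fun n => (hχs n).smul (κ.smooth ⊤)
  let κn : ℕ → 𝓢(Plane, ℂ) := fun n => (hp n).toSchwartzMap (hps n)
  refine mem_closure_of_tendsto (f := κn) (b := atTop) ?_ (Eventually.of_forall fun n => hp n)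
  rw [(schwartz_withSeminorms ℝ Plane ℂ).tendsto_nhds_atTop]
  rintro ⟨k, m⟩ ε hε
  let M : ℝ := ∑ i ∈ Finset.range (m + 1),
    (m.choose i : ℝ) * C i * SchwartzMap.seminorm ℝ (k + 1) (m - i) κ
  have hM : 0 ≤ M := Finset.sum_nonneg fun i _ =>
    mul_nonneg (mul_nonneg (by positivity) (hC0 i)) (apply_nonneg _ _)
  obtain ⟨n0, hn0⟩ := exists_nat_gt (M / ε)
  refine ⟨n0, fun n hn => ?_⟩
  have hnp : (0 : ℝ) < (n : ℝ) + 1 := by positivity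
  have hlt : M / ((n : ℝ) + 1) < ε := by
    rw [div_lt_iff₀ hnp]
    rw [div_lt_iff₀ hε] at hn0
    have : (n0 : ℝ) ≤ n := by exact_mod_cast hn
    nlinarith
  refine lt_of_le_of_lt ?_ hlt
  refine SchwartzMap.seminorm_le_bound ℝ k m _ (by positivity) fun x => ?_
  have hfun : (⇑(κn n - κ) : Plane → ℂ) = fun y => β (((n : ℝ) + 1)⁻¹ • y) • κ y := by
    funext y
    change χ n y • κ y - κ y = _
    simp only [χ, β, sub_smul, one_smul]
  rw [hfun]
  by_cases hx : ‖x‖ < (n : ℝ) + 1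
  · have hz : (fun y => β (((n : ℝ) + 1)⁻¹ • y) • κ y) =ᶠ[𝓝 x] fun _ => 0 := by
      filter_upwards [(isOpen_lt continuous_norm continuous_const).mem_nhds hx] with y hy
      have : b (((n : ℝ) + 1)⁻¹ • y) = 1 := by
        apply b.one_of_mem_closedBall
        simp only [mem_closedBall_zero_iff, norm_smul, norm_inv, Real.norm_eq_abs,
          abs_of_pos hnp]
        rw [inv_mul_le_iff₀ hnp]
        simpa [b] using le_of_lt hy
      simp [β, this]
    rw [(hz.iteratedFDeriv ℝ m).self_of_nhds]
    have : iteratedFDeriv ℝ m (fun _ : Plane => (0 : ℂ)) x = 0 := by simp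
    rw [this, norm_zero, mul_zero]
    positivity
  · push Not at hx
    have hle := norm_iteratedFDeriv_smul_le (𝕜 := ℝ) (N := ∞)
      (f := fun y => β (((n : ℝ) + 1)⁻¹ • y)) (g := κ)
      (hβs.comp (contDiff_const_smul _)) (κ.smooth ⊤) x (n := m) (mod_cast le_top)
    rw [le_div_iff₀ hnp]
    calc ‖x‖ ^ k * ‖iteratedFDeriv ℝ m (fun y => β (((n : ℝ) + 1)⁻¹ • y) • κ y) x‖ * (n + 1)
        ≤ ‖x‖ ^ k * (∑ i ∈ Finset.range (m + 1), (m.choose i : ℝ) *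
          ‖iteratedFDeriv ℝ i (fun y => β (((n : ℝ) + 1)⁻¹ • y)) x‖ *
            ‖iteratedFDeriv ℝ (m - i) κ x‖) * ‖x‖ := by gcongr
      _ = ∑ i ∈ Finset.range (m + 1), (m.choose i : ℝ) *
          ‖iteratedFDeriv ℝ i (fun y => β (((n : ℝ) + 1)⁻¹ • y)) x‖ *
            (‖x‖ ^ (k + 1) * ‖iteratedFDeriv ℝ (m - i) κ x‖) := by
          rw [Finset.mul_sum, Finset.sum_mul]
          exact Finset.sum_congr rfl fun i _ => by ring
      _ ≤ M := by
          refine Finset.sum_le_sum fun i _ => ?_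
          have h1 : ‖iteratedFDeriv ℝ i (fun y => β (((n : ℝ) + 1)⁻¹ • y)) x‖ ≤ C i := by
            rw [iteratedFDeriv_comp_const_smul _ (hβs.of_le (mod_cast le_top)), norm_smul]
            refine (mul_le_of_le_one_left (norm_nonneg _) ?_).trans (hC i _)
            rw [norm_pow, norm_inv, Real.norm_eq_abs, abs_of_pos hnp]
            exact pow_le_one₀ (by positivity)
              (inv_le_one_of_one_le₀ (by linarith [n.cast_nonneg (α := ℝ)]))
          have h2 := SchwartzMap.le_seminorm ℝ (k + 1) (m - i) κ x
          have := hC0 i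
          gcongr

/-- A tempered distribution that vanishes on real smooth compactly supported functions is zero. -/
theorem temperedDistribution_eq_zero {T : 𝓢'(Plane, ℂ)}
    (h : ∀ (η : Plane → ℝ) (hη : ContDiff ℝ ∞ η) (hc : HasCompactSupport η),
      T ((hc.comp_left Complex.ofReal_zero : HasCompactSupport (fun x => (η x : ℂ))).toSchwartzMap
        (Complex.ofRealCLM.contDiff.comp hη)) = 0) : T = 0 := by
  ext κ
  have hcont : Continuous (fun κ : 𝓢(Plane, ℂ) => T κ) := T.continuous
  refine congrFun (hcont.ext_on schwartz_dense_hasCompactSupport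
    (continuous_const (y := (0 : ℂ))) ?_) κ
  intro κ (hκ : HasCompactSupport κ)
  have hre : ContDiff ℝ ∞ (fun x => (κ x).re) := Complex.reCLM.contDiff.comp (κ.smooth ⊤)
  have him : ContDiff ℝ ∞ (fun x => (κ x).im) := Complex.imCLM.contDiff.comp (κ.smooth ⊤)
  have hrec : HasCompactSupport (fun x => (κ x).re) := hκ.comp_left (g := Complex.re) rfl
  have himc : HasCompactSupport (fun x => (κ x).im) := hκ.comp_left (g := Complex.im) rfl
  have hdec : κ = (hrec.comp_left Complex.ofReal_zero : HasCompactSupport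
        (fun x => ((κ x).re : ℂ))).toSchwartzMap (Complex.ofRealCLM.contDiff.comp hre)
      + Complex.I • (himc.comp_left Complex.ofReal_zero : HasCompactSupport
        (fun x => ((κ x).im : ℂ))).toSchwartzMap (Complex.ofRealCLM.contDiff.comp him) := by
    ext x
    change κ x = ((κ x).re : ℂ) + Complex.I • ((κ x).im : ℂ)
    rw [smul_eq_mul, mul_comm, Complex.re_add_im]
  change T κ = 0
  rw [hdec, map_add, map_smul, h _ hre hrec, h _ him himc]
  simp

/-! ### Weak derivatives and the Fourier transform on `L²` -/

/-- Real square integrable functions on the plane. -/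
abbrev L2R : Type := Lp ℝ 2 (volume : Measure Plane)

/-- Complex square integrable functions on the plane. -/
abbrev L2C : Type := Lp ℂ 2 (volume : Measure Plane)

/-- The inclusion of the real `L²` into the complex one. -/
def toL2C : L2R →L[ℝ] L2C := Complex.ofRealCLM.compLpL 2 volume

/-- The real part, as a map of `L²` spaces. -/
def reL2 : L2C →L[ℝ] L2R := Complex.reCLM.compLpL 2 volume

theorem coeFn_toL2C (f : L2R) : toL2C f =ᵐ[volume] fun x => (f x : ℂ) :=
  Complex.ofRealCLM.coeFn_compLpL f

theorem coeFn_reL2 (f : L2C) : reL2 f =ᵐ[volume] fun x => (f x).re :=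
  Complex.reCLM.coeFn_compLpL f

theorem reL2_toL2C (f : L2R) : reL2 (toL2C f) = f := by
  apply Lp.ext
  filter_upwards [coeFn_reL2 (toL2C f), coeFn_toL2C f] with x h1 h2
  rw [h1, h2, Complex.ofReal_re]

theorem locallyIntegrable_L2 {E : Type*} [NormedAddCommGroup E]
    (f : Lp E 2 (volume : Measure Plane)) : LocallyIntegrable f volume :=
  (Lp.memLp f).locallyIntegrable one_le_two

/-- The Fourier symbol `2 π i ξₖ` of `∂ₖ`. -/
def sym (k : Fin 2) (ξ : Plane) : ℂ := 2 * Real.pi * Complex.I * (ξ k : ℂ)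

theorem continuous_sym (k : Fin 2) : Continuous (sym k) := by
  unfold sym; fun_prop

/-- A real test function, regarded as a complex Schwartz function. -/
def testSchwartz (η : Plane → ℝ) (hη : ContDiff ℝ ∞ η) (hc : HasCompactSupport η) :
    𝓢(Plane, ℂ) :=
  (hc.comp_left Complex.ofReal_zero : HasCompactSupport (fun x => (η x : ℂ))).toSchwartzMap
    (Complex.ofRealCLM.contDiff.comp hη)

theorem testSchwartz_apply (η : Plane → ℝ) (hη : ContDiff ℝ ∞ η) (hc : HasCompactSupport η)
    (x : Plane) : testSchwartz η hη hc x = (η x : ℂ) := rfl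

theorem lineDeriv_eq_of_ofReal {κ : 𝓢(Plane, ℂ)} {η : Plane → ℝ} (hη : Differentiable ℝ η)
    (h : ∀ x, κ x = (η x : ℂ)) (k : Fin 2) (x : Plane) :
    (∂_{(EuclideanSpace.single k 1 : Plane)} κ) x = (pd k η x : ℂ) := by
  rw [SchwartzMap.lineDerivOp_apply_eq_fderiv]
  have h1 : (κ : Plane → ℂ) = fun x => Complex.ofRealCLM (η x) := funext h
  have h2 : HasFDerivAt (fun x => Complex.ofRealCLM (η x))
      (Complex.ofRealCLM.comp (fderiv ℝ η x)) x :=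
    Complex.ofRealCLM.hasFDerivAt.comp x (hη x).hasFDerivAt
  rw [h1, h2.fderiv]
  rfl

theorem contDiff_pd {η : Plane → ℝ} (hη : ContDiff ℝ ∞ η) (k : Fin 2) : ContDiff ℝ ∞ (pd k η) := by
  unfold pd
  exact (hη.fderiv_right (m := ∞) (by simp)).clm_apply contDiff_const

theorem hasCompactSupport_pd {η : Plane → ℝ} (hη : HasCompactSupport η) (k : Fin 2) :
    HasCompactSupport (pd k η) :=
  hη.fderiv_apply ℝ (EuclideanSpace.single k (1 : ℝ))

/-- The tempered distribution `T` restricted to compactly supported test functions is the locally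
integrable function `F`. -/
def IsRepr (T : 𝓢'(Plane, ℂ)) (F : Plane → ℂ) : Prop :=
  LocallyIntegrable F volume ∧ ∀ κ : 𝓢(Plane, ℂ), HasCompactSupport κ → T κ = ∫ x, κ x • F x

theorem IsRepr.add {T S : 𝓢'(Plane, ℂ)} {F G : Plane → ℂ} (hT : IsRepr T F) (hS : IsRepr S G) :
    IsRepr (T + S) (fun x => F x + G x) := by
  refine ⟨hT.1.add hS.1, fun κ hκ => ?_⟩
  simp only [smul_add]
  rw [integral_add (hT.1.integrable_smul_left_of_hasCompactSupport κ.continuous hκ)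
    (hS.1.integrable_smul_left_of_hasCompactSupport κ.continuous hκ), ← hT.2 κ hκ, ← hS.2 κ hκ]
  rfl

theorem isRepr_zero : IsRepr 0 (fun _ => 0) :=
  ⟨locallyIntegrable_zero, fun κ _ => by simp⟩

theorem IsRepr.smul {T : 𝓢'(Plane, ℂ)} {F : Plane → ℂ} (hT : IsRepr T F) (c : ℂ) :
    IsRepr (c • T) (fun x => c * F x) := by
  refine ⟨hT.1.smul c, fun κ hκ => ?_⟩
  have h : (c • T) κ = c • T κ := rfl
  rw [h, hT.2 κ hκ, ← integral_smul]
  refine integral_congr_ae (.of_forall fun x => ?_)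
  simp only [smul_eq_mul]; ring

theorem IsRepr.sum {ι : Type*} (s : Finset ι) {T : ι → 𝓢'(Plane, ℂ)} {F : ι → Plane → ℂ}
    (h : ∀ i ∈ s, IsRepr (T i) (F i)) : IsRepr (∑ i ∈ s, T i) (fun x => ∑ i ∈ s, F i x) := by
  classical
  induction s using Finset.induction_on with
  | empty => simpa using isRepr_zero
  | insert a s ha ih =>
    simp only [Finset.sum_insert ha]
    exact (h a (Finset.mem_insert_self a s)).add
      (ih fun i hi => h i (Finset.mem_insert_of_mem hi))

theorem IsRepr.ae_eq {T : 𝓢'(Plane, ℂ)} {F G : Plane → ℂ} (hF : IsRepr T F) (hG : IsRepr T G) :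
    F =ᵐ[volume] G := by
  refine ae_eq_of_integral_contDiff_smul_eq hF.1 hG.1 fun η hη hc => ?_
  have h1 := hF.2 (testSchwartz η hη hc) (hc.comp_left Complex.ofReal_zero)
  have h2 := hG.2 (testSchwartz η hη hc) (hc.comp_left Complex.ofReal_zero)
  rw [h1] at h2
  simpa [testSchwartz_apply] using h2

theorem isRepr_coe (f : L2C) : IsRepr (f : 𝓢'(Plane, ℂ)) f :=
  ⟨locallyIntegrable_L2 f, fun κ _ => Lp.toTemperedDistribution_apply f κ⟩

theorem isRepr_fourier (f : L2C) :
    IsRepr (𝓕 (f : 𝓢'(Plane, ℂ))) (𝓕 f : L2C) := by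
  rw [Lp.fourier_toTemperedDistribution_eq]
  exact isRepr_coe _

theorem inner_single (ξ : Plane) (k : Fin 2) :
    inner ℝ ξ (EuclideanSpace.single k 1 : Plane) = ξ k := by
  simp [EuclideanSpace.inner_single_right]

theorem fourier_lineDeriv_apply (T : 𝓢'(Plane, ℂ)) (k : Fin 2) (κ : 𝓢(Plane, ℂ)) :
    (𝓕 (∂_{(EuclideanSpace.single k 1 : Plane)} T)) κ
      = 𝓕 T (SchwartzMap.smulLeftCLM ℂ (sym k) κ) := by
  have hgr : (fun x : Plane =>
      (inner ℝ x (EuclideanSpace.single k 1 : Plane) : ℝ)).HasTemperateGrowth := by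
    fun_prop
  have hgc : (fun x : Plane =>
      ((inner ℝ x (EuclideanSpace.single k 1 : Plane) : ℝ) : ℂ)).HasTemperateGrowth := by
    fun_prop
  rw [TemperedDistribution.fourier_lineDerivOp_eq]
  have hs : sym k = (2 * Real.pi * Complex.I) •
      (fun x : Plane => ((inner ℝ x (EuclideanSpace.single k 1 : Plane) : ℝ) : ℂ)) := by
    funext x
    simp only [sym, Pi.smul_apply, inner_single, smul_eq_mul]
  rw [hs, SchwartzMap.smulLeftCLM_smul hgc]
  change _ = (𝓕 T) ((2 * Real.pi * Complex.I) • _)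
  rw [map_smul]
  rfl

theorem sym_hasTemperateGrowth (k : Fin 2) : (sym k).HasTemperateGrowth := by
  have hs : sym k = fun x : Plane => (2 * Real.pi * Complex.I) *
      ((inner ℝ x (EuclideanSpace.single k 1 : Plane) : ℝ) : ℂ) := by
    funext x
    simp only [sym, inner_single]
  rw [hs]
  fun_prop

theorem IsRepr.fourier_lineDeriv {T : 𝓢'(Plane, ℂ)} {F : Plane → ℂ} (h : IsRepr (𝓕 T) F)
    (k : Fin 2) : IsRepr (𝓕 (∂_{(EuclideanSpace.single k 1 : Plane)} T))
      (fun ξ => sym k ξ * F ξ) := by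
  have hap : ∀ (κ : 𝓢(Plane, ℂ)) (x : Plane),
      SchwartzMap.smulLeftCLM ℂ (sym k) κ x = sym k x • κ x :=
    fun κ x => SchwartzMap.smulLeftCLM_apply_apply (sym_hasTemperateGrowth k) κ x
  refine ⟨?_, fun κ hκ => ?_⟩
  · rw [locallyIntegrable_iff]
    intro K hK
    exact ((locallyIntegrable_iff.1 h.1 K hK).continuousOn_mul
      (continuous_sym k).continuousOn hK :)
  · have hκ' : HasCompactSupport (SchwartzMap.smulLeftCLM ℂ (sym k) κ) := by
      have : (SchwartzMap.smulLeftCLM ℂ (sym k) κ : Plane → ℂ) = fun x => sym k x * κ x :=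
        funext (hap κ)
      rw [this]
      exact HasCompactSupport.mul_left (f := sym k) (f' := κ) hκ
    rw [fourier_lineDeriv_apply, h.2 _ hκ']
    refine integral_congr_ae (.of_forall fun x => ?_)
    simp only [hap, smul_eq_mul]; ring

theorem toL2C_coe_apply (f : L2R) (κ : 𝓢(Plane, ℂ)) {η : Plane → ℝ} (h : ∀ x, κ x = (η x : ℂ)) :
    (toL2C f : 𝓢'(Plane, ℂ)) κ = ((∫ x, f x * η x : ℝ) : ℂ) := by
  rw [Lp.toTemperedDistribution_apply, ← integral_complex_ofReal]
  refine integral_congr_ae ?_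
  filter_upwards [coeFn_toL2C f] with x hx
  rw [hx, h x, smul_eq_mul]; push_cast; ring

/-- Weak differentiation is multiplication by `2 π i ξₖ` on the Fourier side. -/
theorem HasWeakPartial.fourier {k : Fin 2} {f g : L2R} (h : HasWeakPartial k f g) :
    (𝓕 (toL2C g) : L2C) =ᵐ[volume] fun ξ => sym k ξ * (𝓕 (toL2C f) : L2C) ξ := by
  have hT : ∂_{(EuclideanSpace.single k 1 : Plane)} (toL2C f : 𝓢'(Plane, ℂ))
      - (toL2C g : 𝓢'(Plane, ℂ)) = 0 := by
    refine temperedDistribution_eq_zero fun η hη hc => ?_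
    change (toL2C f : 𝓢'(Plane, ℂ)) (-∂_{(EuclideanSpace.single k 1 : Plane)}
      (testSchwartz η hη hc)) - (toL2C g : 𝓢'(Plane, ℂ)) (testSchwartz η hη hc) = 0
    rw [map_neg, toL2C_coe_apply f _ (lineDeriv_eq_of_ofReal (hη.differentiable (by simp))
      (testSchwartz_apply η hη hc) k), toL2C_coe_apply g _ (testSchwartz_apply η hη hc),
      h.2.2 η hη hc]
    simp
  rw [sub_eq_zero] at hT
  have h1 := (isRepr_fourier (toL2C f)).fourier_lineDeriv k
  rw [hT] at h1
  exact (isRepr_fourier (toL2C g)).ae_eq h1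

/-- Conversely, multiplication by `2 π i ξₖ` on the Fourier side is weak differentiation, also of
the real parts. No symmetry of `F` and `G` is needed, since taking real parts commutes with `∂ₖ`. -/
theorem hasWeakPartial_re_of_fourier {k : Fin 2} {F G : L2C}
    (h : (𝓕 G : L2C) =ᵐ[volume] fun ξ => sym k ξ * (𝓕 F : L2C) ξ) :
    HasWeakPartial k (reL2 F) (reL2 G) := by
  have hT : ∂_{(EuclideanSpace.single k 1 : Plane)} (F : 𝓢'(Plane, ℂ)) = (G : 𝓢'(Plane, ℂ)) := by
    have hinj : Function.Injective (fun T : 𝓢'(Plane, ℂ) => 𝓕 T) := by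
      intro T S hTS
      have : 𝓕⁻ (𝓕 T) = 𝓕⁻ (𝓕 S) := congrArg _ hTS
      simpa using this
    apply hinj
    ext κ
    change (𝓕 (∂_{(EuclideanSpace.single k 1 : Plane)} (F : 𝓢'(Plane, ℂ)))) κ =
      (𝓕 (G : 𝓢'(Plane, ℂ))) κ
    rw [fourier_lineDeriv_apply, Lp.fourier_toTemperedDistribution_eq,
      Lp.fourier_toTemperedDistribution_eq, Lp.toTemperedDistribution_apply,
      Lp.toTemperedDistribution_apply]
    refine integral_congr_ae ?_
    filter_upwards [h] with x hx
    rw [SchwartzMap.smulLeftCLM_apply_apply (sym_hasTemperateGrowth k), hx]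
    simp only [smul_eq_mul]; ring
  refine ⟨locallyIntegrable_L2 _, locallyIntegrable_L2 _, fun η hη hc => ?_⟩
  have h1 : (F : 𝓢'(Plane, ℂ)) (-∂_{(EuclideanSpace.single k 1 : Plane)} (testSchwartz η hη hc))
      = (G : 𝓢'(Plane, ℂ)) (testSchwartz η hη hc) := by rw [← hT]; rfl
  rw [map_neg, Lp.toTemperedDistribution_apply, Lp.toTemperedDistribution_apply] at h1
  have hint : ∀ (H : L2C) (ζ : Plane → ℝ), Continuous ζ → HasCompactSupport ζ →
      ∫ x, reL2 H x * ζ x = (∫ x, (ζ x : ℂ) • H x).re := by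
    intro H ζ hζ hζc
    have hi : Integrable (fun x => (ζ x : ℂ) • H x) volume :=
      (locallyIntegrable_L2 H).integrable_smul_left_of_hasCompactSupport
        (Complex.continuous_ofReal.comp hζ) (hζc.comp_left Complex.ofReal_zero)
    have := integral_re hi
    simp only [RCLike.re_to_complex] at this
    rw [← this]
    refine integral_congr_ae ?_
    filter_upwards [coeFn_reL2 H] with x hx
    rw [hx, smul_eq_mul, Complex.re_ofReal_mul, mul_comm]
  rw [hint F _ (contDiff_pd hη k).continuous (hasCompactSupport_pd hc k),
    hint G _ hη.continuous hc]
  have h2 : ∀ x, (∂_{(EuclideanSpace.single k 1 : Plane)} (testSchwartz η hη hc)) x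
      = (pd k η x : ℂ) := lineDeriv_eq_of_ofReal (hη.differentiable (by simp))
      (testSchwartz_apply η hη hc) k
  simp only [h2, testSchwartz_apply] at h1
  rw [← h1]; simp

/-! ### Fourier multipliers on `L²` -/

/-- Multiplication by an essentially bounded function, on the complex `L²`. -/
def bdMul (m : Plane → ℂ) (hm : MemLp m ∞ (volume : Measure Plane)) : L2C →L[ℂ] L2C :=
  (ContinuousLinearMap.mul ℂ ℂ).holderL volume ∞ 2 2 hm.toLp

theorem coeFn_bdMul (m : Plane → ℂ) (hm : MemLp m ∞ (volume : Measure Plane)) (f : L2C) :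
    bdMul m hm f =ᵐ[volume] fun ξ => m ξ * f ξ := by
  have h := (ContinuousLinearMap.mul ℂ ℂ).coeFn_holder (r := 2) (hm.toLp) f
  filter_upwards [h, hm.coeFn_toLp] with ξ h1 h2
  change ((ContinuousLinearMap.mul ℂ ℂ).holder 2 hm.toLp f) ξ = _
  rw [h1, h2]; rfl

/-- The Fourier multiplier operator with essentially bounded symbol `m`. -/
def fourierMul (m : Plane → ℂ) (hm : MemLp m ∞ (volume : Measure Plane)) : L2C →L[ℂ] L2C :=
  ((Lp.fourierTransformₗᵢ Plane ℂ).symm.toContinuousLinearEquiv : L2C →L[ℂ] L2C) ∘L bdMul m hm ∘L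
    ((Lp.fourierTransformₗᵢ Plane ℂ).toContinuousLinearEquiv : L2C →L[ℂ] L2C)

theorem fourier_fourierMul (m : Plane → ℂ) (hm : MemLp m ∞ (volume : Measure Plane)) (f : L2C) :
    (𝓕 (fourierMul m hm f) : L2C) =ᵐ[volume] fun ξ => m ξ * (𝓕 f : L2C) ξ := by
  have h : (𝓕 (fourierMul m hm f) : L2C) = bdMul m hm (𝓕 f : L2C) :=
    (Lp.fourierTransformₗᵢ Plane ℂ).apply_symm_apply _
  rw [h]
  exact coeFn_bdMul m hm _

/-- The real part of a Fourier multiplier, as an operator on the real `L²`. -/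
def realMul (m : Plane → ℂ) (hm : MemLp m ∞ (volume : Measure Plane)) : L2R →L[ℝ] L2R :=
  reL2 ∘L ((fourierMul m hm).restrictScalars ℝ) ∘L toL2C

theorem realMul_apply (m : Plane → ℂ) (hm : MemLp m ∞ (volume : Measure Plane)) (f : L2R) :
    realMul m hm f = reL2 (fourierMul m hm (toL2C f)) := rfl

theorem fourier_L2_injective {f g : L2C}
    (h : (𝓕 f : L2C) =ᵐ[volume] (𝓕 g : L2C)) : f = g :=
  (Lp.fourierTransformₗᵢ Plane ℂ).injective (Lp.ext h)

theorem hasWeakPartial_realMul {k : Fin 2} {m m' : Plane → ℂ}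
    (hm : MemLp m ∞ (volume : Measure Plane)) (hm' : MemLp m' ∞ (volume : Measure Plane))
    (h : ∀ ξ, m' ξ = sym k ξ * m ξ) (f : L2R) :
    HasWeakPartial k (realMul m hm f) (realMul m' hm' f) := by
  rw [realMul_apply, realMul_apply]
  refine hasWeakPartial_re_of_fourier ?_
  filter_upwards [fourier_fourierMul m hm (toL2C f), fourier_fourierMul m' hm' (toL2C f)]
    with ξ h1 h2
  rw [h1, h2, h]; ring

/-- A derivative of the argument of a multiplier can be moved into its symbol. -/
theorem realMul_weakPartial {k : Fin 2} {m m' : Plane → ℂ}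
    (hm : MemLp m ∞ (volume : Measure Plane)) (hm' : MemLp m' ∞ (volume : Measure Plane))
    (h : ∀ ξ, m' ξ = sym k ξ * m ξ) {f g : L2R} (hfg : HasWeakPartial k f g) :
    realMul m hm g = realMul m' hm' f := by
  rw [realMul_apply, realMul_apply]
  congr 1
  refine fourier_L2_injective ?_
  filter_upwards [fourier_fourierMul m hm (toL2C g), fourier_fourierMul m' hm' (toL2C f),
    hfg.fourier] with ξ h1 h2 h3
  rw [h1, h2, h3, h]; ring

/-- For real functions the real `L²` pairing is the real part of the complex one. -/
theorem inner_reL2 (f : L2R) (F : L2C) :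
    inner ℝ f (reL2 F) = (inner ℂ (toL2C f) F).re := by
  rw [L2.inner_def, L2.inner_def]
  have hi := L2.integrable_inner (𝕜 := ℂ) (toL2C f) F
  have := integral_re hi
  simp only [RCLike.re_to_complex] at this
  rw [← this]
  refine integral_congr_ae ?_
  filter_upwards [coeFn_reL2 F, coeFn_toL2C f] with x h1 h2
  rw [h1, h2]
  simp [mul_comm]

theorem inner_realMul (m : Plane → ℂ) (hm : MemLp m ∞ (volume : Measure Plane)) (f g : L2R) :
    inner ℝ f (realMul m hm g)
      = (∫ ξ, (starRingEnd ℂ) ((𝓕 (toL2C f) : L2C) ξ) * (m ξ * (𝓕 (toL2C g) : L2C) ξ)).re := by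
  rw [realMul_apply, inner_reL2, ← Lp.inner_fourier_eq, L2.inner_def]
  congr 1
  refine integral_congr_ae ?_
  filter_upwards [fourier_fourierMul m hm (toL2C g)] with ξ h1
  rw [RCLike.inner_apply, h1, mul_comm]

/-! ### The resolvent `(1 - Δ)⁻¹` -/

theorem norm_sym_le (k : Fin 2) (ξ : Plane) : ‖sym k ξ‖ ≤ 2 * Real.pi * ‖ξ‖ := by
  have h : ‖ξ k‖ ≤ ‖ξ‖ := PiLp.norm_apply_le ξ k
  have hpi := Real.pi_pos
  simp only [sym, norm_mul, Complex.norm_ofNat, Complex.norm_real, Complex.norm_I, mul_one,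
    Real.norm_eq_abs, abs_of_pos hpi] at *
  gcongr

/-- The symbol `(1 + 4 π² |ξ|²)⁻¹` of the resolvent. -/
def resSym (ξ : Plane) : ℂ := (((1 + (2 * Real.pi * ‖ξ‖) ^ 2)⁻¹ : ℝ) : ℂ)

theorem norm_resSym (ξ : Plane) : ‖resSym ξ‖ = (1 + (2 * Real.pi * ‖ξ‖) ^ 2)⁻¹ := by
  rw [resSym, Complex.norm_real, Real.norm_eq_abs, abs_of_pos (by positivity)]

theorem measurable_sym (k : Fin 2) : Measurable (sym k) := (continuous_sym k).measurable

theorem measurable_resSym : Measurable resSym := by unfold resSym; fun_prop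

theorem memLp_resSym : MemLp resSym ∞ (volume : Measure Plane) := by
  refine memLp_top_of_bound measurable_resSym.aestronglyMeasurable 1 (.of_forall fun ξ => ?_)
  rw [norm_resSym]
  exact inv_le_one_of_one_le₀ (by nlinarith [sq_nonneg (2 * Real.pi * ‖ξ‖)])

theorem memLp_sym_resSym (k : Fin 2) :
    MemLp (fun ξ => sym k ξ * resSym ξ) ∞ (volume : Measure Plane) := by
  refine memLp_top_of_bound
    ((measurable_sym k).mul measurable_resSym).aestronglyMeasurable 1 (.of_forall fun ξ => ?_)
  rw [norm_mul, norm_resSym]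
  have h1 := norm_sym_le k ξ
  set r := 2 * Real.pi * ‖ξ‖
  have hr : 0 < 1 + r ^ 2 := by positivity
  rw [← div_eq_mul_inv, div_le_one hr]
  nlinarith [sq_nonneg (r - 1)]

theorem memLp_sym_sym_resSym (k l : Fin 2) :
    MemLp (fun ξ => sym l ξ * (sym k ξ * resSym ξ)) ∞ (volume : Measure Plane) := by
  refine memLp_top_of_bound
    ((measurable_sym l).mul ((measurable_sym k).mul measurable_resSym)).aestronglyMeasurable 1
    (.of_forall fun ξ => ?_)
  rw [norm_mul, norm_mul, norm_resSym]
  have h1 := norm_sym_le k ξ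
  have h2 := norm_sym_le l ξ
  set r := 2 * Real.pi * ‖ξ‖
  have hr : 0 < 1 + r ^ 2 := by positivity
  rw [← mul_assoc, ← div_eq_mul_inv, div_le_one hr]
  nlinarith [mul_le_mul h2 h1 (norm_nonneg _) ((norm_nonneg _).trans h2)]

/-- The resolvent `(1 - Δ)⁻¹` on the real `L²`. -/
def res : L2R →L[ℝ] L2R := realMul resSym memLp_resSym

/-- `∂ₖ (1 - Δ)⁻¹`. -/
def resD (k : Fin 2) : L2R →L[ℝ] L2R := realMul _ (memLp_sym_resSym k)

/-- `∂ₗ ∂ₖ (1 - Δ)⁻¹`. -/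
def resDD (k l : Fin 2) : L2R →L[ℝ] L2R := realMul _ (memLp_sym_sym_resSym k l)

theorem hasWeakPartial_res (k : Fin 2) (f : L2R) : HasWeakPartial k (res f) (resD k f) :=
  hasWeakPartial_realMul _ _ (fun _ => rfl) f

theorem hasWeakPartial_resD (k l : Fin 2) (f : L2R) :
    HasWeakPartial l (resD k f) (resDD k l f) :=
  hasWeakPartial_realMul _ _ (fun _ => rfl) f

theorem res_weakPartial {k : Fin 2} {f g : L2R} (h : HasWeakPartial k f g) :
    res g = resD k f :=
  realMul_weakPartial _ _ (fun _ => rfl) h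

theorem resD_weakPartial {k l : Fin 2} {f g : L2R} (h : HasWeakPartial l f g) :
    resD k g = resDD k l f :=
  realMul_weakPartial _ _ (fun _ => rfl) h

theorem plane_norm_sq (ξ : Plane) : ‖ξ‖ ^ 2 = ξ 0 ^ 2 + ξ 1 ^ 2 := by
  rw [EuclideanSpace.real_norm_sq_eq, Fin.sum_univ_two]

/-- `(1 - Δ) (1 - Δ)⁻¹ f = f`. -/
theorem res_sub_laplacian (f : L2R) : res f - ∑ k, resDD k k f = f := by
  have key : fourierMul resSym memLp_resSym (toL2C f)
      - ∑ k, fourierMul _ (memLp_sym_sym_resSym k k) (toL2C f) = toL2C f := by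
    apply (Lp.fourierTransformₗᵢ Plane ℂ).injective
    rw [map_sub, map_sum, Fin.sum_univ_two]
    apply Lp.ext
    have h0 := fourier_fourierMul resSym memLp_resSym (toL2C f)
    have h1 := fun k => fourier_fourierMul _ (memLp_sym_sym_resSym k k) (toL2C f)
    refine (Lp.coeFn_sub _ _).trans ?_
    filter_upwards [h0, h1 0, h1 1, Lp.coeFn_add (𝓕 (fourierMul _ (memLp_sym_sym_resSym 0 0)
      (toL2C f)) : L2C) (𝓕 (fourierMul _ (memLp_sym_sym_resSym 1 1) (toL2C f)) : L2C)]
      with ξ e0 e1 e2 e3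
    change (𝓕 (fourierMul resSym memLp_resSym (toL2C f)) : L2C) ξ -
      ((𝓕 (fourierMul _ (memLp_sym_sym_resSym 0 0) (toL2C f)) : L2C) +
        (𝓕 (fourierMul _ (memLp_sym_sym_resSym 1 1) (toL2C f)) : L2C)) ξ
        = (𝓕 (toL2C f) : L2C) ξ
    rw [e3]
    simp only [Pi.add_apply]
    rw [e0, e1, e2]
    have hm : resSym ξ - (sym 0 ξ * (sym 0 ξ * resSym ξ) + sym 1 ξ * (sym 1 ξ * resSym ξ)) = 1 := by
      have hne : (1 + (2 * Real.pi * ‖ξ‖) ^ 2 : ℝ) ≠ 0 := by positivity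
      have hcast : (1 + (2 * Real.pi * ‖ξ‖) ^ 2 : ℝ)
          = 1 + 4 * Real.pi ^ 2 * (ξ 0 ^ 2 + ξ 1 ^ 2) := by rw [mul_pow, plane_norm_sq]; ring
      have : resSym ξ * ((1 + (2 * Real.pi * ‖ξ‖) ^ 2 : ℝ) : ℂ) = 1 := by
        rw [resSym, ← Complex.ofReal_mul, inv_mul_cancel₀ hne, Complex.ofReal_one]
      rw [← this, hcast]
      simp only [sym]
      push_cast
      ring_nf
      rw [Complex.I_sq]
      ring
    linear_combination (𝓕 (toL2C f) : L2C) ξ * hm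
  have := congrArg reL2 key
  rw [map_sub, map_sum, reL2_toL2C] at this
  exact this

/-! ### The negative Sobolev energy of a solenoidal field -/

/-- The symbols of the components of `∇^⊥ = (-∂₁, ∂₀)`. -/
def symPerp (α : Fin 2) (ξ : Plane) : ℂ := if α = 0 then -sym 1 ξ else sym 0 ξ

/-- The symbol `ρ = (2 π |ξ| √(1 + 4 π² |ξ|²))⁻¹`, singular at the origin. -/
def rhoSym (ξ : Plane) : ℂ :=
  (((2 * Real.pi * ‖ξ‖ * √(1 + (2 * Real.pi * ‖ξ‖) ^ 2))⁻¹ : ℝ) : ℂ)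

theorem measurable_rhoSym : Measurable rhoSym := by unfold rhoSym; fun_prop

theorem measurable_symPerp (α : Fin 2) : Measurable (symPerp α) := by
  unfold symPerp
  split_ifs
  · exact (measurable_sym 1).neg
  · exact measurable_sym 0

theorem norm_symPerp_le (α : Fin 2) (ξ : Plane) : ‖symPerp α ξ‖ ≤ 2 * Real.pi * ‖ξ‖ := by
  unfold symPerp
  split_ifs
  · rw [norm_neg]; exact norm_sym_le 1 ξ
  · exact norm_sym_le 0 ξ

theorem norm_rhoSym (ξ : Plane) :
    ‖rhoSym ξ‖ = (2 * Real.pi * ‖ξ‖ * √(1 + (2 * Real.pi * ‖ξ‖) ^ 2))⁻¹ := by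
  rw [rhoSym, Complex.norm_real, Real.norm_eq_abs, abs_of_nonneg (by positivity)]

theorem memLp_symPerp_rhoSym (α : Fin 2) :
    MemLp (fun ξ => symPerp α ξ * rhoSym ξ) ∞ (volume : Measure Plane) := by
  refine memLp_top_of_bound ((measurable_symPerp α).mul measurable_rhoSym).aestronglyMeasurable 1
    (.of_forall fun ξ => ?_)
  rw [norm_mul, norm_rhoSym, ← div_eq_mul_inv]
  refine div_le_one_of_le₀ ?_ (by positivity)
  refine (norm_symPerp_le α ξ).trans (le_mul_of_one_le_right (by positivity) ?_)
  exact Real.one_le_sqrt.2 (by nlinarith [sq_nonneg (2 * Real.pi * ‖ξ‖)])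

theorem memLp_sym_symPerp_rhoSym (α β : Fin 2) :
    MemLp (fun ξ => sym β ξ * (symPerp α ξ * rhoSym ξ)) ∞ (volume : Measure Plane) := by
  refine memLp_top_of_bound ((measurable_sym β).mul
    ((measurable_symPerp α).mul measurable_rhoSym)).aestronglyMeasurable 1 (.of_forall fun ξ => ?_)
  rw [norm_mul, norm_mul, norm_rhoSym, ← mul_assoc, ← div_eq_mul_inv]
  refine div_le_one_of_le₀ ?_ (by positivity)
  have h1 := norm_sym_le β ξ
  have h2 := norm_symPerp_le α ξ
  set r := 2 * Real.pi * ‖ξ‖ with hr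
  have hr0 : 0 ≤ r := by positivity
  have h3 : r ≤ √(1 + r ^ 2) := Real.le_sqrt_of_sq_le (by linarith)
  calc ‖sym β ξ‖ * ‖symPerp α ξ‖ ≤ r * r := mul_le_mul h1 h2 (norm_nonneg _) hr0
    _ ≤ r * √(1 + r ^ 2) := by gcongr

/-- Component `α` of the operator `(-Δ)^{-1/2} (1 - Δ)^{-1/2} curl`, on the Fourier side. -/
def curlOp (α : Fin 2) : L2R →L[ℝ] L2C :=
  ((bdMul _ (memLp_symPerp_rhoSym α)).restrictScalars ℝ) ∘L
    (((Lp.fourierTransformₗᵢ Plane ℂ).toContinuousLinearEquiv : L2C →L[ℂ] L2C).restrictScalars ℝ)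
    ∘L toL2C

/-- Component `(α, β)` of the operator `(-Δ)^{-1/2} (1 - Δ)^{-1/2} curl div`, on the Fourier
side. -/
def curlDivOp (α β : Fin 2) : L2R →L[ℝ] L2C :=
  ((bdMul _ (memLp_sym_symPerp_rhoSym α β)).restrictScalars ℝ) ∘L
    (((Lp.fourierTransformₗᵢ Plane ℂ).toContinuousLinearEquiv : L2C →L[ℂ] L2C).restrictScalars ℝ)
    ∘L toL2C

theorem coeFn_curlOp (α : Fin 2) (f : L2R) :
    curlOp α f =ᵐ[volume] fun ξ => symPerp α ξ * rhoSym ξ * (𝓕 (toL2C f) : L2C) ξ :=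
  coeFn_bdMul _ (memLp_symPerp_rhoSym α) (𝓕 (toL2C f) : L2C)

theorem coeFn_curlDivOp (α β : Fin 2) (f : L2R) :
    curlDivOp α β f =ᵐ[volume]
      fun ξ => sym β ξ * (symPerp α ξ * rhoSym ξ) * (𝓕 (toL2C f) : L2C) ξ :=
  coeFn_bdMul _ (memLp_sym_symPerp_rhoSym α β) (𝓕 (toL2C f) : L2C)

theorem coeFn_sum_L2C {ι : Type*} (s : Finset ι) (F : ι → L2C) :
    (∑ i ∈ s, F i : L2C) =ᵐ[volume] fun ξ => ∑ i ∈ s, F i ξ := by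
  classical
  induction s using Finset.induction_on with
  | empty =>
    simp only [Finset.sum_empty]
    exact Lp.coeFn_zero ℂ 2 (volume : Measure Plane)
  | insert a s ha ih =>
    rw [Finset.sum_insert ha]
    filter_upwards [Lp.coeFn_add (F a) (∑ i ∈ s, F i), ih] with ξ h1 h2
    rw [h1, Pi.add_apply, h2, Finset.sum_insert ha]

theorem ae_ne_zero_plane : ∀ᵐ ξ : Plane, ξ ≠ 0 := by
  rw [ae_iff]; simp

theorem rhoSym_sq {ξ : Plane} (hξ : ξ ≠ 0) :
    ((2 * Real.pi * ‖ξ‖ : ℝ) : ℂ) ^ 2 * (rhoSym ξ * rhoSym ξ) = resSym ξ := by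
  have hn : 0 < ‖ξ‖ := norm_pos_iff.2 hξ
  have hpi := Real.pi_pos
  set r := 2 * Real.pi * ‖ξ‖ with hr
  have hr0 : 0 < r := by positivity
  have hs : √(1 + r ^ 2) ^ 2 = 1 + r ^ 2 := Real.sq_sqrt (by positivity)
  have hs0 : 0 < √(1 + r ^ 2) := Real.sqrt_pos.2 (by positivity)
  rw [rhoSym, resSym, ← Complex.ofReal_mul, ← Complex.ofReal_pow, ← Complex.ofReal_mul]
  congr 1
  rw [← hr, show (1 + r ^ 2)⁻¹ = (√(1 + r ^ 2) ^ 2)⁻¹ by rw [hs]]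
  generalize √(1 + r ^ 2) = q at hs0
  field_simp

theorem conj_rhoSym (ξ : Plane) : (starRingEnd ℂ) (rhoSym ξ) = rhoSym ξ := Complex.conj_ofReal _

theorem conj_sym (k : Fin 2) (ξ : Plane) : (starRingEnd ℂ) (sym k ξ) = -sym k ξ := by
  simp [sym, map_ofNat]

/-- The Leray projection leaves a solenoidal field unchanged: this is that fact on the Fourier side,
with `symPerp` spanning the orthogonal complement of the frequency. -/
theorem leray_identity {V : Fin 2 → ℂ} {ξ : Plane} (hξ : ξ ≠ 0)
    (hdiv : ∑ α, sym α ξ * V α = 0) (α : Fin 2) :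
    (∑ γ, symPerp γ ξ * rhoSym ξ * V γ) * (starRingEnd ℂ) (symPerp α ξ * rhoSym ξ)
      = resSym ξ * V α := by
  rw [map_mul, conj_rhoSym, ← rhoSym_sq hξ]
  have hcast : ((2 * Real.pi * ‖ξ‖ : ℝ) : ℂ) ^ 2
      = 4 * (Real.pi : ℂ) ^ 2 * ((ξ 0 : ℂ) ^ 2 + (ξ 1 : ℂ) ^ 2) := by
    rw [← Complex.ofReal_pow, mul_pow, plane_norm_sq]; push_cast; ring
  rw [hcast]
  have hpi : (2 * (Real.pi : ℂ) * Complex.I) ≠ 0 := by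
    simp [Real.pi_ne_zero]
  have hd : (ξ 0 : ℂ) * V 0 + (ξ 1 : ℂ) * V 1 = 0 := by
    rw [Fin.sum_univ_two] at hdiv
    simp only [sym] at hdiv
    apply (mul_eq_zero.1 (_ : (2 * (Real.pi : ℂ) * Complex.I) * _ = 0)).resolve_left hpi
    linear_combination hdiv
  have hI : Complex.I ^ 2 = -1 := Complex.I_sq
  fin_cases α
  · simp only [Fin.sum_univ_two, symPerp, Fin.zero_eta, if_true, Fin.isValue, one_ne_zero, if_false,
      map_neg, conj_sym]
    simp only [sym]
    linear_combination (-4 * (Real.pi : ℂ) ^ 2 * rhoSym ξ * rhoSym ξ *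
      (ξ 1 : ℂ) * (-(ξ 1 : ℂ) * V 0 + (ξ 0 : ℂ) * V 1)) * (-hI)
      - 4 * (Real.pi : ℂ) ^ 2 * rhoSym ξ * rhoSym ξ * (ξ 0 : ℂ) * hd
  · simp only [Fin.sum_univ_two, symPerp, Fin.mk_one, if_true, Fin.isValue, one_ne_zero, if_false,
      conj_sym]
    simp only [sym]
    linear_combination (4 * (Real.pi : ℂ) ^ 2 * rhoSym ξ * rhoSym ξ *
      (ξ 0 : ℂ) * (-(ξ 1 : ℂ) * V 0 + (ξ 0 : ℂ) * V 1)) * (-hI)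
      - 4 * (Real.pi : ℂ) ^ 2 * rhoSym ξ * rhoSym ξ * (ξ 1 : ℂ) * hd

/-- The square of the `H⁻¹` energy of a solenoidal field. -/
theorem norm_sq_curlOp {v : Fin 2 → L2R}
    (hdiv : ∀ᵐ ξ, ∑ α, sym α ξ * (𝓕 (toL2C (v α)) : L2C) ξ = 0) :
    ‖∑ α, curlOp α (v α)‖ ^ 2 = ∑ α, inner ℝ (v α) (res (v α)) := by
  have hF : ∀ α, Integrable (fun ξ => (starRingEnd ℂ) ((𝓕 (toL2C (v α)) : L2C) ξ) *
      (resSym ξ * (𝓕 (toL2C (v α)) : L2C) ξ)) volume := by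
    intro α
    refine (L2.integrable_inner (𝕜 := ℂ) (𝓕 (toL2C (v α)) : L2C)
      (𝓕 (fourierMul resSym memLp_resSym (toL2C (v α))) : L2C)).congr ?_
    filter_upwards [fourier_fourierMul resSym memLp_resSym (toL2C (v α))] with ξ h1
    rw [RCLike.inner_apply, h1, mul_comm]
  have h1 : ∑ α, inner ℝ (v α) (res (v α)) = (∫ ξ, ∑ α, (starRingEnd ℂ)
      ((𝓕 (toL2C (v α)) : L2C) ξ) * (resSym ξ * (𝓕 (toL2C (v α)) : L2C) ξ)).re := by
    rw [integral_finsetSum _ fun α _ => hF α, Complex.re_sum]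
    exact Finset.sum_congr rfl fun α _ => inner_realMul _ _ _ _
  rw [h1, ← inner_self_eq_norm_sq (𝕜 := ℂ), RCLike.re_to_complex, L2.inner_def]
  congr 1
  refine integral_congr_ae ?_
  filter_upwards [hdiv, ae_ne_zero_plane, coeFn_sum_L2C Finset.univ (fun α => curlOp α (v α)),
    ae_all_iff.2 fun α => coeFn_curlOp α (v α)] with ξ hd hξ hs hc
  rw [RCLike.inner_apply, hs]
  simp only [hc]
  rw [map_sum, Finset.mul_sum]
  refine Finset.sum_congr rfl fun α _ => ?_
  rw [map_mul, ← mul_assoc, leray_identity hξ hd α]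
  ring

/-- The pairing that drives the `H⁻¹` energy: the operators `curlOp` and `curlDivOp` are arranged so
that only `∇ (1 - Δ)⁻¹ v` remains. -/
theorem inner_curlOp_curlDivOp {v : Fin 2 → L2R} (σ : Fin 2 → Fin 2 → L2R)
    (hdiv : ∀ᵐ ξ, ∑ α, sym α ξ * (𝓕 (toL2C (v α)) : L2C) ξ = 0) :
    (inner ℂ (∑ α : Fin 2 × Fin 2, curlDivOp α.1 α.2 (σ α.1 α.2) : L2C)
        (∑ α, curlOp α (v α) : L2C)).re
      = -∑ α : Fin 2 × Fin 2, inner ℝ (σ α.1 α.2) (resD α.2 (v α.1)) := by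
  have hF : ∀ α : Fin 2 × Fin 2, Integrable (fun ξ => (starRingEnd ℂ)
      ((𝓕 (toL2C (σ α.1 α.2)) : L2C) ξ) *
      (sym α.2 ξ * resSym ξ * (𝓕 (toL2C (v α.1)) : L2C) ξ)) volume := by
    intro α
    refine (L2.integrable_inner (𝕜 := ℂ) (𝓕 (toL2C (σ α.1 α.2)) : L2C)
      (𝓕 (fourierMul _ (memLp_sym_resSym α.2) (toL2C (v α.1))) : L2C)).congr ?_
    filter_upwards [fourier_fourierMul _ (memLp_sym_resSym α.2) (toL2C (v α.1))] with ξ h1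
    rw [RCLike.inner_apply, h1, mul_comm]
  have h1 : ∑ α : Fin 2 × Fin 2, inner ℝ (σ α.1 α.2) (resD α.2 (v α.1)) = (∫ ξ, ∑ α : Fin 2 × Fin 2,
      (starRingEnd ℂ) ((𝓕 (toL2C (σ α.1 α.2)) : L2C) ξ) *
        (sym α.2 ξ * resSym ξ * (𝓕 (toL2C (v α.1)) : L2C) ξ)).re := by
    rw [integral_finsetSum _ fun α _ => hF α, Complex.re_sum]
    exact Finset.sum_congr rfl fun α _ => inner_realMul _ _ _ _
  rw [h1, ← Complex.neg_re, ← integral_neg, L2.inner_def]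
  congr 1
  refine integral_congr_ae ?_
  filter_upwards [hdiv, ae_ne_zero_plane, coeFn_sum_L2C Finset.univ (fun α => curlOp α (v α)),
    ae_all_iff.2 fun α => coeFn_curlOp α (v α), coeFn_sum_L2C Finset.univ
      (fun α : Fin 2 × Fin 2 => curlDivOp α.1 α.2 (σ α.1 α.2)),
    ae_all_iff.2 fun α : Fin 2 × Fin 2 => coeFn_curlDivOp α.1 α.2 (σ α.1 α.2)]
    with ξ hd hξ hs hc hs' hc'
  rw [RCLike.inner_apply, hs, hs']
  simp only [hc, hc']
  rw [map_sum, Finset.mul_sum, ← Finset.sum_neg_distrib]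
  refine Finset.sum_congr rfl fun α _ => ?_
  rw [map_mul, map_mul, conj_sym]
  linear_combination (-sym α.2 ξ * (starRingEnd ℂ) ((𝓕 (toL2C (σ α.1 α.2)) : L2C) ξ)) *
    leray_identity hξ hd α.1

/-- The distributional identity `curl V = curl div S`, tested with compactly supported stream
functions, carries over to the Fourier side. -/
theorem curlOp_eq_curlDivOp {V : Fin 2 → L2R} {S : Fin 2 → Fin 2 → L2R}
    (h : ∀ η : Plane → ℝ, ContDiff ℝ ∞ η → HasCompactSupport η →
      (-∫ x, V 0 x * (-pd 1 η x)) - ∫ x, V 1 x * pd 0 η x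
        = ∑ β, ((∫ x, S 0 β x * pd β (fun y => -pd 1 η y) x) + ∫ x, S 1 β x * pd β (pd 0 η) x)) :
    ∑ α, curlOp α (V α) = ∑ α : Fin 2 × Fin 2, curlDivOp α.1 α.2 (S α.1 α.2) := by
  let e : Fin 2 → Plane := fun k => EuclideanSpace.single k 1
  let VT : Fin 2 → 𝓢'(Plane, ℂ) := fun α => (toL2C (V α) : 𝓢'(Plane, ℂ))
  let ST : Fin 2 → Fin 2 → 𝓢'(Plane, ℂ) := fun α β => (toL2C (S α β) : 𝓢'(Plane, ℂ))
  have hT : ((-1 : ℂ) • ∂_{e 1} (VT 0) + ∂_{e 0} (VT 1)) + (-1 : ℂ) • ∑ β,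
      ((-1 : ℂ) • ∂_{e 1} (∂_{e β} (ST 0 β)) + ∂_{e 0} (∂_{e β} (ST 1 β))) = 0 := by
    refine temperedDistribution_eq_zero fun η hη hc => ?_
    set κ := testSchwartz η hη hc with hκ
    have hκ1 : ∀ k x, (∂_{e k} κ) x = (pd k η x : ℂ) :=
      lineDeriv_eq_of_ofReal (hη.differentiable (by simp)) (testSchwartz_apply η hη hc)
    have hκ2 : ∀ k l x, (∂_{e l} (∂_{e k} κ)) x = (pd l (pd k η) x : ℂ) := fun k l =>
      lineDeriv_eq_of_ofReal ((contDiff_pd hη k).differentiable (by simp)) (hκ1 k) l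
    have hV : ∀ α k, (∂_{e k} (VT α)) κ = -((∫ x, V α x * pd k η x : ℝ) : ℂ) := by
      intro α k
      change (VT α) (-∂_{e k} κ) = _
      rw [map_neg, toL2C_coe_apply (V α) _ (hκ1 k)]
    have hS : ∀ α β k, (∂_{e k} (∂_{e β} (ST α β))) κ
        = ((∫ x, S α β x * pd β (pd k η) x : ℝ) : ℂ) := by
      intro α β k
      change (ST α β) (-∂_{e β} (-∂_{e k} κ)) = _
      rw [← toL2C_coe_apply (S α β) _ (hκ2 k β)]
      congr 1
      ext x
      simp [lineDerivOp_neg]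
    change (((-1 : ℂ) • (∂_{e 1} (VT 0)) κ + (∂_{e 0} (VT 1)) κ)) + (-1 : ℂ) •
      (∑ β, ((-1 : ℂ) • ∂_{e 1} (∂_{e β} (ST 0 β)) + ∂_{e 0} (∂_{e β} (ST 1 β)))) κ = 0
    have hsum : (∑ β, ((-1 : ℂ) • ∂_{e 1} (∂_{e β} (ST 0 β)) + ∂_{e 0} (∂_{e β} (ST 1 β)))) κ
        = ∑ β, ((-1 : ℂ) • (∂_{e 1} (∂_{e β} (ST 0 β))) κ + (∂_{e 0} (∂_{e β} (ST 1 β))) κ) := by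
      rw [Fin.sum_univ_two, Fin.sum_univ_two]; rfl
    rw [hsum]
    simp only [hV, hS]
    have hh := h η hη hc
    have hneg : ∀ β x, pd β (fun y => -pd 1 η y) x = -pd β (pd 1 η) x := by
      intro β x
      simp only [pd]
      rw [fderiv_fun_neg]; rfl
    simp only [hneg, mul_neg, integral_neg, neg_neg] at hh
    have hh' := congrArg (fun r : ℝ => (r : ℂ)) hh
    push_cast at hh'
    simp only [smul_eq_mul, Fin.sum_univ_two] at hh' ⊢
    linear_combination hh'
  have hR := ((((((isRepr_fourier (toL2C (V 0))).fourier_lineDeriv 1).smul (-1)).add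
    ((isRepr_fourier (toL2C (V 1))).fourier_lineDeriv 0))).add ((IsRepr.sum Finset.univ
      (T := fun β => (-1 : ℂ) • 𝓕 (∂_{e 1} (∂_{e β} (ST 0 β))) + 𝓕 (∂_{e 0} (∂_{e β} (ST 1 β))))
      fun β _ => ((((isRepr_fourier (toL2C (S 0 β))).fourier_lineDeriv β).fourier_lineDeriv 1).smul
      (-1)).add (((isRepr_fourier (toL2C (S 1 β))).fourier_lineDeriv β).fourier_lineDeriv 0)).smul
      (-1)))
  have hR0 : IsRepr (((-1 : ℂ) • 𝓕 (∂_{e 1} (VT 0)) + 𝓕 (∂_{e 0} (VT 1))) + (-1 : ℂ) • ∑ β,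
      ((-1 : ℂ) • 𝓕 (∂_{e 1} (∂_{e β} (ST 0 β))) + 𝓕 (∂_{e 0} (∂_{e β} (ST 1 β)))))
      (fun _ => 0) := by
    have hz := congrArg (fun T : 𝓢'(Plane, ℂ) => 𝓕 T) hT
    simp only [Fin.sum_univ_two, FourierTransform.fourier_add, FourierTransform.fourier_smul] at hz
    rw [Fin.sum_univ_two, hz]
    have : (𝓕 (0 : 𝓢'(Plane, ℂ))) = 0 := by ext κ; rfl
    rw [this]
    exact isRepr_zero
  have hae := hR.ae_eq hR0
  apply Lp.ext
  filter_upwards [hae, coeFn_sum_L2C Finset.univ (fun α => curlOp α (V α)),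
    ae_all_iff.2 fun α => coeFn_curlOp α (V α), coeFn_sum_L2C Finset.univ
      (fun α : Fin 2 × Fin 2 => curlDivOp α.1 α.2 (S α.1 α.2)),
    ae_all_iff.2 fun α : Fin 2 × Fin 2 => coeFn_curlDivOp α.1 α.2 (S α.1 α.2)]
    with ξ h0 hs hc hs' hc'
  rw [hs, hs']
  simp only [hc, hc', Fintype.sum_prod_type, Fin.sum_univ_two, symPerp, Fin.isValue, if_true,
    one_ne_zero, if_false] at h0 ⊢
  linear_combination rhoSym ξ * h0

/-! ### Sobolev embedding `H² ⊂ L^∞` -/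

/-- The reason why `H²` embeds in `L^∞`: `(1 + 4 π² |ξ|²)⁻¹` is square integrable on the plane. -/
theorem memLp_two_resSym : MemLp resSym 2 (volume : Measure Plane) := by
  rw [memLp_two_iff_integrable_sq_norm measurable_resSym.aestronglyMeasurable]
  have h : Integrable (fun x : Plane ↦ ((1 : ℝ) + ‖x‖ ^ 2) ^ (-(4 : ℝ) / 2)) volume :=
    integrable_rpow_neg_one_add_norm_sq (by simp; norm_num)
  refine h.mono' (by have := measurable_resSym; fun_prop) (.of_forall fun ξ => ?_)
  rw [norm_resSym, Real.norm_eq_abs, abs_of_nonneg (by positivity)]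
  have e : (-(4 : ℝ) / 2) = -(2 : ℕ) := by norm_num
  rw [e, Real.rpow_neg (by positivity), Real.rpow_natCast, inv_pow]
  have hpi := Real.pi_gt_three
  have : ‖ξ‖ ^ 2 ≤ (2 * Real.pi * ‖ξ‖) ^ 2 := by
    rw [mul_pow]
    exact le_mul_of_one_le_left (by positivity) (by nlinarith)
  gcongr

/-- If the Fourier transform of `F ∈ L²` is integrable, then `F` is bounded by its `L¹` norm. -/
theorem ae_norm_le_of_fourier_integrable {F : L2C} {Φ : Plane → ℂ}
    (h : (𝓕 F : L2C) =ᵐ[volume] Φ) (hΦ : Integrable Φ volume) :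
    ∀ᵐ x, ‖F x‖ ≤ ∫ ξ, ‖Φ ξ‖ := by
  let G : Plane → ℂ := VectorFourier.fourierIntegral Real.fourierChar volume
    (-(innerₗ Plane)).flip Φ
  have hL : Continuous fun p : Plane × Plane => (-(innerₗ Plane)) p.1 p.2 := by
    change Continuous fun p : Plane × Plane => -(inner ℝ p.1 p.2 : ℝ)
    fun_prop
  have hL' : Continuous fun p : Plane × Plane => (-(innerₗ Plane)).flip p.1 p.2 := by
    change Continuous fun p : Plane × Plane => -(inner ℝ p.2 p.1 : ℝ)
    fun_prop
  have hG : Continuous G :=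
    VectorFourier.fourierIntegral_continuous Real.continuous_fourierChar hL' hΦ
  have hFG : (F : Plane → ℂ) =ᵐ[volume] G := by
    refine ae_eq_of_integral_contDiff_smul_eq (locallyIntegrable_L2 F) hG.locallyIntegrable
      fun η hη hc => ?_
    set κ := testSchwartz η hη hc
    have h1 : (F : 𝓢'(Plane, ℂ)) κ = (𝓕 (F : 𝓢'(Plane, ℂ))) (𝓕⁻ κ) := by
      rw [TemperedDistribution.fourier_apply, FourierTransform.fourier_fourierInv_eq]
    rw [Lp.fourier_toTemperedDistribution_eq, Lp.toTemperedDistribution_apply,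
      Lp.toTemperedDistribution_apply] at h1
    have h2 : ∫ x, (𝓕⁻ κ) x • (𝓕 F : L2C) x = ∫ x, (𝓕⁻ κ) x • Φ x :=
      integral_congr_ae (by filter_upwards [h] with x hx; rw [hx])
    have h3 : ∫ x, (𝓕⁻ κ) x • Φ x = ∫ x, κ x • G x := by
      rw [SchwartzMap.fourierInv_coe]
      exact VectorFourier.integral_fourierIntegral_smul_eq_flip Real.continuous_fourierChar hL
        κ.integrable hΦ
    rw [h2, h3] at h1
    simpa [κ, testSchwartz_apply] using h1
  filter_upwards [hFG] with x hx
  rw [hx]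
  exact VectorFourier.norm_fourierIntegral_le_integral_norm _ _ _ _ _

theorem integral_norm_mul_le_eLpNorm {f g : Plane → ℂ} (hf : MemLp f 2 (volume : Measure Plane))
    (hg : MemLp g 2 (volume : Measure Plane)) :
    ∫ x, ‖f x * g x‖ ≤ (eLpNorm f 2 volume).toReal * (eLpNorm g 2 volume).toReal := by
  have hm : MemLp (fun x => f x * g x) 1 (volume : Measure Plane) := MemLp.mul' hg hf
  have h : eLpNorm (f • g) 1 volume ≤ eLpNorm f 2 volume * eLpNorm g 2 volume :=
    eLpNorm_smul_le_mul_eLpNorm (p := 2) (q := 2) (r := 1) hg.1 hf.1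
  rw [integral_norm_eq_lintegral_enorm hm.1, ← ENNReal.toReal_mul]
  refine ENNReal.toReal_mono (ENNReal.mul_ne_top hf.eLpNorm_ne_top hg.eLpNorm_ne_top) ?_
  rw [eLpNorm_one_eq_lintegral_enorm] at h
  exact h

theorem norm_toL2C (f : L2R) : ‖toL2C f‖ = ‖f‖ := by
  have h : ∀ᵐ x, ‖toL2C f x‖ = ‖f x‖ := by
    filter_upwards [coeFn_toL2C f] with x hx
    rw [hx, Complex.norm_real]
  exact le_antisymm (Lp.norm_le_norm_of_ae_le (h.mono fun x hx => hx.le))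
    (Lp.norm_le_norm_of_ae_le (h.mono fun x hx => hx.ge))

/-- The resolvent maps `L²` into `L^∞`. -/
theorem exists_res_bound : ∃ C : ℝ, 0 ≤ C ∧ ∀ g : L2R, ∀ᵐ x, |res g x| ≤ C * ‖g‖ := by
  refine ⟨(eLpNorm resSym 2 volume).toReal, ENNReal.toReal_nonneg, fun g => ?_⟩
  have hΦ : Integrable (fun ξ => resSym ξ * (𝓕 (toL2C g) : L2C) ξ) volume :=
    memLp_one_iff_integrable.1 (MemLp.mul' (Lp.memLp _) memLp_two_resSym)
  have h1 := ae_norm_le_of_fourier_integrable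
    (fourier_fourierMul resSym memLp_resSym (toL2C g)) hΦ
  have h2 := integral_norm_mul_le_eLpNorm memLp_two_resSym (Lp.memLp (𝓕 (toL2C g) : L2C))
  rw [← Lp.norm_def, Lp.norm_fourier_eq, norm_toL2C] at h2
  filter_upwards [h1, coeFn_reL2 (fourierMul resSym memLp_resSym (toL2C g))] with x hx hre
  have h3 : res g x = (fourierMul resSym memLp_resSym (toL2C g) x).re := hre
  rw [h3]
  exact (Complex.abs_re_le_norm _).trans (hx.trans h2)

/-! ### The Sobolev space `H¹` of the plane -/

/-- `f ∈ H¹(ℝ²)` with weak gradient `Df`. -/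
structure MemH1 (f : Plane → ℝ) (Df : Fin 2 → Plane → ℝ) : Prop where
  memLp : MemLp f 2 (volume : Measure Plane)
  memLp_grad : ∀ k, MemLp (Df k) 2 (volume : Measure Plane)
  weak : ∀ k, HasWeakPartial k f (Df k)

theorem HasWeakPartial.congr {k : Fin 2} {f f' g g' : Plane → ℝ} (h : HasWeakPartial k f g)
    (hf : f =ᵐ[volume] f') (hg : g =ᵐ[volume] g') : HasWeakPartial k f' g' := by
  refine ⟨h.1.congr hf, h.2.1.congr hg, fun η hη hc => ?_⟩
  have h1 : ∫ x, f' x * pd k η x = ∫ x, f x * pd k η x :=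
    integral_congr_ae (by filter_upwards [hf] with x hx; rw [hx])
  have h2 : ∫ x, g' x * η x = ∫ x, g x * η x :=
    integral_congr_ae (by filter_upwards [hg] with x hx; rw [hx])
  rw [h1, h2, h.2.2 η hη hc]

theorem integrable_mul_test {f ζ : Plane → ℝ} (hf : LocallyIntegrable f volume)
    (hζ : Continuous ζ) (hc : HasCompactSupport ζ) : Integrable (fun x => f x * ζ x) volume :=
  hf.integrable_smul_right_of_hasCompactSupport hζ hc

theorem HasWeakPartial.add {k : Fin 2} {f f' g g' : Plane → ℝ} (h : HasWeakPartial k f g)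
    (h' : HasWeakPartial k f' g') :
    HasWeakPartial k (fun x => f x + f' x) (fun x => g x + g' x) := by
  refine ⟨h.1.add h'.1, h.2.1.add h'.2.1, fun η hη hc => ?_⟩
  have c1 := (contDiff_pd hη k).continuous
  have c2 := hasCompactSupport_pd hc k
  simp only [add_mul]
  rw [integral_add (integrable_mul_test h.1 c1 c2) (integrable_mul_test h'.1 c1 c2),
    integral_add (integrable_mul_test h.2.1 hη.continuous hc)
      (integrable_mul_test h'.2.1 hη.continuous hc), h.2.2 η hη hc, h'.2.2 η hη hc]
  ring

theorem HasWeakPartial.const_mul {k : Fin 2} {f g : Plane → ℝ} (h : HasWeakPartial k f g) (c : ℝ) :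
    HasWeakPartial k (fun x => c * f x) (fun x => c * g x) := by
  refine ⟨h.1.smul c, h.2.1.smul c, fun η hη hc => ?_⟩
  simp only [mul_assoc, integral_const_mul]
  rw [h.2.2 η hη hc]; ring

theorem MemH1.add {f g : Plane → ℝ} {Df Dg : Fin 2 → Plane → ℝ} (hf : MemH1 f Df)
    (hg : MemH1 g Dg) : MemH1 (fun x => f x + g x) (fun k x => Df k x + Dg k x) :=
  ⟨hf.memLp.add hg.memLp, fun k => (hf.memLp_grad k).add (hg.memLp_grad k),
    fun k => (hf.weak k).add (hg.weak k)⟩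

theorem MemH1.const_mul {f : Plane → ℝ} {Df : Fin 2 → Plane → ℝ} (hf : MemH1 f Df) (c : ℝ) :
    MemH1 (fun x => c * f x) (fun k x => c * Df k x) :=
  ⟨hf.memLp.const_mul c, fun k => (hf.memLp_grad k).const_mul c, fun k => (hf.weak k).const_mul c⟩

theorem MemH1.sub {f g : Plane → ℝ} {Df Dg : Fin 2 → Plane → ℝ} (hf : MemH1 f Df)
    (hg : MemH1 g Dg) : MemH1 (fun x => f x - g x) (fun k x => Df k x - Dg k x) := by
  have := hf.add (hg.const_mul (-1))
  simpa [sub_eq_add_neg] using this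

theorem HasWeakPartial.toLp {k : Fin 2} {f g : Plane → ℝ} (h : HasWeakPartial k f g)
    (hf : MemLp f 2 (volume : Measure Plane)) (hg : MemLp g 2 (volume : Measure Plane)) :
    HasWeakPartial k (hf.toLp f : L2R) (hg.toLp g : L2R) :=
  h.congr hf.coeFn_toLp.symm hg.coeFn_toLp.symm

theorem pd_mul {f g : Plane → ℝ} (hf : Differentiable ℝ f) (hg : Differentiable ℝ g) (k : Fin 2)
    (x : Plane) : pd k (fun y => f y * g y) x = pd k f x * g x + f x * pd k g x := by
  simp only [pd]
  rw [fderiv_fun_mul (hf x) (hg x)]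
  simp; ring

/-- A smooth compactly supported function belongs to `H¹`. -/
theorem memH1_of_contDiff {η : Plane → ℝ} (hη : ContDiff ℝ ∞ η) (hc : HasCompactSupport η) :
    MemH1 η (fun k => pd k η) := by
  refine ⟨hη.continuous.memLp_of_hasCompactSupport hc, fun k =>
    (contDiff_pd hη k).continuous.memLp_of_hasCompactSupport (hasCompactSupport_pd hc k),
    fun k => ⟨hη.continuous.locallyIntegrable, (contDiff_pd hη k).continuous.locallyIntegrable,
    fun ζ hζ hcζ => ?_⟩⟩
  have c1 := (contDiff_pd hζ k).continuous
  have c2 := hasCompactSupport_pd hcζ k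
  refine integral_mul_fderiv_eq_neg_fderiv_mul_of_integrable
    (integrable_mul_test (contDiff_pd hη k).continuous.locallyIntegrable hζ.continuous hcζ)
    (integrable_mul_test hη.continuous.locallyIntegrable c1 c2)
    (integrable_mul_test hη.continuous.locallyIntegrable hζ.continuous hcζ)
    (fun x _ => hη.differentiable (by simp) x) (fun x _ => hζ.differentiable (by simp) x)

/-- In `H¹`, the only `f` orthogonal to all smooth compactly supported functions is `0`: on the
Fourier side the orthogonality says `(1 + 4 π² |ξ|²) f̂ = 0`. -/
theorem eq_zero_of_orthogonal_test {f : L2R} {Df : Fin 2 → L2R}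
    (hw : ∀ k, HasWeakPartial k f (Df k))
    (h : ∀ η : Plane → ℝ, ContDiff ℝ ∞ η → HasCompactSupport η →
      (∫ x, f x * η x) + ∑ k, ∫ x, Df k x * pd k η x = 0) : f = 0 ∧ ∀ k, Df k = 0 := by
  let e : Fin 2 → Plane := fun k => EuclideanSpace.single k 1
  have hT : (toL2C f : 𝓢'(Plane, ℂ)) + (-1 : ℂ) • (∂_{e 0} (toL2C (Df 0) : 𝓢'(Plane, ℂ))
      + ∂_{e 1} (toL2C (Df 1) : 𝓢'(Plane, ℂ))) = 0 := by
    refine temperedDistribution_eq_zero fun η hη hc => ?_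
    have hκ1 : ∀ k x, (∂_{e k} (testSchwartz η hη hc)) x = (pd k η x : ℂ) :=
      lineDeriv_eq_of_ofReal (hη.differentiable (by simp)) (testSchwartz_apply η hη hc)
    change (toL2C f : 𝓢'(Plane, ℂ)) (testSchwartz η hη hc) +
      (-1 : ℂ) * ((toL2C (Df 0) : 𝓢'(Plane, ℂ)) (-∂_{e 0} (testSchwartz η hη hc))
        + (toL2C (Df 1) : 𝓢'(Plane, ℂ)) (-∂_{e 1} (testSchwartz η hη hc))) = 0
    rw [map_neg, map_neg, toL2C_coe_apply _ _ (hκ1 0), toL2C_coe_apply _ _ (hκ1 1),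
      toL2C_coe_apply _ _ (testSchwartz_apply η hη hc)]
    have := congrArg (fun r : ℝ => (r : ℂ)) (h η hη hc)
    rw [Fin.sum_univ_two] at this
    push_cast at this
    linear_combination this
  have hR := (isRepr_fourier (toL2C f)).add ((((isRepr_fourier (toL2C (Df 0))).fourier_lineDeriv
    0).add ((isRepr_fourier (toL2C (Df 1))).fourier_lineDeriv 1)).smul (-1))
  have hR0 : IsRepr (𝓕 (toL2C f : 𝓢'(Plane, ℂ)) + (-1 : ℂ) •
      (𝓕 (∂_{e 0} (toL2C (Df 0) : 𝓢'(Plane, ℂ))) + 𝓕 (∂_{e 1} (toL2C (Df 1) : 𝓢'(Plane, ℂ)))))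
      (fun _ => 0) := by
    have hz := congrArg (fun T : 𝓢'(Plane, ℂ) => 𝓕 T) hT
    simp only [FourierTransform.fourier_add, FourierTransform.fourier_smul] at hz
    rw [hz]
    have : (𝓕 (0 : 𝓢'(Plane, ℂ))) = 0 := by ext κ; rfl
    rw [this]
    exact isRepr_zero
  have hf0 : (𝓕 (toL2C f) : L2C) =ᵐ[volume] fun _ => (0 : ℂ) := by
    filter_upwards [hR.ae_eq hR0, (hw 0).fourier, (hw 1).fourier] with ξ h0 h1 h2
    rw [h1, h2] at h0
    have hne : ((1 + 4 * Real.pi ^ 2 * (ξ 0 ^ 2 + ξ 1 ^ 2) : ℝ) : ℂ) ≠ 0 := by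
      exact_mod_cast (by positivity : (1 + 4 * Real.pi ^ 2 * (ξ 0 ^ 2 + ξ 1 ^ 2) : ℝ) ≠ 0)
    refine (mul_eq_zero.1 (?_ : _ * (𝓕 (toL2C f) : L2C) ξ = 0)).resolve_left hne
    simp only [sym] at h0
    push_cast
    have hI : Complex.I ^ 2 = -1 := Complex.I_sq
    linear_combination h0 + 4 * (Real.pi : ℂ) ^ 2 * ((ξ 0 : ℂ) ^ 2 + (ξ 1 : ℂ) ^ 2) *
      (𝓕 (toL2C f) : L2C) ξ * hI
  have hzero : ∀ g : L2R, (𝓕 (toL2C g) : L2C) =ᵐ[volume] (fun _ => (0 : ℂ)) → g = 0 := by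
    intro g hg
    have h1 : toL2C g = 0 := by
      apply (Lp.fourierTransformₗᵢ Plane ℂ).injective
      rw [map_zero]
      exact Lp.ext (hg.trans (Lp.coeFn_zero ℂ 2 (volume : Measure Plane)).symm)
    have := norm_toL2C g
    rw [h1, norm_zero] at this
    exact norm_eq_zero.1 this.symm
  refine ⟨hzero f hf0, fun k => hzero _ ?_⟩
  filter_upwards [(hw k).fourier, hf0] with ξ h1 h2
  rw [h1, h2, mul_zero]

theorem inner_L2R (f g : L2R) : inner ℝ f g = ∫ x, f x * g x := by
  rw [L2.inner_def]
  exact integral_congr_ae (.of_forall fun x => by simp [mul_comm])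

/-- Smooth compactly supported functions are dense in `H¹`. -/
theorem MemH1.exists_contDiff_approx {f : Plane → ℝ} {Df : Fin 2 → Plane → ℝ} (h : MemH1 f Df)
    {ε : ℝ} (hε : 0 < ε) : ∃ η : Plane → ℝ, ContDiff ℝ ∞ η ∧ HasCompactSupport η ∧
      (eLpNorm (fun x => f x - η x) 2 volume).toReal ≤ ε ∧
      ∀ k, (eLpNorm (fun x => Df k x - pd k η x) 2 volume).toReal ≤ ε := by
  let X := PiLp 2 (fun _ : Option (Fin 2) => L2R)
  let T := {η : Plane → ℝ // ContDiff ℝ ∞ η ∧ HasCompactSupport η}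
  have mk : ∀ η : T, MemH1 η.1 (fun k => pd k η.1) := fun η => memH1_of_contDiff η.2.1 η.2.2
  let J : (g : Plane → ℝ) → (Dg : Fin 2 → Plane → ℝ) → MemH1 g Dg → X := fun g Dg hg =>
    WithLp.toLp 2 fun o => match o with
      | none => hg.memLp.toLp g
      | some k => (hg.memLp_grad k).toLp (Dg k)
  let K : Submodule ℝ X :=
    { carrier := Set.range fun η : T => J _ _ (mk η)
      zero_mem' := by
        refine ⟨⟨fun _ => 0, contDiff_const, HasCompactSupport.zero⟩, ?_⟩
        apply PiLp.ext
        rintro (_ | k)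
        · exact MemLp.toLp_zero
            (mk ⟨fun _ => 0, contDiff_const, HasCompactSupport.zero⟩).memLp
        · change MemLp.toLp (pd k fun _ => 0)
            ((memH1_of_contDiff contDiff_const HasCompactSupport.zero).memLp_grad k) = 0
          rw [Lp.eq_zero_iff_ae_eq_zero]
          refine (MemLp.coeFn_toLp _).trans (.of_forall fun x => ?_)
          simp [pd]
      add_mem' := by
        rintro _ _ ⟨η, rfl⟩ ⟨ζ, rfl⟩
        refine ⟨⟨fun x => η.1 x + ζ.1 x, η.2.1.add ζ.2.1, η.2.2.add ζ.2.2⟩, ?_⟩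
        apply PiLp.ext
        rintro (_ | k)
        · exact MemLp.toLp_add (mk η).memLp (mk ζ).memLp
        · change MemLp.toLp (pd k fun x => η.1 x + ζ.1 x)
            ((memH1_of_contDiff (η.2.1.add ζ.2.1) (η.2.2.add ζ.2.2)).memLp_grad k) =
            MemLp.toLp _ ((mk η).memLp_grad k) + MemLp.toLp _ ((mk ζ).memLp_grad k)
          rw [← MemLp.toLp_add]
          refine MemLp.toLp_congr _ _ (.of_forall fun x => ?_)
          simp only [pd, Pi.add_apply]
          rw [fderiv_fun_add (η.2.1.differentiable (by simp) x)
            (ζ.2.1.differentiable (by simp) x)]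
          rfl
      smul_mem' := by
        rintro c _ ⟨η, rfl⟩
        refine ⟨⟨fun x => c * η.1 x, contDiff_const.mul η.2.1, η.2.2.mul_left⟩, ?_⟩
        apply PiLp.ext
        rintro (_ | k)
        · exact MemLp.toLp_const_smul c (mk η).memLp
        · change MemLp.toLp (pd k fun x => c * η.1 x)
            ((memH1_of_contDiff (contDiff_const.mul η.2.1) (η.2.2.mul_left)).memLp_grad k) =
            c • MemLp.toLp _ ((mk η).memLp_grad k)
          rw [← MemLp.toLp_const_smul]
          refine MemLp.toLp_congr _ _ (.of_forall fun x => ?_)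
          simp only [pd, Pi.smul_apply]
          rw [fderiv_const_mul (η.2.1.differentiable (by simp) x)]
          rfl }
  let W : Set X := ⋂ (k : Fin 2) (η : T), {x | inner ℝ (x none) ((mk η).memLp_grad k).toLp
    = -inner ℝ (x (some k)) (mk η).memLp.toLp}
  have hWc : IsClosed W := by
    refine isClosed_iInter fun k => isClosed_iInter fun η => isClosed_eq ?_ ?_
    · exact (PiLp.continuous_apply 2 _ none).inner continuous_const
    · exact ((PiLp.continuous_apply 2 _ (some k)).inner continuous_const).neg
  have hW : ∀ g Dg (hg : MemH1 g Dg), J g Dg hg ∈ W := by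
    intro g Dg hg
    simp only [W, Set.mem_iInter]
    intro k η
    change inner ℝ (hg.memLp.toLp g) ((mk η).memLp_grad k).toLp
      = -inner ℝ ((hg.memLp_grad k).toLp) (mk η).memLp.toLp
    have h1 := (hg.weak k).2.2 η.1 η.2.1 η.2.2
    rw [inner_L2R, inner_L2R]
    refine Eq.trans (integral_congr_ae ?_) (h1.trans (congrArg Neg.neg (integral_congr_ae ?_)))
    · filter_upwards [hg.memLp.coeFn_toLp, ((mk η).memLp_grad k).coeFn_toLp] with x h1 h2
      rw [h1, h2]
    · filter_upwards [(hg.memLp_grad k).coeFn_toLp, (mk η).memLp.coeFn_toLp] with x h1 h2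
      rw [h1, h2]
  have hKW : (K.topologicalClosure : Set X) ⊆ W := by
    refine closure_minimal ?_ hWc
    rintro _ ⟨η, rfl⟩
    exact hW _ _ (mk η)
  obtain ⟨y, hy, z, hz, hyz⟩ := K.topologicalClosure.exists_add_mem_mem_orthogonal (J f Df h)
  have hzW : z ∈ W := by
    have e : z = J f Df h - y := by rw [hyz]; abel
    have h1 := hW f Df h
    have h2 := hKW hy
    simp only [W, Set.mem_iInter, Set.mem_ofPred_eq] at h1 h2 ⊢
    intro k η
    rw [e]
    change inner ℝ ((J f Df h) none - y none) _ = -inner ℝ ((J f Df h) (some k) - y (some k)) _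
    rw [inner_sub_left, inner_sub_left, h1 k η, h2 k η]; ring
  have hz0 : z = 0 := by
    have hz1 := eq_zero_of_orthogonal_test (f := z none) (Df := fun k => z (some k)) ?_ ?_
    · apply PiLp.ext
      rintro (_ | k)
      · exact hz1.1
      · exact hz1.2 k
    · intro k
      refine ⟨locallyIntegrable_L2 _, locallyIntegrable_L2 _, fun η hη hc => ?_⟩
      simp only [W, Set.mem_iInter, Set.mem_ofPred_eq] at hzW
      have h1 := hzW k ⟨η, hη, hc⟩
      rw [inner_L2R, inner_L2R] at h1
      refine Eq.trans (integral_congr_ae ?_) (h1.trans (congrArg Neg.neg (integral_congr_ae ?_)))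
      · filter_upwards [((mk ⟨η, hη, hc⟩).memLp_grad k).coeFn_toLp] with x h1
        rw [h1]
      · filter_upwards [(mk ⟨η, hη, hc⟩).memLp.coeFn_toLp] with x h1
        rw [h1]
    · intro η hη hc
      have h1 : inner ℝ (J _ _ (mk ⟨η, hη, hc⟩)) z = 0 :=
        hz _ (K.le_topologicalClosure ⟨⟨η, hη, hc⟩, rfl⟩)
      rw [PiLp.inner_apply, Fintype.sum_option] at h1
      rw [← h1]
      congr 1
      · rw [real_inner_comm, inner_L2R]
        refine integral_congr_ae ?_
        filter_upwards [(mk ⟨η, hη, hc⟩).memLp.coeFn_toLp] with x h1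
        exact congrArg (z none x * ·) h1.symm
      · refine Finset.sum_congr rfl fun k _ => ?_
        rw [real_inner_comm, inner_L2R]
        refine integral_congr_ae ?_
        filter_upwards [((mk ⟨η, hη, hc⟩).memLp_grad k).coeFn_toLp] with x h1
        exact congrArg (z (some k) x * ·) h1.symm
  have hmem : J f Df h ∈ K.topologicalClosure := by rw [hyz, hz0, add_zero]; exact hy
  obtain ⟨_, ⟨η, rfl⟩, hd⟩ := Metric.mem_closure_iff.1 hmem ε hε
  rw [dist_eq_norm] at hd
  refine ⟨η.1, η.2.1, η.2.2, ?_, fun k => ?_⟩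
  · refine le_trans (le_of_eq ?_) ((PiLp.norm_apply_le (J f Df h - J _ _ (mk η)) none).trans hd.le)
    change _ = ‖h.memLp.toLp f - (mk η).memLp.toLp‖
    rw [← MemLp.toLp_sub, Lp.norm_toLp]; rfl
  · refine le_trans (le_of_eq ?_)
      ((PiLp.norm_apply_le (J f Df h - J _ _ (mk η)) (some k)).trans hd.le)
    change _ = ‖(h.memLp_grad k).toLp (Df k) - ((mk η).memLp_grad k).toLp‖
    rw [← MemLp.toLp_sub, Lp.norm_toLp]; rfl

/-! ### Ladyzhenskaya's inequality and integration by parts in `H¹` -/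

/-- The `L²` norm as a real number. -/
def n2 (f : Plane → ℝ) : ℝ := (eLpNorm f 2 volume).toReal

/-- The `L⁴` norm as a real number. -/
def n4 (f : Plane → ℝ) : ℝ := (eLpNorm f 4 volume).toReal

theorem n2_nonneg (f : Plane → ℝ) : 0 ≤ n2 f := ENNReal.toReal_nonneg

theorem n4_nonneg (f : Plane → ℝ) : 0 ≤ n4 f := ENNReal.toReal_nonneg

instance holderTriple_four : ENNReal.HolderTriple 4 4 2 :=
  ⟨by
    rw [← ENNReal.toReal_eq_toReal_iff' (by simp) (by simp), ENNReal.toReal_add (by simp) (by simp)]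
    simp [ENNReal.toReal_inv]; norm_num⟩

theorem norm_fderiv_le_sum_pd (η : Plane → ℝ) (x : Plane) :
    ‖fderiv ℝ η x‖ ≤ ∑ k, |pd k η x| := by
  refine ContinuousLinearMap.opNorm_le_bound _
    (Finset.sum_nonneg fun k _ => abs_nonneg _) fun y => ?_
  have hy : y = ∑ k, y k • (EuclideanSpace.single k (1 : ℝ) : Plane) := by
    ext i
    simp [PiLp.single_apply, Fin.sum_univ_two]
    fin_cases i <;> simp
  conv_lhs => rw [hy]
  rw [map_sum, Finset.sum_mul]
  refine (norm_sum_le _ _).trans (Finset.sum_le_sum fun k _ => ?_)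
  rw [map_smul, norm_smul, mul_comm]
  exact mul_le_mul_of_nonneg_left (PiLp.norm_apply_le y k) (abs_nonneg _)

/-- Ladyzhenskaya's inequality for test functions: the Gagliardo–Nirenberg–Sobolev inequality
`‖η²‖₂ ≤ C ‖∇(η²)‖₁` in the plane, with `∇(η²) = 2 η ∇η`. -/
theorem exists_ladyzhenskaya_test : ∃ K : ℝ≥0, ∀ η : Plane → ℝ, ContDiff ℝ ∞ η →
    HasCompactSupport η → n4 η ^ 2 ≤ K * (n2 η * ∑ k, n2 (pd k η)) := by
  let C := eLpNormLESNormFDerivOneConst (volume : Measure Plane) (2 : ℝ≥0)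
  refine ⟨2 * C, fun η hη hc => ?_⟩
  have hp : NNReal.HolderConjugate (Module.finrank ℝ Plane) (2 : ℝ≥0) := by
    rw [finrank_euclideanSpace, Fintype.card_fin]
    rw [NNReal.holderConjugate_iff]
    constructor
    · norm_num
    · apply NNReal.eq; push_cast; norm_num
  have h1 := eLpNorm_le_eLpNorm_fderiv_one (volume : Measure Plane) (u := fun x => η x * η x)
    ((hη.mul hη).of_le (by simp)) (hc.mul_left) hp
  have hm2 : MemLp η 2 (volume : Measure Plane) := hη.continuous.memLp_of_hasCompactSupport hc
  have hm4 : MemLp η 4 (volume : Measure Plane) := hη.continuous.memLp_of_hasCompactSupport hc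
  have hd2 : ∀ k, MemLp (pd k η) 2 (volume : Measure Plane) := fun k =>
    (contDiff_pd hη k).continuous.memLp_of_hasCompactSupport (hasCompactSupport_pd hc k)
  have e1 : eLpNorm (fun x => η x * η x) 2 volume = eLpNorm η 4 volume ^ 2 := by
    have h := eLpNorm_norm_rpow (p := 2) (μ := (volume : Measure Plane)) η (q := 2) (by norm_num)
    have h4 : (2 : ℝ≥0∞) * ENNReal.ofReal 2 = 4 := by
      rw [ENNReal.ofReal_ofNat]; norm_num
    rw [h4] at h
    have h5 : eLpNorm (fun x => η x * η x) 2 volume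
        = eLpNorm (fun x => ‖η x‖ ^ (2 : ℝ)) 2 volume := by
      congr 1
      funext x
      rw [Real.rpow_two, Real.norm_eq_abs, sq_abs, sq]
    rw [h5, h]
    exact ENNReal.rpow_natCast _ 2
  have hs : MemLp (fun x => ∑ k, |pd k η x|) 2 (volume : Measure Plane) :=
    memLp_finsetSum _ fun k _ => (hd2 k).abs
  have e2 : eLpNorm (fderiv ℝ fun x => η x * η x) 1 volume
      ≤ 2 * (eLpNorm η 2 volume * ∑ k, eLpNorm (pd k η) 2 volume) := by
    have hle : eLpNorm (fderiv ℝ fun x => η x * η x) 1 volume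
        ≤ eLpNorm ((2 : ℝ) • (η • fun x => ∑ k, |pd k η x|)) 1 volume := by
      refine eLpNorm_mono fun x => ?_
      rw [fderiv_fun_mul (hη.differentiable (by simp) x) (hη.differentiable (by simp) x)]
      have hb := norm_fderiv_le_sum_pd η x
      have hnn : 0 ≤ ∑ k, |pd k η x| := Finset.sum_nonneg fun k _ => abs_nonneg _
      have e : ‖((2 : ℝ) • (η • fun x => ∑ k, |pd k η x|)) x‖ = 2 * (|η x| * ∑ k, |pd k η x|) := by
        simp only [Pi.smul_apply, Pi.mul_apply, smul_eq_mul, norm_mul,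
          Real.norm_eq_abs]
        rw [abs_of_nonneg hnn, abs_two]
      rw [e, ← two_smul ℝ, norm_smul, norm_smul]
      simp only [Real.norm_eq_abs, abs_two]
      gcongr
    refine hle.trans ?_
    rw [eLpNorm_const_smul]
    have h2 : ‖(2 : ℝ)‖ₑ = 2 := by
      rw [Real.enorm_eq_ofReal (by norm_num), ENNReal.ofReal_ofNat]
    rw [h2]
    gcongr
    refine (eLpNorm_smul_le_mul_eLpNorm (p := 2) (q := 2) (r := 1) hs.1 hm2.1).trans ?_
    gcongr
    have hsum := eLpNorm_sum_le (μ := (volume : Measure Plane)) (p := 2) (s := Finset.univ)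
      (f := fun k x => |pd k η x|) (fun k _ => (hd2 k).abs.1) (by norm_num)
    refine le_trans (le_of_eq ?_) (hsum.trans (le_of_eq ?_))
    · congr 1
    · refine Finset.sum_congr rfl fun k _ => ?_
      exact eLpNorm_norm (pd k η)
  have e3 : eLpNorm η 4 volume ^ 2
      ≤ (2 * C : ℝ≥0) * (eLpNorm η 2 volume * ∑ k, eLpNorm (pd k η) 2 volume) := by
    rw [← e1]
    refine h1.trans ?_
    push_cast
    calc (C : ℝ≥0∞) * eLpNorm (fderiv ℝ fun x => η x * η x) 1 volume
        ≤ C * (2 * (eLpNorm η 2 volume * ∑ k, eLpNorm (pd k η) 2 volume)) := by gcongr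
      _ = 2 * C * (eLpNorm η 2 volume * ∑ k, eLpNorm (pd k η) 2 volume) := by ring
  have hfin : (∑ k, eLpNorm (pd k η) 2 volume) ≠ ⊤ :=
    ENNReal.sum_ne_top.2 fun k _ => (hd2 k).eLpNorm_ne_top
  have e4 := ENNReal.toReal_mono (ENNReal.mul_ne_top ENNReal.coe_ne_top
    (ENNReal.mul_ne_top hm2.eLpNorm_ne_top hfin)) e3
  rw [ENNReal.toReal_pow, ENNReal.toReal_mul, ENNReal.toReal_mul,
    ENNReal.toReal_sum fun k _ => (hd2 k).eLpNorm_ne_top] at e4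
  exact e4

theorem n2_sub_comm (f g : Plane → ℝ) : n2 (fun x => f x - g x) = n2 (fun x => g x - f x) := by
  unfold n2
  rw [← eLpNorm_neg]
  congr 2
  funext x; simp

theorem n2_add_le {f g : Plane → ℝ} (hf : MemLp f 2 (volume : Measure Plane))
    (hg : MemLp g 2 (volume : Measure Plane)) : n2 (fun x => f x + g x) ≤ n2 f + n2 g := by
  unfold n2
  rw [← ENNReal.toReal_add hf.eLpNorm_ne_top hg.eLpNorm_ne_top]
  exact ENNReal.toReal_mono (ENNReal.add_ne_top.2 ⟨hf.eLpNorm_ne_top, hg.eLpNorm_ne_top⟩)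
    (eLpNorm_add_le hf.1 hg.1 (by norm_num))

theorem n2_le_of_sub_le {f η : Plane → ℝ} (hf : MemLp f 2 (volume : Measure Plane))
    (hη : MemLp η 2 (volume : Measure Plane)) {ε : ℝ} (h : n2 (fun x => f x - η x) ≤ ε) :
    n2 η ≤ n2 f + ε := by
  rw [n2_sub_comm] at h
  have := n2_add_le (hη.sub hf) hf
  have e : (fun x => (η - f) x + f x) = η := by funext x; simp
  rw [e] at this
  change n2 (η - f) ≤ ε at h
  linarith

/-- Ladyzhenskaya's inequality in `H¹(ℝ²)`. -/
theorem exists_ladyzhenskaya : ∃ K : ℝ, 0 ≤ K ∧ ∀ (f : Plane → ℝ) (Df : Fin 2 → Plane → ℝ),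
    MemH1 f Df → MemLp f 4 (volume : Measure Plane) ∧ n4 f ^ 2 ≤ K * (n2 f * ∑ k, n2 (Df k)) := by
  obtain ⟨K, hK⟩ := exists_ladyzhenskaya_test
  refine ⟨K, K.2, fun f Df h => ?_⟩
  choose η hη hc h1 h2 using fun n : ℕ => h.exists_contDiff_approx (ε := 1 / ((n : ℝ) + 1))
    (by positivity)
  have hηm : ∀ n, MemLp (η n) 2 (volume : Measure Plane) := fun n =>
    (hη n).continuous.memLp_of_hasCompactSupport (hc n)
  have hηm4 : ∀ n, MemLp (η n) 4 (volume : Measure Plane) := fun n =>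
    (hη n).continuous.memLp_of_hasCompactSupport (hc n)
  have hηd : ∀ n k, MemLp (pd k (η n)) 2 (volume : Measure Plane) := fun n k =>
    (contDiff_pd (hη n) k).continuous.memLp_of_hasCompactSupport (hasCompactSupport_pd (hc n) k)
  let B : ℕ → ℝ := fun n => K * ((n2 f + 1 / ((n : ℝ) + 1)) * ∑ k, (n2 (Df k) + 1 / ((n : ℝ) + 1)))
  have hB : ∀ n, n4 (η n) ^ 2 ≤ B n := by
    intro n
    refine (hK _ (hη n) (hc n)).trans ?_
    have a1 := n2_le_of_sub_le h.memLp (hηm n) (h1 n)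
    have a2 := fun k => n2_le_of_sub_le (h.memLp_grad k) (hηd n k) (h2 n k)
    have a3 : ∑ k, n2 (pd k (η n)) ≤ ∑ k, (n2 (Df k) + 1 / ((n : ℝ) + 1)) :=
      Finset.sum_le_sum fun k _ => a2 k
    have a4 : 0 ≤ ∑ k, n2 (pd k (η n)) := Finset.sum_nonneg fun k _ => n2_nonneg _
    have a5 : 0 ≤ n2 f + 1 / ((n : ℝ) + 1) := (n2_nonneg _).trans a1
    exact mul_le_mul_of_nonneg_left (mul_le_mul a1 a3 a4 a5) K.2
  have hlim0 : Tendsto (fun n : ℕ => 1 / ((n : ℝ) + 1)) atTop (𝓝 0) :=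
    tendsto_one_div_add_atTop_nhds_zero_nat
  have hBlim : Tendsto B atTop (𝓝 (K * (n2 f * ∑ k, n2 (Df k)))) := by
    have : Tendsto B atTop (𝓝 (K * ((n2 f + 0) * ∑ k, (n2 (Df k) + 0)))) :=
      (((hlim0.const_add _).mul (tendsto_finsetSum _ fun k _ => hlim0.const_add _)).const_mul _)
    simpa using this
  have hconv : Tendsto (fun n => eLpNorm (η n - f) 2 volume) atTop (𝓝 0) := by
    have hb : ∀ n, eLpNorm (η n - f) 2 volume ≤ ENNReal.ofReal (1 / ((n : ℝ) + 1)) := by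
      intro n
      rw [eLpNorm_sub_comm]
      exact (ENNReal.le_ofReal_iff_toReal_le (h.memLp.sub (hηm n)).eLpNorm_ne_top
        (by positivity)).2 (h1 n)
    refine tendsto_of_tendsto_of_tendsto_of_le_of_le tendsto_const_nhds ?_ (fun _ => zero_le) hb
    simpa using ENNReal.tendsto_ofReal hlim0
  obtain ⟨ns, hns, hae⟩ := (tendstoInMeasure_of_tendsto_eLpNorm two_ne_zero (fun n => (hηm n).1)
    h.memLp.1 hconv).exists_seq_tendsto_ae
  have hF := Lp.eLpNorm_lim_le_liminf_eLpNorm (p := 4) (fun n => (hηm (ns n)).1) f hae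
  have hle : ∀ n, eLpNorm (η (ns n)) 4 volume ≤ ENNReal.ofReal (√(B (ns n))) := by
    intro n
    refine (ENNReal.le_ofReal_iff_toReal_le (hηm4 _).eLpNorm_ne_top (Real.sqrt_nonneg _)).2 ?_
    exact Real.le_sqrt_of_sq_le (hB _)
  have hlim2 : Tendsto (fun n => ENNReal.ofReal (√(B (ns n)))) atTop
      (𝓝 (ENNReal.ofReal (√(K * (n2 f * ∑ k, n2 (Df k)))))) :=
    ENNReal.tendsto_ofReal ((Real.continuous_sqrt.tendsto _).comp
      (hBlim.comp hns.tendsto_atTop))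
  have hfin : eLpNorm f 4 volume ≤ ENNReal.ofReal (√(K * (n2 f * ∑ k, n2 (Df k)))) := by
    refine hF.trans ?_
    rw [← hlim2.liminf_eq]
    exact liminf_le_liminf (.of_forall hle)
  have hm : MemLp f 4 (volume : Measure Plane) := ⟨h.memLp.1, hfin.trans_lt ENNReal.ofReal_lt_top⟩
  refine ⟨hm, ?_⟩
  have hnn : 0 ≤ (K : ℝ) * (n2 f * ∑ k, n2 (Df k)) :=
    mul_nonneg K.2 (mul_nonneg (n2_nonneg _) (Finset.sum_nonneg fun k _ => n2_nonneg _))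
  have h5 : n4 f ≤ √(K * (n2 f * ∑ k, n2 (Df k))) :=
    (ENNReal.le_ofReal_iff_toReal_le hm.eLpNorm_ne_top (Real.sqrt_nonneg _)).1 hfin
  calc n4 f ^ 2 ≤ √(K * (n2 f * ∑ k, n2 (Df k))) ^ 2 := by
        have := n4_nonneg f
        gcongr
    _ = _ := Real.sq_sqrt hnn

theorem MemH1.memLp_four {f : Plane → ℝ} {Df : Fin 2 → Plane → ℝ} (h : MemH1 f Df) :
    MemLp f 4 (volume : Measure Plane) :=
  exists_ladyzhenskaya.choose_spec.2 f Df h |>.1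

theorem memLp_mul_four {g h : Plane → ℝ} (hg : MemLp g 4 (volume : Measure Plane))
    (hh : MemLp h 4 (volume : Measure Plane)) :
    MemLp (fun x => g x * h x) 2 (volume : Measure Plane) := MemLp.mul' hh hg

theorem integrable_mul_two {f g : Plane → ℝ} (hf : MemLp f 2 (volume : Measure Plane))
    (hg : MemLp g 2 (volume : Measure Plane)) : Integrable (fun x => f x * g x) volume :=
  memLp_one_iff_integrable.1 (MemLp.mul' hg hf)

theorem integrable_mul_mul {f g h : Plane → ℝ} (hf : MemLp f 2 (volume : Measure Plane))
    (hg : MemLp g 4 (volume : Measure Plane)) (hh : MemLp h 4 (volume : Measure Plane)) :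
    Integrable (fun x => f x * g x * h x) volume := by
  simpa only [mul_assoc] using integrable_mul_two hf (memLp_mul_four hg hh)

theorem abs_integral_mul_le {f g : Plane → ℝ} (hf : MemLp f 2 (volume : Measure Plane))
    (hg : MemLp g 2 (volume : Measure Plane)) : |∫ x, f x * g x| ≤ n2 f * n2 g := by
  refine (norm_integral_le_integral_norm (fun x => f x * g x)).trans ?_
  have hm : MemLp (fun x => f x * g x) 1 (volume : Measure Plane) := MemLp.mul' hg hf
  have h : eLpNorm (f • g) 1 volume ≤ eLpNorm f 2 volume * eLpNorm g 2 volume :=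
    eLpNorm_smul_le_mul_eLpNorm (p := 2) (q := 2) (r := 1) hg.1 hf.1
  rw [integral_norm_eq_lintegral_enorm hm.1, n2, n2, ← ENNReal.toReal_mul]
  refine ENNReal.toReal_mono (ENNReal.mul_ne_top hf.eLpNorm_ne_top hg.eLpNorm_ne_top) ?_
  rw [eLpNorm_one_eq_lintegral_enorm] at h
  exact h

theorem n2_mul_le {g h : Plane → ℝ} (hg : MemLp g 4 (volume : Measure Plane))
    (hh : MemLp h 4 (volume : Measure Plane)) : n2 (fun x => g x * h x) ≤ n4 g * n4 h := by
  have h1 : eLpNorm (g • h) 2 volume ≤ eLpNorm g 4 volume * eLpNorm h 4 volume :=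
    eLpNorm_smul_le_mul_eLpNorm (p := 4) (q := 4) (r := 2) hh.1 hg.1
  rw [n2, n4, n4, ← ENNReal.toReal_mul]
  exact ENNReal.toReal_mono (ENNReal.mul_ne_top hg.eLpNorm_ne_top hh.eLpNorm_ne_top) h1

theorem abs_integral_mul_mul_le {f g h : Plane → ℝ} (hf : MemLp f 2 (volume : Measure Plane))
    (hg : MemLp g 4 (volume : Measure Plane)) (hh : MemLp h 4 (volume : Measure Plane)) :
    |∫ x, f x * g x * h x| ≤ n2 f * (n4 g * n4 h) := by
  simp only [mul_assoc]
  exact (abs_integral_mul_le hf (memLp_mul_four hg hh)).trans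
    (mul_le_mul_of_nonneg_left (n2_mul_le hg hh) (n2_nonneg _))

/-- A first order functional that is continuous on `H¹` and vanishes on test functions vanishes on
`H¹`. -/
theorem MemH1.functional_eq_zero {A B₀ B₁ B₂ G₁ G₂ : Plane → ℝ}
    (hA : MemLp A 2 (volume : Measure Plane)) (hB₀ : MemLp B₀ 2 (volume : Measure Plane))
    (hB₁ : MemLp B₁ 2 (volume : Measure Plane)) (hB₂ : MemLp B₂ 2 (volume : Measure Plane))
    (hG₁ : MemLp G₁ 4 (volume : Measure Plane)) (hG₂ : MemLp G₂ 4 (volume : Measure Plane))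
    {k : Fin 2}
    (hT : ∀ η : Plane → ℝ, ContDiff ℝ ∞ η → HasCompactSupport η →
      (∫ x, pd k η x * A x) + (∫ x, η x * B₀ x) + (∫ x, B₁ x * η x * G₁ x)
        + (∫ x, B₂ x * η x * G₂ x) = 0)
    {f : Plane → ℝ} {Df : Fin 2 → Plane → ℝ} (h : MemH1 f Df) :
    (∫ x, Df k x * A x) + (∫ x, f x * B₀ x) + (∫ x, B₁ x * f x * G₁ x)
        + (∫ x, B₂ x * f x * G₂ x) = 0 := by
  obtain ⟨K, hK, hlad⟩ := exists_ladyzhenskaya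
  set C : ℝ := n2 A + n2 B₀ + √(K * 2) * (n2 B₁ * n4 G₁ + n2 B₂ * n4 G₂) with hC
  have key : ∀ ε : ℝ, 0 < ε → |(∫ x, Df k x * A x) + (∫ x, f x * B₀ x)
      + (∫ x, B₁ x * f x * G₁ x) + (∫ x, B₂ x * f x * G₂ x)| ≤ ε * C := by
    intro ε hε
    obtain ⟨η, hη, hc, h1, h2⟩ := h.exists_contDiff_approx hε
    have hηH := memH1_of_contDiff hη hc
    have hd := h.sub hηH
    have hη4 := hηH.memLp_four
    have hf4 := h.memLp_four
    have e1 : ∫ x, (Df k x - pd k η x) * A x = (∫ x, Df k x * A x) - ∫ x, pd k η x * A x := by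
      rw [← integral_sub (integrable_mul_two (h.memLp_grad k) hA)
        (integrable_mul_two (hηH.memLp_grad k) hA)]
      simp only [sub_mul]
    have e2 : ∫ x, (f x - η x) * B₀ x = (∫ x, f x * B₀ x) - ∫ x, η x * B₀ x := by
      rw [← integral_sub (integrable_mul_two h.memLp hB₀) (integrable_mul_two hηH.memLp hB₀)]
      simp only [sub_mul]
    have e3 : ∫ x, B₁ x * (f x - η x) * G₁ x
        = (∫ x, B₁ x * f x * G₁ x) - ∫ x, B₁ x * η x * G₁ x := by
      rw [← integral_sub (integrable_mul_mul hB₁ hf4 hG₁) (integrable_mul_mul hB₁ hη4 hG₁)]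
      simp only [sub_mul, mul_sub]
    have e4 : ∫ x, B₂ x * (f x - η x) * G₂ x
        = (∫ x, B₂ x * f x * G₂ x) - ∫ x, B₂ x * η x * G₂ x := by
      rw [← integral_sub (integrable_mul_mul hB₂ hf4 hG₂) (integrable_mul_mul hB₂ hη4 hG₂)]
      simp only [sub_mul, mul_sub]
    have hn4 : n4 (fun x => f x - η x) ≤ √(K * 2) * ε := by
      have hl := (hlad _ _ hd).2
      have a1 : n2 (fun x => f x - η x) ≤ ε := h1
      have a2 : ∑ j, n2 (fun x => Df j x - pd j η x) ≤ 2 * ε := by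
        rw [Fin.sum_univ_two]
        have := h2 0
        have := h2 1
        unfold n2
        linarith
      have a3 : n2 (fun x => f x - η x) * ∑ j, n2 (fun x => Df j x - pd j η x) ≤ ε * (2 * ε) :=
        mul_le_mul a1 a2 (Finset.sum_nonneg fun j _ => n2_nonneg _) hε.le
      have a4 : n4 (fun x => f x - η x) ^ 2 ≤ (√(K * 2) * ε) ^ 2 := by
        rw [mul_pow, Real.sq_sqrt (by positivity)]
        refine hl.trans ((mul_le_mul_of_nonneg_left a3 hK).trans (le_of_eq (by ring)))
      exact le_of_sq_le_sq a4 (by positivity)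
    have b1 := abs_integral_mul_le (hd.memLp_grad k) hA
    have b2 := abs_integral_mul_le hd.memLp hB₀
    have b3 := abs_integral_mul_mul_le hB₁ hd.memLp_four hG₁
    have b4 := abs_integral_mul_mul_le hB₂ hd.memLp_four hG₂
    have c1 : n2 (fun x => Df k x - pd k η x) * n2 A ≤ ε * n2 A :=
      mul_le_mul_of_nonneg_right (h2 k) (n2_nonneg _)
    have c2 : n2 (fun x => f x - η x) * n2 B₀ ≤ ε * n2 B₀ :=
      mul_le_mul_of_nonneg_right h1 (n2_nonneg _)
    have c3 : n2 B₁ * (n4 (fun x => f x - η x) * n4 G₁) ≤ n2 B₁ * ((√(K * 2) * ε) * n4 G₁) :=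
      mul_le_mul_of_nonneg_left (mul_le_mul_of_nonneg_right hn4 (n4_nonneg _)) (n2_nonneg _)
    have c4 : n2 B₂ * (n4 (fun x => f x - η x) * n4 G₂) ≤ n2 B₂ * ((√(K * 2) * ε) * n4 G₂) :=
      mul_le_mul_of_nonneg_left (mul_le_mul_of_nonneg_right hn4 (n4_nonneg _)) (n2_nonneg _)
    have hz := hT η hη hc
    rw [e1] at b1
    rw [e2] at b2
    rw [e3] at b3
    rw [e4] at b4
    rw [abs_le] at *
    have hCe : ε * C = ε * n2 A + ε * n2 B₀ + n2 B₁ * ((√(K * 2) * ε) * n4 G₁)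
        + n2 B₂ * ((√(K * 2) * ε) * n4 G₂) := by rw [hC]; ring
    rw [hCe]
    constructor <;> linarith [b1.1, b1.2, b2.1, b2.2, b3.1, b3.2, b4.1, b4.2]
  have hC0 : 0 ≤ C := by
    have := n2_nonneg A
    have := n2_nonneg B₀
    have := n2_nonneg B₁
    have := n2_nonneg B₂
    have := n4_nonneg G₁
    have := n4_nonneg G₂
    positivity
  rw [← abs_nonpos_iff]
  refine le_of_forall_pos_le_add fun δ hδ => ?_
  refine (key (δ / (C + 1)) (by positivity)).trans ?_
  rw [zero_add, div_mul_eq_mul_div, div_le_iff₀ (by positivity)]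
  nlinarith

/-- Integration by parts for a product of two `H¹` functions. -/
theorem MemH1.integral_mul_eq_neg {f g : Plane → ℝ} {Df Dg : Fin 2 → Plane → ℝ} (hf : MemH1 f Df)
    (hg : MemH1 g Dg) (k : Fin 2) : ∫ x, Df k x * g x = -∫ x, f x * Dg k x := by
  have z2 : MemLp (fun _ => (0 : ℝ)) 2 (volume : Measure Plane) := MemLp.zero
  have z4 : MemLp (fun _ => (0 : ℝ)) 4 (volume : Measure Plane) := MemLp.zero
  have := MemH1.functional_eq_zero (A := g) (B₀ := Dg k) (k := k) hg.memLp (hg.memLp_grad k) z2 z2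
    z4 z4 (fun η hη hc => by
      have := (hg.weak k).2.2 η hη hc
      simp only [mul_comm (g _), mul_comm (Dg k _)] at this
      simp [this]) hf
  simp only [zero_mul, integral_zero, add_zero] at this
  linarith

/-- Integration by parts for a product of three `H¹` functions. -/
theorem MemH1.integral_mul_mul_eq_neg {f g h : Plane → ℝ} {Df Dg Dh : Fin 2 → Plane → ℝ}
    (hf : MemH1 f Df) (hg : MemH1 g Dg) (hh : MemH1 h Dh) (k : Fin 2) :
    ∫ x, Df k x * g x * h x = -(∫ x, Dg k x * f x * h x) - ∫ x, Dh k x * f x * g x := by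
  have z2 : MemLp (fun _ => (0 : ℝ)) 2 (volume : Measure Plane) := MemLp.zero
  -- first for test functions in place of `f` and `g`, then for a test function in place of `f`
  have s1 : ∀ η : Plane → ℝ, ContDiff ℝ ∞ η → HasCompactSupport η →
      ∀ ζ : Plane → ℝ, ContDiff ℝ ∞ ζ → HasCompactSupport ζ →
      (∫ x, pd k ζ x * (η x * h x)) + (∫ x, ζ x * (fun _ => (0 : ℝ)) x)
        + (∫ x, Dh k x * ζ x * η x) + (∫ x, pd k η x * ζ x * h x) = 0 := by
    intro η hη hc ζ hζ hcζ
    have hηH := memH1_of_contDiff hη hc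
    have hζH := memH1_of_contDiff hζ hcζ
    have hw := (hh.weak k).2.2 (fun x => η x * ζ x) (hη.mul hζ) hc.mul_right
    have e : ∫ x, h x * pd k (fun x => η x * ζ x) x
        = (∫ x, pd k η x * ζ x * h x) + ∫ x, pd k ζ x * (η x * h x) := by
      rw [← integral_add (integrable_mul_mul (hηH.memLp_grad k) hζH.memLp_four hh.memLp_four)
        (integrable_mul_two (hζH.memLp_grad k) (memLp_mul_four hηH.memLp_four hh.memLp_four))]
      refine integral_congr_ae (.of_forall fun x => ?_)
      simp only [pd_mul (hη.differentiable (by simp)) (hζ.differentiable (by simp))]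
      ring
    have e2 : ∫ x, Dh k x * (η x * ζ x) = ∫ x, Dh k x * ζ x * η x :=
      integral_congr_ae (.of_forall fun x => by ring)
    rw [e, e2] at hw
    simp only [mul_zero, integral_zero]
    linarith
  have s2 : ∀ η : Plane → ℝ, ContDiff ℝ ∞ η → HasCompactSupport η →
      (∫ x, pd k η x * (g x * h x)) + (∫ x, η x * (fun _ => (0 : ℝ)) x)
        + (∫ x, Dg k x * η x * h x) + (∫ x, Dh k x * η x * g x) = 0 := by
    intro η hη hc
    have hηH := memH1_of_contDiff hη hc
    have := MemH1.functional_eq_zero (k := k) (memLp_mul_four hηH.memLp_four hh.memLp_four) z2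
      (hh.memLp_grad k) (hηH.memLp_grad k) hηH.memLp_four hh.memLp_four (s1 η hη hc) hg
    have r1 : ∫ x, Dg k x * (η x * h x) = ∫ x, Dg k x * η x * h x := by simp only [mul_assoc]
    have r2 : ∫ x, Dh k x * g x * η x = ∫ x, Dh k x * η x * g x :=
      integral_congr_ae (.of_forall fun x => by ring)
    have r3 : ∫ x, pd k η x * g x * h x = ∫ x, pd k η x * (g x * h x) := by simp only [mul_assoc]
    rw [r1, r2, r3] at this
    simp only [mul_zero, integral_zero] at this ⊢
    linarith
  have := MemH1.functional_eq_zero (k := k) (memLp_mul_four hg.memLp_four hh.memLp_four) z2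
    (hg.memLp_grad k) (hh.memLp_grad k) hh.memLp_four hg.memLp_four s2 hf
  simp only [mul_zero, integral_zero, ← mul_assoc] at this
  linarith

/-! ### Vector valued primitives on the time half-line -/

section Time

variable {H : Type*} [NormedAddCommGroup H] [NormedSpace ℝ H]

/-- Fubini's theorem on the triangle `0 < s ≤ t ≤ T`. -/
theorem integral_triangle_swap {T : ℝ} {F : ℝ → ℝ → H}
    (hF : Integrable (Function.uncurry F)
      ((volume.restrict (Set.Ioc 0 T)).prod (volume.restrict (Set.Ioc 0 T)))) :
    ∫ t in Set.Ioc 0 T, ∫ s in Set.Ioc 0 t, F t s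
      = ∫ s in Set.Ioc 0 T, ∫ t in Set.Icc s T, F t s := by
  have hm : MeasurableSet {z : ℝ × ℝ | z.2 ≤ z.1} := measurableSet_le measurable_snd measurable_fst
  have h := integral_integral_swap (f := fun t s => {z : ℝ × ℝ | z.2 ≤ z.1}.indicator
    (Function.uncurry F) (t, s)) (hF.indicator hm)
  have e1 : ∀ t ∈ Set.Ioc 0 T, ∫ s in Set.Ioc 0 T, {z : ℝ × ℝ | z.2 ≤ z.1}.indicator
      (Function.uncurry F) (t, s) = ∫ s in Set.Ioc 0 t, F t s := by
    intro t ht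
    have : (fun s => {z : ℝ × ℝ | z.2 ≤ z.1}.indicator (Function.uncurry F) (t, s))
        = (Set.Iic t).indicator (fun s => F t s) := by
      funext s
      simp only [Set.indicator_apply, Set.mem_ofPred_eq, Set.mem_Iic, Function.uncurry]
    rw [this, setIntegral_indicator measurableSet_Iic]
    congr 2
    ext s
    simp only [Set.mem_inter_iff, Set.mem_Ioc, Set.mem_Iic]
    exact ⟨fun h => ⟨h.1.1, h.2⟩, fun h => ⟨⟨h.1, h.2.trans ht.2⟩, h.2⟩⟩
  have e2 : ∀ s ∈ Set.Ioc 0 T, ∫ t in Set.Ioc 0 T, {z : ℝ × ℝ | z.2 ≤ z.1}.indicator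
      (Function.uncurry F) (t, s) = ∫ t in Set.Icc s T, F t s := by
    intro s hs
    have : (fun t => {z : ℝ × ℝ | z.2 ≤ z.1}.indicator (Function.uncurry F) (t, s))
        = (Set.Ici s).indicator (fun t => F t s) := by
      funext t
      simp only [Set.indicator_apply, Set.mem_ofPred_eq, Set.mem_Ici, Function.uncurry]
    rw [this, setIntegral_indicator measurableSet_Ici]
    congr 2
    ext t
    simp only [Set.mem_inter_iff, Set.mem_Ioc, Set.mem_Ici, Set.mem_Icc]
    exact ⟨fun h => ⟨h.2, h.1.2⟩, fun h => ⟨⟨hs.1.trans_le h.1, h.2⟩, h.1⟩⟩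
  rw [setIntegral_congr_fun measurableSet_Ioc e1, setIntegral_congr_fun measurableSet_Ioc e2] at h
  exact h

theorem continuousOn_primitive_Ioc {Y : ℝ → H} {T : ℝ} (hY : IntegrableOn Y (Set.Ioc 0 T)) :
    ContinuousOn (fun t => ∫ s in Set.Ioc 0 t, Y s) (Set.Icc 0 T) := by
  refine intervalIntegral.continuousOn_primitive ?_
  exact (integrableOn_Icc_iff_integrableOn_Ioc).2 hY

variable [CompleteSpace H]

theorem integral_deriv_smul_primitive {θ : ℝ → ℝ} (hθ : ContDiff ℝ ∞ θ) {T : ℝ}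
    (hT : ∀ t, T ≤ t → θ t = 0) {Y : ℝ → H} (hY : IntegrableOn Y (Set.Ioc 0 T)) :
    ∫ t in Set.Ioc 0 T, deriv θ t • ∫ s in Set.Ioc 0 t, Y s
      = -∫ t in Set.Ioc 0 T, θ t • Y t := by
  have hd : Continuous (deriv θ) := hθ.continuous_deriv (by simp)
  have hi : IntegrableOn (deriv θ) (Set.Ioc 0 T) :=
    (hd.integrableOn_Icc (a := 0) (b := T)).mono_set Set.Ioc_subset_Icc_self
  have h := integral_triangle_swap (T := T) (F := fun t s => deriv θ t • Y s) (hi.smul_prod hY)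
  simp only [integral_smul] at h
  rw [h, ← integral_neg]
  refine setIntegral_congr_fun measurableSet_Ioc fun s hs => ?_
  rw [integral_smul_const, integral_Icc_eq_integral_Ioc, ← intervalIntegral.integral_of_le hs.2,
    intervalIntegral.integral_deriv_eq_sub (fun x _ => hθ.differentiable (by simp) x)
      (hd.intervalIntegrable _ _), hT T le_rfl, zero_sub, neg_smul]

/-- If `X' = Y` in the sense of distributions on `[0, ∞)`, with vanishing initial value, then `X` is
the primitive of `Y`. -/
theorem ae_eq_primitive_of_forall_test {X Y : ℝ → H} (hX : ∀ T, IntegrableOn X (Set.Ioc 0 T))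
    (hY : ∀ T, IntegrableOn Y (Set.Ioc 0 T))
    (h : ∀ θ : ℝ → ℝ, ContDiff ℝ ∞ θ → HasCompactSupport θ →
      ∫ t in Set.Ioi 0, deriv θ t • X t = -∫ t in Set.Ioi 0, θ t • Y t) :
    ∀ᵐ t ∂timeMeasure, X t = ∫ s in Set.Ioc 0 t, Y s := by
  set Z : ℝ → H := fun t => ∫ s in Set.Ioc 0 t, Y s with hZ
  have hZi : ∀ T, IntegrableOn Z (Set.Ioc 0 T) := fun T =>
    ((continuousOn_primitive_Ioc (hY T)).integrableOn_Icc).mono_set Set.Ioc_subset_Icc_self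
  have hW : LocallyIntegrableOn (fun t => X t - Z t) (Set.Ioi 0) := by
    refine (locallyIntegrableOn_iff (isOpen_Ioi.isLocallyClosed)).2 fun k hk hc => ?_
    obtain ⟨T, hT⟩ := hc.bddAbove
    exact ((hX T).sub (hZi T)).mono_set fun t ht => ⟨hk ht, hT ht⟩
  have key := isOpen_Ioi.ae_eq_zero_of_integral_contDiff_smul_eq_zero (μ := volume) hW
    fun κ hκ hc hs => ?_
  · refine (ae_restrict_iff' measurableSet_Ioi).2 ?_
    filter_upwards [key] with t ht h0
    exact sub_eq_zero.1 (ht h0)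
  -- `θ` is a compactly supported primitive of `κ` on the half-line: the mass of `κ` is compensated
  -- by a translate of `κ` that lives in negative times.
  obtain ⟨T', hT'⟩ := hc.isCompact.bddAbove
  set T : ℝ := max T' 0
  have hT0 : 0 ≤ T := le_max_right _ _
  have hκT : ∀ t, t ∉ Set.Ioc 0 T → κ t = 0 := by
    intro t ht
    by_contra h0
    have h1 : t ∈ tsupport κ := subset_tsupport _ h0
    exact ht ⟨hs h1, (hT' h1).trans (le_max_left _ _)⟩
  set K : ℝ → ℝ := fun t => ∫ s in (0 : ℝ)..t, κ s with hK
  have hKd : ∀ t, HasDerivAt K (κ t) t := fun t =>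
    intervalIntegral.integral_hasDerivAt_right (hκ.continuous.intervalIntegrable _ _)
      hκ.continuous.aestronglyMeasurable.stronglyMeasurableAtFilter hκ.continuous.continuousAt
  have hKs : ContDiff ℝ ∞ K := by
    rw [contDiff_infty_iff_deriv]
    refine ⟨fun t => (hKd t).differentiableAt, ?_⟩
    rw [show deriv K = κ from funext fun t => (hKd t).deriv]
    exact hκ
  set θ : ℝ → ℝ := fun t => K t - K (t + T) with hθ
  have hθs : ContDiff ℝ ∞ θ := hKs.sub (hKs.comp (contDiff_id.add contDiff_const))
  have hθd : ∀ t, 0 < t → deriv θ t = κ t := by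
    intro t ht
    have h1 : HasDerivAt θ (κ t - κ (t + T)) t :=
      (hKd t).sub ((hKd (t + T)).comp_add_const t T)
    rw [h1.deriv, hκT (t + T) (fun h => by have := h.2; linarith), sub_zero]
  have hθ0 : ∀ t, t ∉ Set.Icc (-T) T → θ t = 0 := by
    intro t ht
    have e : θ t = -∫ s in t..(t + T), κ s := by
      rw [hθ, ← intervalIntegral.integral_interval_sub_left
        (hκ.continuous.intervalIntegrable 0 _) (hκ.continuous.intervalIntegrable 0 _)]
      ring
    rw [e, intervalIntegral.integral_congr (g := fun _ => 0), intervalIntegral.integral_zero,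
      neg_zero]
    intro s hs
    rw [Set.uIcc_of_le (by linarith)] at hs
    refine hκT s fun h => ht ⟨?_, ?_⟩
    · linarith [hs.2, h.1]
    · linarith [hs.1, h.2]
  have hθc : HasCompactSupport θ := HasCompactSupport.intro isCompact_Icc hθ0
  have hθT : ∀ t, T + 1 ≤ t → θ t = 0 := fun t ht => hθ0 t fun h => by linarith [h.2]
  have e1 := h θ hθs hθc
  have e2 := integral_deriv_smul_primitive hθs hθT (hY (T + 1))
  have hsub : ∀ V : ℝ → H, ∀ ρ : ℝ → ℝ, (∀ t, T + 1 < t → ρ t = 0) →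
      ∫ t in Set.Ioi 0, ρ t • V t = ∫ t in Set.Ioc 0 (T + 1), ρ t • V t := by
    intro V ρ hρ
    refine setIntegral_eq_of_subset_of_forall_sdiff_eq_zero measurableSet_Ioi
      Set.Ioc_subset_Ioi_self fun t ht => ?_
    rw [hρ t (not_le.1 fun h => ht.2 ⟨ht.1, h⟩), zero_smul]
  have hdT : ∀ t, T + 1 < t → deriv θ t = 0 := fun t ht => by
    rw [hθd t (by linarith), hκT t fun h => by linarith [h.2]]
  rw [hsub X _ hdT, hsub Y _ fun t ht => hθT t ht.le] at e1
  have hbX : IntegrableOn (fun t => deriv θ t • X t) (Set.Ioc 0 (T + 1)) := by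
    have hdc : Continuous (deriv θ) := hθs.continuous_deriv (by simp)
    have hcs : HasCompactSupport (deriv θ) := hθc.deriv
    obtain ⟨C, hC⟩ := hcs.exists_bound_of_continuous hdc
    exact (hX (T + 1)).bdd_smul C hdc.aestronglyMeasurable (.of_forall hC)
  have hbZ : IntegrableOn (fun t => deriv θ t • Z t) (Set.Ioc 0 (T + 1)) := by
    have hdc : Continuous (deriv θ) := hθs.continuous_deriv (by simp)
    have hcs : HasCompactSupport (deriv θ) := hθc.deriv
    obtain ⟨C, hC⟩ := hcs.exists_bound_of_continuous hdc
    exact (hZi (T + 1)).bdd_smul C hdc.aestronglyMeasurable (.of_forall hC)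
  have e3 : ∫ t in Set.Ioc 0 (T + 1), deriv θ t • (X t - Z t) = 0 := by
    simp only [smul_sub]
    rw [integral_sub hbX hbZ, e1, e2, sub_self]
  have e4 : ∫ t, κ t • (X t - Z t) = ∫ t in Set.Ioc 0 (T + 1), κ t • (X t - Z t) := by
    refine (setIntegral_eq_integral_of_forall_compl_eq_zero fun t ht => ?_).symm
    rw [hκT t fun h => ht ⟨h.1, by linarith [h.2]⟩, zero_smul]
  rw [e4, ← e3]
  refine setIntegral_congr_fun measurableSet_Ioc fun t ht => ?_
  simp only [hθd t ht.1]

end Time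

theorem integrableOn_inner_primitive {H : Type*} [NormedAddCommGroup H] [InnerProductSpace ℝ H]
    {Y : ℝ → H} {T : ℝ} (hY : IntegrableOn Y (Set.Ioc 0 T)) :
    IntegrableOn (fun t => (inner ℝ (∫ s in Set.Ioc 0 t, Y s) (Y t) : ℝ)) (Set.Ioc 0 T) := by
  have hc := continuousOn_primitive_Ioc hY
  obtain ⟨C, hC⟩ := isCompact_Icc.exists_bound_of_continuousOn hc
  refine Integrable.mono' (hY.norm.const_mul C) ?_ ?_
  · exact ((hc.mono Set.Ioc_subset_Icc_self).aestronglyMeasurable measurableSet_Ioc).inner hY.1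
  · filter_upwards [ae_restrict_mem measurableSet_Ioc] with t ht
    refine (norm_inner_le_norm _ _).trans ?_
    exact mul_le_mul_of_nonneg_right (hC t (Set.Ioc_subset_Icc_self ht)) (norm_nonneg _)

/-- The chain rule `‖X‖² = 2 ∫ ⟨X, X'⟩` for the primitive `X` of an integrable function. -/
theorem norm_sq_primitive {H : Type*} [NormedAddCommGroup H] [InnerProductSpace ℝ H]
    [CompleteSpace H] {Y : ℝ → H} {T : ℝ} (hY : IntegrableOn Y (Set.Ioc 0 T)) :
    ‖∫ s in Set.Ioc 0 T, Y s‖ ^ 2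
      = 2 * ∫ t in Set.Ioc 0 T, inner ℝ (∫ s in Set.Ioc 0 t, Y s) (Y t) := by
  have hYt : ∀ t ∈ Set.Ioc 0 T, IntegrableOn Y (Set.Ioc 0 t) := fun t ht =>
    hY.mono_set (Set.Ioc_subset_Ioc_right ht.2)
  have hF : Integrable (Function.uncurry fun t s => (inner ℝ (Y s) (Y t) : ℝ))
      ((volume.restrict (Set.Ioc 0 T)).prod (volume.restrict (Set.Ioc 0 T))) := by
    have hn : Integrable (fun z : ℝ × ℝ => ‖Y z.1‖ * ‖Y z.2‖)
      ((volume.restrict (Set.Ioc 0 T)).prod (volume.restrict (Set.Ioc 0 T))) :=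
      hY.norm.mul_prod hY.norm
    refine hn.mono' ?_ (.of_forall fun z => ?_)
    · exact (hY.1.comp_snd).inner (hY.1.comp_fst)
    · exact (norm_inner_le_norm _ _).trans_eq (mul_comm _ _)
  have h1 := integral_triangle_swap hF
  have e1 : ∀ t ∈ Set.Ioc 0 T, (∫ s in Set.Ioc 0 t, (inner ℝ (Y s) (Y t) : ℝ))
      = inner ℝ (∫ s in Set.Ioc 0 t, Y s) (Y t) := by
    intro t ht
    have := integral_inner (𝕜 := ℝ) (hYt t ht) (Y t)
    rw [real_inner_comm, ← this]
    simp only [real_inner_comm]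
  have e2 : ∀ s ∈ Set.Ioc 0 T, (∫ t in Set.Icc s T, (inner ℝ (Y s) (Y t) : ℝ))
      = inner ℝ (Y s) (∫ t in Set.Ioc s T, Y t) := by
    intro s hs
    rw [integral_Icc_eq_integral_Ioc]
    exact integral_inner (𝕜 := ℝ) (hY.mono_set (Set.Ioc_subset_Ioc_left hs.1.le)) (Y s)
  rw [setIntegral_congr_fun measurableSet_Ioc e1, setIntegral_congr_fun measurableSet_Ioc e2] at h1
  set X : H := ∫ s in Set.Ioc 0 T, Y s with hX
  have e3 : ∀ s ∈ Set.Ioc 0 T, (inner ℝ (Y s) (∫ t in Set.Ioc s T, Y t) : ℝ)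
      = inner ℝ X (Y s) - inner ℝ (∫ t in Set.Ioc 0 s, Y t) (Y s) := by
    intro s hs
    have hu : X = (∫ t in Set.Ioc 0 s, Y t) + ∫ t in Set.Ioc s T, Y t := by
      rw [hX, ← setIntegral_union (Set.Ioc_disjoint_Ioc_of_le le_rfl) measurableSet_Ioc
        (hYt s hs) (hY.mono_set (Set.Ioc_subset_Ioc_left hs.1.le)),
        Set.Ioc_union_Ioc_eq_Ioc hs.1.le hs.2]
    rw [hu, inner_add_left, real_inner_comm]
    ring
  have i1 : IntegrableOn (fun s => (inner ℝ X (Y s) : ℝ)) (Set.Ioc 0 T) := hY.const_inner X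
  have i2 := integrableOn_inner_primitive hY
  rw [setIntegral_congr_fun measurableSet_Ioc e3, integral_sub i1 i2,
    integral_inner (𝕜 := ℝ) hY X, ← hX, real_inner_self_eq_norm_sq] at h1
  linarith

/-! ### Paths in `L²` -/

open Classical in
/-- A function of time and space as a path in `L²(ℝ²)`; it takes the value `0` at the times at which
the function is not square integrable. -/
def path (f : ℝ → Plane → ℝ) (t : ℝ) : L2R :=
  if h : MemLp (f t) 2 (volume : Measure Plane) then h.toLp (f t) else 0

theorem path_eq {f : ℝ → Plane → ℝ} {t : ℝ} (h : MemLp (f t) 2 (volume : Measure Plane)) :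
    path f t = h.toLp (f t) := dif_pos h

theorem coeFn_path {f : ℝ → Plane → ℝ} {t : ℝ} (h : MemLp (f t) 2 (volume : Measure Plane)) :
    path f t =ᵐ[volume] f t := by
  rw [path_eq h]; exact h.coeFn_toLp

theorem norm_path {f : ℝ → Plane → ℝ} {t : ℝ} (h : MemLp (f t) 2 (volume : Measure Plane)) :
    ‖path f t‖ = n2 (f t) := by
  rw [path_eq h, Lp.norm_toLp, n2]

theorem norm_path_le (f : ℝ → Plane → ℝ) (t : ℝ) : ‖path f t‖ ≤ n2 (f t) := by
  by_cases h : MemLp (f t) 2 (volume : Measure Plane)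
  · exact (norm_path h).le
  · rw [path, dif_neg h, norm_zero]; exact n2_nonneg _

theorem countable_of_hilbertBasis {ι H : Type*} [NormedAddCommGroup H] [InnerProductSpace ℝ H]
    [TopologicalSpace.SeparableSpace H] (b : HilbertBasis ι ℝ H) : Countable ι := by
  have hd : (Set.univ : Set ι).PairwiseDisjoint fun i => Metric.ball (b i) (1 / 2) := by
    intro i _ j _ hij
    refine Metric.ball_disjoint_ball ?_
    have h1 : ‖b i - b j‖ ^ 2 = 2 := by
      rw [norm_sub_sq_real, b.orthonormal.1 i, b.orthonormal.1 j, b.orthonormal.2 hij]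
      norm_num
    rw [dist_eq_norm]
    nlinarith [norm_nonneg (b i - b j)]
  have := hd.countable_of_isOpen (fun i _ => Metric.isOpen_ball)
    (fun i _ => Metric.nonempty_ball.2 (by norm_num))
  exact Set.countable_univ_iff.1 this

/-- A path is the pointwise limit of its partial sums in a Hilbert basis of `L²`, whose coefficients
are measurable by Fubini. -/
theorem aestronglyMeasurable_path {f : ℝ → Plane → ℝ} (hf : SpaceTimeMeasurable f)
    (h2 : ∀ᵐ t ∂timeMeasure, MemLp (f t) 2 (volume : Measure Plane)) :
    AEStronglyMeasurable (path f) timeMeasure := by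
  have : Fact ((2 : ℝ≥0∞) ≠ ⊤) := ⟨by norm_num⟩
  have : SecondCountableTopology L2R := by unfold L2R; infer_instance
  obtain ⟨w, b, -⟩ := exists_hilbertBasis ℝ L2R
  have := countable_of_hilbertBasis b
  have hc : ∀ i, AEStronglyMeasurable (fun t => ∫ x, b i x * f t x) timeMeasure := by
    intro i
    exact AEStronglyMeasurable.integral_prod_right' (f := fun z : ℝ × Plane => b i z.2 * f z.1 z.2)
      ((Lp.aestronglyMeasurable (b i)).comp_snd.mul hf)
  have hs : ∀ s : Finset w, AEStronglyMeasurable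
      (fun t => ∑ i ∈ s, (∫ x, b i x * f t x) • b i) timeMeasure := fun s =>
    Finset.aestronglyMeasurable_fun_sum s fun i _ => (hc i).smul_const (b i)
  refine aestronglyMeasurable_of_tendsto_ae atTop hs ?_
  filter_upwards [h2] with t ht
  have h := b.hasSum_repr (path f t)
  have e : ∀ i, b.repr (path f t) i = ∫ x, b i x * f t x := by
    intro i
    rw [b.repr_apply_apply, inner_L2R]
    refine integral_congr_ae ?_
    filter_upwards [coeFn_path ht] with x hx
    rw [hx]
  simp only [e] at h
  exact h

/-- Local integrability of a path from a bound on its norm. -/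
theorem integrableOn_path {f : ℝ → Plane → ℝ} (hf : SpaceTimeMeasurable f)
    (h2 : ∀ᵐ t ∂timeMeasure, MemLp (f t) 2 (volume : Measure Plane)) {g : ℝ → ℝ} {T : ℝ}
    (hg : IntegrableOn g (Set.Ioc 0 T)) (hb : ∀ᵐ t ∂timeMeasure, n2 (f t) ≤ g t) :
    IntegrableOn (path f) (Set.Ioc 0 T) := by
  have hle : volume.restrict (Set.Ioc 0 T) ≤ timeMeasure :=
    Measure.restrict_mono Set.Ioc_subset_Ioi_self le_rfl
  refine Integrable.mono' hg ((aestronglyMeasurable_path hf h2).mono_measure hle) ?_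
  exact ae_mono hle (hb.mono fun t ht => (norm_path_le f t).trans ht)

/-- Gronwall's inequality for functions that satisfy an integral inequality almost everywhere. -/
theorem ae_eq_zero_of_le_integral {E a : ℝ → ℝ} (hE : ∀ᵐ t ∂timeMeasure, 0 ≤ E t)
    (ha : ∀ T, IntegrableOn a (Set.Ioc 0 T)) (ha0 : ∀ t, 0 ≤ a t)
    (haE : ∀ T, IntegrableOn (fun t => a t * E t) (Set.Ioc 0 T))
    (h : ∀ᵐ t ∂timeMeasure, E t ≤ ∫ s in Set.Ioc 0 t, a s * E s) :
    ∀ᵐ t ∂timeMeasure, E t = 0 := by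
  set F : ℝ → ℝ := fun t => ∫ s in Set.Ioc 0 t, a s * E s with hF
  have hE' : ∀ s : Set ℝ, s ⊆ Set.Ioi 0 → ∀ᵐ t ∂volume.restrict s, 0 ≤ E t ∧ E t ≤ F t :=
    fun s hs => ae_mono (Measure.restrict_mono hs le_rfl) (hE.and h)
  have hint : ∀ s t, 0 ≤ s → IntegrableOn (fun r => a r * E r) (Set.Ioc s t) := fun s t hs =>
    (haE t).mono_set (Set.Ioc_subset_Ioc_left hs)
  have hadd : ∀ s t, 0 ≤ s → s ≤ t → F t = F s + ∫ r in Set.Ioc s t, a r * E r := by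
    intro s t hs hst
    rw [hF]
    simp only
    rw [← setIntegral_union (Set.Ioc_disjoint_Ioc_of_le le_rfl) measurableSet_Ioc
      (hint 0 s le_rfl) (hint s t hs), Set.Ioc_union_Ioc_eq_Ioc hs hst]
  have hnn : ∀ s t, 0 ≤ s → 0 ≤ ∫ r in Set.Ioc s t, a r * E r := by
    intro s t hs
    refine integral_nonneg_of_ae ?_
    filter_upwards [hE' (Set.Ioc s t) fun r hr => hs.trans_lt hr.1] with r hr
    exact mul_nonneg (ha0 r) hr.1
  have hmono : ∀ s t, 0 ≤ s → s ≤ t → F s ≤ F t := fun s t hs hst => by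
    rw [hadd s t hs hst]; linarith [hnn s t hs]
  have hF0 : F 0 = 0 := by simp [hF]
  have hstep : ∀ s t, 0 ≤ s → s ≤ t → F t ≤ F s + F t * ∫ r in Set.Ioc s t, a r := by
    intro s t hs hst
    rw [hadd s t hs hst]
    refine add_le_add le_rfl ?_
    rw [← hadd s t hs hst, ← integral_const_mul]
    refine integral_mono_ae (hint s t hs)
      (((ha t).mono_set (Set.Ioc_subset_Ioc_left hs)).const_mul _) ?_
    filter_upwards [hE' (Set.Ioc s t) fun r hr => hs.trans_lt hr.1,
      ae_restrict_mem measurableSet_Ioc] with r hr hrm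
    have h1 : E r ≤ F t := hr.2.trans (hmono r t (hs.trans hrm.1.le) hrm.2)
    change a r * E r ≤ F t * a r
    rw [mul_comm (F t)]
    exact mul_le_mul_of_nonneg_left h1 (ha0 r)
  -- `F` vanishes identically: it cannot leave `0` after its last zero.
  have hall : ∀ T, 0 ≤ T → F T = 0 := by
    intro T hT
    have hc : ContinuousOn F (Set.Icc 0 T) := continuousOn_primitive_Ioc (haE T)
    have hcA : ContinuousOn (fun t => ∫ r in Set.Ioc 0 t, a r) (Set.Icc 0 T) :=
      continuousOn_primitive_Ioc (ha T)
    have hcl : IsClosed ({t | F t = 0} ∩ Set.Icc 0 T) := by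
      have := hc.preimage_isClosed_of_isClosed isClosed_Icc (isClosed_singleton (x := (0 : ℝ)))
      rwa [Set.inter_comm] at this
    have hz := hcl.Icc_subset_of_forall_mem_nhdsWithin (a := 0) (b := T) hF0 fun s hs => ?_
    · exact hz ⟨hT, le_rfl⟩
    have hs0 : F s = 0 := hs.1
    have hcw : ContinuousWithinAt (fun t => ∫ r in Set.Ioc 0 t, a r) (Set.Ioi s) s := by
      have := (hcA s ⟨hs.2.1, hs.2.2.le⟩).mono (Set.Icc_subset_Icc_left hs.2.1 : Set.Icc s T ⊆ _)
      exact this.mono_of_mem_nhdsWithin (Icc_mem_nhdsGT hs.2.2)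
    have hev : ∀ᶠ t in 𝓝[>] s, (∫ r in Set.Ioc 0 t, a r) < (∫ r in Set.Ioc 0 s, a r) + 1 / 2 :=
      hcw.eventually_lt_const (by linarith)
    filter_upwards [hev, self_mem_nhdsWithin] with t ht hst
    have hst' : s < t := hst
    have hA : ∫ r in Set.Ioc 0 t, a r = (∫ r in Set.Ioc 0 s, a r) + ∫ r in Set.Ioc s t, a r := by
      rw [← setIntegral_union (Set.Ioc_disjoint_Ioc_of_le le_rfl) measurableSet_Ioc
        (ha s) ((ha t).mono_set (Set.Ioc_subset_Ioc_left hs.2.1)),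
        Set.Ioc_union_Ioc_eq_Ioc hs.2.1 hst'.le]
    have h2 := hstep s t hs.2.1 hst'.le
    have h3 : 0 ≤ F t := hs0 ▸ hmono s t hs.2.1 hst'.le
    change F t = 0
    rw [hs0, zero_add] at h2
    nlinarith
  have hmem : ∀ᵐ t ∂timeMeasure, t ∈ Set.Ioi (0 : ℝ) := ae_restrict_mem measurableSet_Ioi
  filter_upwards [hE, h, hmem] with t h0 h1 ht
  rw [← hF] at *
  have : F t = 0 := hall t (le_of_lt ht)
  exact le_antisymm (h1.trans this.le) h0

/-! ### Classes of functions of time and space -/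

theorem restrict_Ioc_le_timeMeasure (T : ℝ) : volume.restrict (Set.Ioc 0 T) ≤ timeMeasure :=
  Measure.restrict_mono Set.Ioc_subset_Ioi_self le_rfl

theorem ae_timeMeasure_of_forall {p : ℝ → Prop}
    (h : ∀ T : ℝ, ∀ᵐ t ∂volume.restrict (Set.Ioc 0 T), p t) : ∀ᵐ t ∂timeMeasure, p t := by
  have e : Set.Ioi (0 : ℝ) = ⋃ n : ℕ, Set.Ioc 0 (n : ℝ) := by
    ext t
    simp only [Set.mem_Ioi, Set.mem_iUnion, Set.mem_Ioc]
    exact ⟨fun h => ⟨_, h, (exists_nat_ge t).choose_spec⟩, fun ⟨_, h⟩ => h.1⟩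
  rw [timeMeasure, e, ae_restrict_iUnion_iff]
  exact fun n => h n

theorem SpaceTimeMeasurable.ae_slice {f : ℝ → Plane → ℝ} (hf : SpaceTimeMeasurable f) :
    ∀ᵐ t ∂timeMeasure, AEStronglyMeasurable (f t) (volume : Measure Plane) :=
  AEStronglyMeasurable.prodMk_left hf

theorem SpaceTimeMeasurable.aemeasurable_normL2 {f : ℝ → Plane → ℝ} (hf : SpaceTimeMeasurable f) :
    AEMeasurable (fun t => normL2 (f t)) timeMeasure := by
  have e : (fun t => normL2 (f t)) = fun t => (∫⁻ x, ‖f t x‖ₑ ^ 2) ^ (1 / 2 : ℝ) := by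
    funext t
    rw [normL2, eLpNorm_eq_lintegral_rpow_enorm_toReal (by norm_num) (by norm_num)]
    simp
  rw [e]
  refine AEMeasurable.pow_const ?_ _
  exact AEMeasurable.lintegral_prod_right' (f := fun z : ℝ × Plane => ‖f z.1 z.2‖ₑ ^ 2)
    (hf.enorm.pow_const 2)

theorem SpaceTimeMeasurable.aestronglyMeasurable_n2 {f : ℝ → Plane → ℝ}
    (hf : SpaceTimeMeasurable f) : AEStronglyMeasurable (fun t => n2 (f t)) timeMeasure :=
  hf.aemeasurable_normL2.ennreal_toReal.aestronglyMeasurable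

/-- A function of time that is `p`-integrable on bounded intervals. -/
def TimeLp (p : ℝ≥0∞) (g : ℝ → ℝ) : Prop :=
  ∀ T : ℝ, MemLp g p (volume.restrict (Set.Ioc 0 T))

theorem TimeLp.mul {p q r : ℝ≥0∞} [ENNReal.HolderTriple p q r] {f g : ℝ → ℝ} (hf : TimeLp p f)
    (hg : TimeLp q g) : TimeLp r (fun t => f t * g t) := fun T => (hg T).mul' (hf T)

theorem TimeLp.add {p : ℝ≥0∞} {f g : ℝ → ℝ} (hf : TimeLp p f) (hg : TimeLp p g) :
    TimeLp p (fun t => f t + g t) := fun T => (hf T).add (hg T)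

theorem TimeLp.const_mul {p : ℝ≥0∞} {f : ℝ → ℝ} (hf : TimeLp p f) (c : ℝ) :
    TimeLp p (fun t => c * f t) := fun T => (hf T).const_mul c

theorem TimeLp.sum {p : ℝ≥0∞} {ι : Type*} (s : Finset ι) {f : ι → ℝ → ℝ}
    (hf : ∀ i ∈ s, TimeLp p (f i)) : TimeLp p (fun t => ∑ i ∈ s, f i t) := fun T =>
  memLp_finsetSum s fun i hi => hf i hi T

theorem TimeLp.mono_exponent {p q : ℝ≥0∞} {f : ℝ → ℝ} (hf : TimeLp q f) (hpq : p ≤ q) :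
    TimeLp p f := fun T => (hf T).mono_exponent hpq

theorem TimeLp.integrableOn {f : ℝ → ℝ} (hf : TimeLp 1 f) (T : ℝ) :
    IntegrableOn f (Set.Ioc 0 T) := memLp_one_iff_integrable.1 (hf T)

theorem timeLp_const (p : ℝ≥0∞) (c : ℝ) : TimeLp p (fun _ => c) := fun _ => memLp_const c

theorem InLinftyLoc.ae_memLp {f : ℝ → Plane → ℝ} (hf : InLinftyLoc normL2 f) :
    ∀ᵐ t ∂timeMeasure, MemLp (f t) 2 (volume : Measure Plane) := by
  have h : ∀ᵐ t ∂timeMeasure, normL2 (f t) < ⊤ := ae_timeMeasure_of_forall fun T => by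
    obtain ⟨M, hM⟩ := hf.2 T
    exact hM.mono fun t ht => ht.trans_lt ENNReal.coe_lt_top
  filter_upwards [h, hf.1.ae_slice] with t h1 h2 using ⟨h2, h1⟩

theorem InLinftyLoc.timeLp {f : ℝ → Plane → ℝ} (hf : InLinftyLoc normL2 f) :
    TimeLp ⊤ (fun t => n2 (f t)) := by
  intro T
  obtain ⟨M, hM⟩ := hf.2 T
  refine memLp_top_of_bound
    (hf.1.aestronglyMeasurable_n2.mono_measure (restrict_Ioc_le_timeMeasure T)) M ?_
  filter_upwards [hM] with t ht
  rw [Real.norm_eq_abs, abs_of_nonneg (n2_nonneg _)]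
  exact ENNReal.toReal_mono ENNReal.coe_ne_top ht

theorem InL2Loc.ae_memLp {f : ℝ → Plane → ℝ} (hf : InL2Loc normL2 f) :
    ∀ᵐ t ∂timeMeasure, MemLp (f t) 2 (volume : Measure Plane) := by
  have h : ∀ᵐ t ∂timeMeasure, normL2 (f t) < ⊤ := ae_timeMeasure_of_forall fun T => by
    have hm := (hf.1.aemeasurable_normL2.mono_measure (restrict_Ioc_le_timeMeasure T)).pow_const 2
    filter_upwards [ae_lt_top' hm (hf.2 T).ne] with t ht
    exact lt_of_not_ge fun h => by simp [top_le_iff.1 h] at ht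
  filter_upwards [h, hf.1.ae_slice] with t h1 h2 using ⟨h2, h1⟩

theorem InL2Loc.timeLp {f : ℝ → Plane → ℝ} (hf : InL2Loc normL2 f) :
    TimeLp 2 (fun t => n2 (f t)) := by
  intro T
  refine ⟨hf.1.aestronglyMeasurable_n2.mono_measure (restrict_Ioc_le_timeMeasure T), ?_⟩
  rw [eLpNorm_lt_top_iff_lintegral_rpow_enorm_lt_top (by norm_num) (by norm_num)]
  refine lt_of_le_of_lt (lintegral_mono fun t => ?_) (hf.2 T)
  simp only [ENNReal.toReal_ofNat, ENNReal.rpow_ofNat]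
  gcongr
  rw [Real.enorm_eq_ofReal (n2_nonneg _)]
  exact ENNReal.ofReal_toReal_le

/-- `f ∈ L^∞_loc L² ∩ L²_loc H¹`, with weak gradient `Df`. -/
structure InEnergy (f : ℝ → Plane → ℝ) (Df : Fin 2 → ℝ → Plane → ℝ) : Prop where
  bound : InLinftyLoc normL2 f
  bound_grad : ∀ k, InL2Loc normL2 (Df k)
  weak : ∀ k, HasWeakSpacePartial k f (Df k)

theorem InLinftyLoc.inL2Loc {f : ℝ → Plane → ℝ} (hf : InLinftyLoc normL2 f) :
    InL2Loc normL2 f := by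
  refine ⟨hf.1, fun T => ?_⟩
  obtain ⟨M, hM⟩ := hf.2 T
  calc ∫⁻ t in Set.Ioc 0 T, normL2 (f t) ^ 2 ≤ ∫⁻ _ in Set.Ioc 0 T, (M : ℝ≥0∞) ^ 2 :=
        lintegral_mono_ae (hM.mono fun t ht => by gcongr)
    _ < ⊤ := by
        rw [setLIntegral_const]
        exact ENNReal.mul_lt_top (by simp) (by simp)

theorem InEnergy.ae_memH1 {f : ℝ → Plane → ℝ} {Df : Fin 2 → ℝ → Plane → ℝ} (h : InEnergy f Df) :
    ∀ᵐ t ∂timeMeasure, MemH1 (f t) (fun k => Df k t) := by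
  filter_upwards [h.bound.ae_memLp, ae_all_iff.2 fun k => (h.bound_grad k).ae_memLp,
    ae_all_iff.2 h.weak] with t h1 h2 h3 using ⟨h1, h2, h3⟩

/-- The square of the bound that Ladyzhenskaya's inequality gives for `‖f‖₄²`. -/
def ladyWeight (f : ℝ → Plane → ℝ) (Df : Fin 2 → ℝ → Plane → ℝ) (t : ℝ) : ℝ :=
  (n2 (f t) * ∑ k, n2 (Df k t)) * (n2 (f t) * ∑ k, n2 (Df k t))

theorem InEnergy.timeLp_mul {f : ℝ → Plane → ℝ} {Df : Fin 2 → ℝ → Plane → ℝ}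
    (h : InEnergy f Df) : TimeLp 2 (fun t => n2 (f t) * ∑ k, n2 (Df k t)) :=
  h.bound.timeLp.mul (TimeLp.sum _ fun k _ => (h.bound_grad k).timeLp)

theorem InEnergy.timeLp_ladyWeight {f : ℝ → Plane → ℝ} {Df : Fin 2 → ℝ → Plane → ℝ}
    (h : InEnergy f Df) : TimeLp 1 (ladyWeight f Df) := h.timeLp_mul.mul h.timeLp_mul

theorem ladyWeight_nonneg (f : ℝ → Plane → ℝ) (Df : Fin 2 → ℝ → Plane → ℝ) (t : ℝ) :
    0 ≤ ladyWeight f Df t := mul_self_nonneg _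

/-- `f ∈ L¹_loc L²`. -/
structure InL1L2 (f : ℝ → Plane → ℝ) : Prop where
  meas : SpaceTimeMeasurable f
  memLp : ∀ᵐ t ∂timeMeasure, MemLp (f t) 2 (volume : Measure Plane)
  bound : ∃ g : ℝ → ℝ, TimeLp 1 g ∧ ∀ᵐ t ∂timeMeasure, n2 (f t) ≤ g t

theorem n2_const_mul (c : ℝ) (f : Plane → ℝ) : n2 (fun x => c * f x) = |c| * n2 f := by
  have h : eLpNorm (c • f) 2 volume = ‖c‖ₑ * eLpNorm f 2 volume := eLpNorm_const_smul c f 2 volume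
  have e : n2 (c • f) = |c| * n2 f := by
    rw [n2, h, ENNReal.toReal_mul, n2]; simp
  exact e

theorem InL1L2.add {f g : ℝ → Plane → ℝ} (hf : InL1L2 f) (hg : InL1L2 g) :
    InL1L2 (fun t x => f t x + g t x) := by
  obtain ⟨a, ha, ha'⟩ := hf.bound
  obtain ⟨b, hb, hb'⟩ := hg.bound
  refine ⟨AEStronglyMeasurable.add hf.meas hg.meas, ?_, fun t => a t + b t, ha.add hb, ?_⟩
  · filter_upwards [hf.memLp, hg.memLp] with t h1 h2 using h1.add h2
  · filter_upwards [hf.memLp, hg.memLp, ha', hb'] with t h1 h2 h3 h4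
    exact (n2_add_le h1 h2).trans (add_le_add h3 h4)

theorem InL1L2.const_mul {f : ℝ → Plane → ℝ} (hf : InL1L2 f) (c : ℝ) :
    InL1L2 (fun t x => c * f t x) := by
  obtain ⟨a, ha, ha'⟩ := hf.bound
  refine ⟨AEStronglyMeasurable.const_mul hf.meas c, ?_, fun t => |c| * a t, ha.const_mul _, ?_⟩
  · filter_upwards [hf.memLp] with t h1 using h1.const_mul c
  · filter_upwards [ha'] with t h1
    rw [n2_const_mul]
    exact mul_le_mul_of_nonneg_left h1 (abs_nonneg c)

theorem InL1L2.sub {f g : ℝ → Plane → ℝ} (hf : InL1L2 f) (hg : InL1L2 g) :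
    InL1L2 (fun t x => f t x - g t x) := by
  simpa [sub_eq_add_neg] using hf.add (hg.const_mul (-1))

theorem InL1L2.neg {f : ℝ → Plane → ℝ} (hf : InL1L2 f) : InL1L2 (fun t x => -f t x) := by
  simpa using hf.const_mul (-1)

theorem inL1L2_zero : InL1L2 (fun _ _ => 0) :=
  ⟨aestronglyMeasurable_const, .of_forall fun _ => MemLp.zero, fun _ => 0, timeLp_const 1 0,
    .of_forall fun _ => by simp [n2]⟩

theorem InL1L2.sum {ι : Type*} (s : Finset ι) {f : ι → ℝ → Plane → ℝ}
    (hf : ∀ i ∈ s, InL1L2 (f i)) : InL1L2 (fun t x => ∑ i ∈ s, f i t x) := by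
  classical
  induction s using Finset.induction_on with
  | empty => simpa using inL1L2_zero
  | insert i s hi ih =>
    simp only [Finset.sum_insert hi]
    exact (hf i (Finset.mem_insert_self i s)).add
      (ih fun j hj => hf j (Finset.mem_insert_of_mem hj))

theorem InL2Loc.inL1L2 {f : ℝ → Plane → ℝ} (hf : InL2Loc normL2 f) : InL1L2 f :=
  ⟨hf.1, hf.ae_memLp, _, hf.timeLp.mono_exponent (by norm_num), .of_forall fun _ => le_rfl⟩

/-- The product of two functions of the energy class. -/
theorem InEnergy.mul {f g : ℝ → Plane → ℝ} {Df Dg : Fin 2 → ℝ → Plane → ℝ}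
    (hf : InEnergy f Df) (hg : InEnergy g Dg) : InL1L2 (fun t x => f t x * g t x) := by
  obtain ⟨K, hK, hlad⟩ := exists_ladyzhenskaya
  refine ⟨AEStronglyMeasurable.mul hf.bound.1 hg.bound.1, ?_,
    fun t => K * (n2 (f t) * ∑ k, n2 (Df k t)) + K * (n2 (g t) * ∑ k, n2 (Dg k t)),
    ((hf.timeLp_mul.const_mul K).add (hg.timeLp_mul.const_mul K)).mono_exponent (by norm_num), ?_⟩
  · filter_upwards [hf.ae_memH1, hg.ae_memH1] with t h1 h2
    exact memLp_mul_four h1.memLp_four h2.memLp_four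
  · filter_upwards [hf.ae_memH1, hg.ae_memH1] with t h1 h2
    refine (n2_mul_le h1.memLp_four h2.memLp_four).trans ?_
    have a1 := (hlad _ _ h1).2
    have a2 := (hlad _ _ h2).2
    nlinarith [sq_nonneg (n4 (f t) - n4 (g t)), sq_nonneg (n4 (f t)), sq_nonneg (n4 (g t))]

/-- A function that is bounded in space, with a bound that is square integrable in time. -/
structure InL2Linfty (f : ℝ → Plane → ℝ) : Prop where
  meas : SpaceTimeMeasurable f
  bound : ∃ g : ℝ → ℝ, TimeLp 2 g ∧ ∀ᵐ t ∂timeMeasure, ∀ᵐ x, |f t x| ≤ g t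

theorem memLp_two_mul_bdd {f g : Plane → ℝ} {C : ℝ}
    (hf : AEStronglyMeasurable f (volume : Measure Plane)) (hC : ∀ᵐ x, |f x| ≤ C)
    (hg : MemLp g 2 (volume : Measure Plane)) :
    MemLp (fun x => f x * g x) 2 (volume : Measure Plane) ∧ n2 (fun x => f x * g x) ≤ C * n2 g := by
  have hb : ∀ᵐ x ∂(volume : Measure Plane), ‖f x * g x‖ ≤ C * ‖g x‖ := by
    filter_upwards [hC] with x hx
    rw [norm_mul]
    exact mul_le_mul_of_nonneg_right hx (norm_nonneg _)
  have hle := eLpNorm_le_mul_eLpNorm_of_ae_le_mul hb 2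
  have hm : MemLp (fun x => f x * g x) 2 (volume : Measure Plane) :=
    hg.of_le_mul (hf.mul hg.1) hb
  refine ⟨hm, ?_⟩
  rcases (eq_or_ne (volume : Measure Plane) 0) with h0 | h0
  · exact absurd h0 (NeZero.ne _)
  have hC0 : 0 ≤ C := by
    have : (ae (volume : Measure Plane)).NeBot := ae_neBot.2 h0
    obtain ⟨x, hx⟩ := hC.exists
    exact (abs_nonneg _).trans hx
  have := ENNReal.toReal_mono (ENNReal.mul_ne_top ENNReal.ofReal_ne_top hg.eLpNorm_ne_top) hle
  rwa [ENNReal.toReal_mul, ENNReal.toReal_ofReal hC0] at this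

/-- `L²_loc L^∞ · L²_loc L² ⊂ L¹_loc L²`. -/
theorem InL2Linfty.mul {f g : ℝ → Plane → ℝ} (hf : InL2Linfty f) (hg : SpaceTimeMeasurable g)
    (hg2 : ∀ᵐ t ∂timeMeasure, MemLp (g t) 2 (volume : Measure Plane)) {b : ℝ → ℝ}
    (hb : TimeLp 2 b) (hgb : ∀ᵐ t ∂timeMeasure, n2 (g t) ≤ b t) :
    InL1L2 (fun t x => f t x * g t x) := by
  obtain ⟨a, ha, ha'⟩ := hf.bound
  refine ⟨AEStronglyMeasurable.mul hf.meas hg, ?_, fun t => |a t| * b t, ?_, ?_⟩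
  · filter_upwards [ha', hf.meas.ae_slice, hg2] with t h1 h2 h3
    exact (memLp_two_mul_bdd h2 h1 h3).1
  · exact TimeLp.mul (p := 2) (q := 2) (fun T => (ha T).abs) hb
  · filter_upwards [ha', hf.meas.ae_slice, hg2, hgb] with t h1 h2 h3 h4
    refine (memLp_two_mul_bdd h2 h1 h3).2.trans ?_
    exact mul_le_mul (le_abs_self _) h4 (n2_nonneg _) (abs_nonneg _)

theorem InL2Linfty.mul_inL2Loc {f g : ℝ → Plane → ℝ} (hf : InL2Linfty f)
    (hg : InL2Loc normL2 g) : InL1L2 (fun t x => f t x * g t x) :=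
  hf.mul hg.1 hg.ae_memLp hg.timeLp (.of_forall fun _ => le_rfl)

/-- The embedding `H² ⊂ L^∞`, for functions of time and space. -/
theorem InEnergy.inL2Linfty {f : ℝ → Plane → ℝ} {Df : Fin 2 → ℝ → Plane → ℝ}
    {D2f : Fin 2 → Fin 2 → ℝ → Plane → ℝ} (hf : InEnergy f Df)
    (hDf : ∀ k, InEnergy (Df k) (D2f k)) : InL2Linfty f := by
  obtain ⟨C, hC, hres⟩ := exists_res_bound
  refine ⟨hf.bound.1, fun t => C * (n2 (f t) + ∑ k, n2 (D2f k k t)), ?_, ?_⟩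
  · exact (TimeLp.add hf.bound.inL2Loc.timeLp
      (TimeLp.sum _ fun k _ => ((hDf k).bound_grad k).timeLp)).const_mul C
  · filter_upwards [hf.ae_memH1, ae_all_iff.2 fun k => (hDf k).ae_memH1] with t h1 h2
    set F : L2R := h1.memLp.toLp
    set G : Fin 2 → L2R := fun k => ((h2 k).memLp_grad k).toLp
    have hw1 : ∀ k, res ((h1.memLp_grad k).toLp) = resD k F := fun k =>
      res_weakPartial ((h1.weak k).toLp h1.memLp (h1.memLp_grad k))
    have hw2 : ∀ k, res (G k) = resDD k k F := by
      intro k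
      rw [res_weakPartial (((h2 k).weak k).toLp (h1.memLp_grad k) ((h2 k).memLp_grad k)),
        resD_weakPartial ((h1.weak k).toLp h1.memLp (h1.memLp_grad k))]
    have e : res (F - ∑ k, G k) = F := by
      rw [map_sub, map_sum]
      simp only [hw2]
      exact res_sub_laplacian F
    have h3 := hres (F - ∑ k, G k)
    rw [e] at h3
    have h4 : ‖F - ∑ k, G k‖ ≤ n2 (f t) + ∑ k, n2 (D2f k k t) := by
      refine (norm_sub_le _ _).trans (add_le_add ?_ ((norm_sum_le _ _).trans
        (Finset.sum_le_sum fun k _ => ?_)))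
      · exact (Lp.norm_toLp _ h1.memLp).le
      · exact (Lp.norm_toLp _ ((h2 k).memLp_grad k)).le
    filter_upwards [h3, h1.memLp.coeFn_toLp] with x h5 h6
    rw [← h6]
    exact h5.trans (mul_le_mul_of_nonneg_left h4 hC)

theorem integrableOn_Ioi_smul_of_hasCompactSupport {H : Type*} [NormedAddCommGroup H]
    [NormedSpace ℝ H] {Y : ℝ → H} (hY : ∀ T, IntegrableOn Y (Set.Ioc 0 T)) {ρ : ℝ → ℝ}
    (hρ : Continuous ρ) (hc : HasCompactSupport ρ) :
    IntegrableOn (fun t => ρ t • Y t) (Set.Ioi 0) := by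
  obtain ⟨T, hT⟩ := hc.isCompact.bddAbove
  obtain ⟨C, hC⟩ := hc.exists_bound_of_continuous hρ
  have h1 : IntegrableOn (fun t => ρ t • Y t) (Set.Ioc 0 T) :=
    (hY T).bdd_smul C hρ.aestronglyMeasurable (.of_forall hC)
  refine h1.of_forall_sdiff_eq_zero measurableSet_Ioi fun t ht => ?_
  have : ρ t = 0 := by
    by_contra h0
    exact ht.2 ⟨ht.1, hT (subset_tsupport _ h0)⟩
  rw [this, zero_smul]

theorem InL1L2.integrableOn_path {f : ℝ → Plane → ℝ} (hf : InL1L2 f) (T : ℝ) :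
    IntegrableOn (path f) (Set.Ioc 0 T) := by
  obtain ⟨g, hg, hb⟩ := hf.bound
  exact _root_.integrableOn_path hf.meas hf.memLp (hg.integrableOn T) hb

theorem inner_path_toLp {f : ℝ → Plane → ℝ} {t : ℝ} (hf : MemLp (f t) 2 (volume : Measure Plane))
    {ζ : Plane → ℝ} (hζ : MemLp ζ 2 (volume : Measure Plane)) :
    inner ℝ (hζ.toLp ζ) (path f t) = ∫ x, f t x * ζ x := by
  rw [inner_L2R]
  refine integral_congr_ae ?_
  filter_upwards [coeFn_path hf, hζ.coeFn_toLp] with x h1 h2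
  rw [h1, h2, mul_comm]

theorem InL1L2.integrableOn_pairing {f : ℝ → Plane → ℝ} (hf : InL1L2 f) {ζ : Plane → ℝ}
    (hζ : MemLp ζ 2 (volume : Measure Plane)) (T : ℝ) :
    IntegrableOn (fun t => ∫ x, f t x * ζ x) (Set.Ioc 0 T) := by
  refine ((hf.integrableOn_path T).const_inner (𝕜 := ℝ) (hζ.toLp ζ)).congr ?_
  filter_upwards [ae_mono (restrict_Ioc_le_timeMeasure T) hf.memLp] with t ht
  exact inner_path_toLp ht hζ

theorem InL1L2.integrableOn_mul_pairing {f : ℝ → Plane → ℝ} (hf : InL1L2 f) {ζ : Plane → ℝ}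
    (hζ : MemLp ζ 2 (volume : Measure Plane)) {ρ : ℝ → ℝ} (hρ : Continuous ρ)
    (hc : HasCompactSupport ρ) :
    IntegrableOn (fun t => ρ t * ∫ x, f t x * ζ x) (Set.Ioi 0) :=
  integrableOn_Ioi_smul_of_hasCompactSupport (hf.integrableOn_pairing hζ) hρ hc

/-- Pairing a Bochner integral in `L²` with a fixed function. -/
theorem InL1L2.integral_pairing {f : ℝ → Plane → ℝ} (hf : InL1L2 f) {ζ : Plane → ℝ}
    (hζ : MemLp ζ 2 (volume : Measure Plane)) {ρ : ℝ → ℝ} (hρ : Continuous ρ)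
    (hc : HasCompactSupport ρ) :
    ∫ x, (∫ t in Set.Ioi 0, ρ t • path f t : L2R) x * ζ x
      = ∫ t in Set.Ioi 0, ρ t * ∫ x, f t x * ζ x := by
  have h := integral_inner (𝕜 := ℝ) (integrableOn_Ioi_smul_of_hasCompactSupport
    hf.integrableOn_path hρ hc) (hζ.toLp ζ)
  have e : ∫ x, (∫ t in Set.Ioi 0, ρ t • path f t : L2R) x * ζ x
      = inner ℝ (hζ.toLp ζ) (∫ t in Set.Ioi 0, ρ t • path f t) := by
    rw [inner_L2R]
    refine integral_congr_ae ?_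
    filter_upwards [hζ.coeFn_toLp] with x h2
    rw [h2, mul_comm]
  rw [e, ← h]
  refine integral_congr_ae ?_
  filter_upwards [(hf.memLp : ∀ᵐ t ∂volume.restrict (Set.Ioi (0 : ℝ)), _)] with t ht
  rw [inner_smul_right, inner_path_toLp ht hζ]

/-- Functions in `L²` are determined by their integrals against test functions. -/
theorem L2R_ext_test {f g : L2R} (h : ∀ η : Plane → ℝ, ContDiff ℝ ∞ η → HasCompactSupport η →
    ∫ x, f x * η x = ∫ x, g x * η x) : f = g := by
  rw [← sub_eq_zero]
  refine (Lp.eq_zero_iff_ae_eq_zero).2 ?_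
  refine ae_eq_zero_of_integral_contDiff_smul_eq_zero (locallyIntegrable_L2 _) fun η hη hc => ?_
  have e : ∫ x, η x • (f - g) x = (∫ x, f x * η x) - ∫ x, g x * η x := by
    rw [← integral_sub (integrable_mul_test (locallyIntegrable_L2 f) hη.continuous hc)
      (integrable_mul_test (locallyIntegrable_L2 g) hη.continuous hc)]
    refine integral_congr_ae ?_
    filter_upwards [Lp.coeFn_sub f g] with x hx
    rw [hx, Pi.sub_apply, smul_eq_mul]; ring
  rw [e, h η hη hc, sub_self]

/-- A scalar evolution equation in the sense of distributions, as an identity for paths in `L²`. -/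
theorem path_eq_primitive {f g : ℝ → Plane → ℝ} (hf : InL1L2 f) (hg : InL1L2 g)
    (h : ∀ η : Plane → ℝ, ContDiff ℝ ∞ η → HasCompactSupport η →
      ∀ θ : ℝ → ℝ, ContDiff ℝ ∞ θ → HasCompactSupport θ →
      ∫ t in Set.Ioi 0, deriv θ t * ∫ x, f t x * η x
        = -∫ t in Set.Ioi 0, θ t * ∫ x, g t x * η x) :
    ∀ᵐ t ∂timeMeasure, path f t = ∫ s in Set.Ioc 0 t, path g s := by
  refine ae_eq_primitive_of_forall_test hf.integrableOn_path hg.integrableOn_path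
    fun θ hθ hc => L2R_ext_test fun η hη hcη => ?_
  have h2 : MemLp η 2 (volume : Measure Plane) := hη.continuous.memLp_of_hasCompactSupport hcη
  rw [hf.integral_pairing h2 (hθ.continuous_deriv (by simp)) hc.deriv, h η hη hcη θ hθ hc,
    ← hg.integral_pairing h2 hθ.continuous hc, ← integral_neg]
  refine integral_congr_ae ?_
  filter_upwards [Lp.coeFn_neg (∫ t in Set.Ioi 0, θ t • path g t)] with x hx
  rw [hx, Pi.neg_apply, neg_mul]

theorem MemH1.zero : MemH1 (fun _ => 0) (fun _ _ => 0) :=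
  ⟨MemLp.zero, fun _ => MemLp.zero, fun _ => ⟨locallyIntegrable_const 0, locallyIntegrable_const 0,
    fun η _ _ => by simp⟩⟩

theorem MemH1.sum {ι : Type*} (s : Finset ι) {f : ι → Plane → ℝ} {Df : ι → Fin 2 → Plane → ℝ}
    (h : ∀ i ∈ s, MemH1 (f i) (Df i)) :
    MemH1 (fun x => ∑ i ∈ s, f i x) (fun k x => ∑ i ∈ s, Df i k x) := by
  classical
  induction s using Finset.induction_on with
  | empty => simpa using MemH1.zero
  | insert i s hi ih =>
    simp only [Finset.sum_insert hi]
    exact (h i (Finset.mem_insert_self i s)).add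
      (ih fun j hj => h j (Finset.mem_insert_of_mem hj))

/-! ### Solutions with their weak derivatives -/

/-- The entries of `pad N A` as linear functions of those of `A`. -/
def padCoef {N : ℕ} (α β : Fin 2) (i j : Fin N) : ℝ :=
  if i.val = α.val ∧ j.val = β.val then 1 else 0

theorem pad_apply_eq_sum {N : ℕ} (A : Mat 2) (i j : Fin N) :
    pad N A i j = ∑ α, ∑ β, padCoef α β i j * A α β := by
  unfold pad padCoef
  split_ifs with h
  · rw [Finset.sum_eq_single ⟨i.val, h.1⟩, Finset.sum_eq_single ⟨j.val, h.2⟩]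
    · simp
    · intro β _ hβ
      rw [if_neg, zero_mul]
      rintro ⟨-, h2⟩
      exact hβ (Fin.ext h2.symm)
    · simp
    · intro α _ hα
      refine Finset.sum_eq_zero fun β _ => ?_
      rw [if_neg, zero_mul]
      rintro ⟨h1, -⟩
      exact hα (Fin.ext h1.symm)
    · simp
  · refine (Finset.sum_eq_zero fun α _ => Finset.sum_eq_zero fun β _ => ?_).symm
    rw [if_neg, zero_mul]
    rintro ⟨h1, h2⟩
    exact h ⟨h1 ▸ α.2, h2 ▸ β.2⟩

/-- A pair `(Q, u)` of the energy class, with its weak derivatives. -/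
structure WeakFlow (N : ℕ) where
  /-- the tensor `Q` -/
  Q : ℝ → Plane → Mat N
  /-- its first derivatives -/
  DQ : Fin 2 → ℝ → Plane → Mat N
  /-- its second derivatives -/
  D2Q : Fin 2 → Fin 2 → ℝ → Plane → Mat N
  /-- the velocity -/
  u : ℝ → Plane → Plane
  /-- the velocity gradient -/
  Du : ℝ → Plane → Mat 2
  hQ : QEnergyClass Q DQ D2Q
  hu : UEnergyClass u Du

namespace WeakFlow

variable {N : ℕ} (S : WeakFlow N)

theorem inEnergy_Q (i j : Fin N) :
    InEnergy (fun t x => S.Q t x i j) (fun k t x => S.DQ k t x i j) :=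
  ⟨S.hQ.bound_zero i j, fun k => (S.hQ.bound_first k i j).inL2Loc, fun k => S.hQ.weak_first k i j⟩

theorem inEnergy_DQ (k : Fin 2) (i j : Fin N) :
    InEnergy (fun t x => S.DQ k t x i j) (fun l t x => S.D2Q k l t x i j) :=
  ⟨S.hQ.bound_first k i j, fun l => S.hQ.bound_second k l i j, fun l => S.hQ.weak_second k l i j⟩

theorem inEnergy_u (α : Fin 2) :
    InEnergy (fun t x => S.u t x α) (fun β t x => S.Du t x α β) :=
  ⟨S.hu.bound_zero α, fun β => S.hu.bound_grad α β, fun β => S.hu.weak_grad α β⟩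

theorem inL2Linfty_Q (i j : Fin N) : InL2Linfty (fun t x => S.Q t x i j) :=
  (S.inEnergy_Q i j).inL2Linfty fun k => S.inEnergy_DQ k i j

/-- `[Ω, Q] = ΩQ - QΩ`. -/
def corot (t : ℝ) (x : Plane) : Mat N :=
  pad N (vorticity S.Du t x) * S.Q t x - S.Q t x * pad N (vorticity S.Du t x)

/-- `u · ∇Q`. -/
def transport (t : ℝ) (x : Plane) : Mat N := ∑ k, S.u t x k • S.DQ k t x

/-- The right-hand side of the `Q`-equation, `∂ₜ Q = force`. -/
def force (a b c Γ L : ℝ) (t : ℝ) (x : Plane) : Mat N :=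
  (Γ * L) • lap S.D2Q t x - S.transport t x + S.corot t x + Γ • bulk a b c (S.Q t x)

theorem inL1L2_lap (i j : Fin N) : InL1L2 (fun t x => lap S.D2Q t x i j) := by
  simp only [lap, Matrix.sum_apply]
  exact InL1L2.sum _ fun k _ => (S.hQ.bound_second k k i j).inL1L2

theorem inL1L2_transport (i j : Fin N) : InL1L2 (fun t x => S.transport t x i j) := by
  simp only [transport, Matrix.sum_apply, Matrix.smul_apply, smul_eq_mul]
  exact InL1L2.sum _ fun k _ => (S.inEnergy_u k).mul (S.inEnergy_DQ k i j)

theorem pad_vorticity_apply (Du : ℝ → Plane → Mat 2) (t : ℝ) (x : Plane) (i j : Fin N) :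
    pad N (vorticity Du t x) i j
      = ∑ α, ∑ β, (1 / 2 * (padCoef α β i j - padCoef β α i j)) * Du t x α β := by
  rw [pad_apply_eq_sum]
  simp only [vorticity, Matrix.smul_apply, Matrix.sub_apply, Matrix.transpose_apply, smul_eq_mul,
    Fin.sum_univ_two]
  ring

theorem inL1L2_mul_vorticity (i j k l : Fin N) :
    InL1L2 (fun t x => S.Q t x i j * pad N (vorticity S.Du t x) k l) := by
  simp only [pad_vorticity_apply, Finset.mul_sum]
  refine InL1L2.sum _ fun α _ => InL1L2.sum _ fun β _ => ?_
  simpa only [mul_left_comm] using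
    ((S.inL2Linfty_Q i j).mul_inL2Loc (S.hu.bound_grad α β)).const_mul
      (1 / 2 * (padCoef α β k l - padCoef β α k l))

theorem inL1L2_corot (i j : Fin N) : InL1L2 (fun t x => S.corot t x i j) := by
  simp only [corot, Matrix.sub_apply, Matrix.mul_apply]
  refine (InL1L2.sum _ fun k _ => ?_).sub (InL1L2.sum _ fun k _ => S.inL1L2_mul_vorticity i k k j)
  simpa only [mul_comm] using S.inL1L2_mul_vorticity k j i k

theorem inL1L2_bulk (a b c : ℝ) (i j : Fin N) : InL1L2 (fun t x => bulk a b c (S.Q t x) i j) := by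
  have h2 : ∀ i j k l, InL1L2 (fun t x => S.Q t x i j * S.Q t x k l) := fun i j k l =>
    (S.inEnergy_Q i j).mul (S.inEnergy_Q k l)
  have h3 : ∀ i j k l m n, InL1L2 (fun t x => S.Q t x i j * (S.Q t x k l * S.Q t x m n)) := by
    intro i j k l m n
    obtain ⟨K, hK, hlad⟩ := exists_ladyzhenskaya
    have hk := S.inEnergy_Q k l
    have hm := S.inEnergy_Q m n
    refine (S.inL2Linfty_Q i j).mul (h2 k l m n).meas (h2 k l m n).memLp
      (b := fun t => K * (n2 (fun x => S.Q t x k l) * ∑ q, n2 (fun x => S.DQ q t x k l))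
        + K * (n2 (fun x => S.Q t x m n) * ∑ q, n2 (fun x => S.DQ q t x m n)))
      ((hk.timeLp_mul.const_mul K).add (hm.timeLp_mul.const_mul K)) ?_
    filter_upwards [hk.ae_memH1, hm.ae_memH1] with t h1 h2
    refine (n2_mul_le h1.memLp_four h2.memLp_four).trans ?_
    have a1 := (hlad _ _ h1).2
    have a2 := (hlad _ _ h2).2
    nlinarith [sq_nonneg (n4 (fun x => S.Q t x k l) - n4 (fun x => S.Q t x m n)),
      sq_nonneg (n4 (fun x => S.Q t x k l)), sq_nonneg (n4 (fun x => S.Q t x m n))]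
  have h2s : ∀ i j, InL1L2 (fun t x => (S.Q t x * S.Q t x) i j) := by
    intro i j
    simp only [Matrix.mul_apply]
    exact InL1L2.sum _ fun k _ => h2 i k k j
  have htr : InL1L2 (fun t x => (S.Q t x * S.Q t x).trace) := by
    simp only [Matrix.trace, Matrix.diag_apply]
    exact InL1L2.sum _ fun k _ => h2s k k
  have htr3 : InL1L2 (fun t x => (S.Q t x * S.Q t x).trace * S.Q t x i j) := by
    simp only [Matrix.trace, Matrix.diag_apply, Matrix.mul_apply, Finset.sum_mul]
    refine InL1L2.sum _ fun k _ => InL1L2.sum _ fun l _ => ?_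
    simpa only [mul_comm] using h3 i j k l l k
  have hQ1 : InL1L2 (fun t x => S.Q t x i j) := (S.hQ.bound_zero i j).inL2Loc.inL1L2
  have e : (fun t x => bulk a b c (S.Q t x) i j) = fun t x => -(a * S.Q t x i j)
      + b * ((S.Q t x * S.Q t x) i j - (1 : Mat N) i j / 2 * (S.Q t x * S.Q t x).trace)
      - c * ((S.Q t x * S.Q t x).trace * S.Q t x i j) := by
    funext t x
    simp only [bulk, Matrix.sub_apply, Matrix.add_apply, Matrix.neg_apply, Matrix.smul_apply,
      smul_eq_mul]
    ring
  rw [e]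
  exact ((hQ1.const_mul a).neg.add (((h2s i j).sub (htr.const_mul _)).const_mul b)).sub
    (htr3.const_mul c)

theorem inL1L2_force (a b c Γ L : ℝ) (i j : Fin N) :
    InL1L2 (fun t x => S.force a b c Γ L t x i j) := by
  simp only [force, Matrix.add_apply, Matrix.sub_apply, Matrix.smul_apply, smul_eq_mul]
  exact ((((S.inL1L2_lap i j).const_mul _).sub (S.inL1L2_transport i j)).add
    (S.inL1L2_corot i j)).add ((S.inL1L2_bulk a b c i j).const_mul Γ)

end WeakFlow

/-! ### The equation for the tensor and its energy identity in `L²` -/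

/-- Transport by a solenoidal field is antisymmetric. -/
theorem integral_transport_add_eq_zero {u : Fin 2 → Plane → ℝ} {Du : Fin 2 → Fin 2 → Plane → ℝ}
    (hu : ∀ k, MemH1 (u k) (Du k)) (hdiv : ∀ᵐ x, ∑ k, Du k k x = 0) {f g : Plane → ℝ}
    {Df Dg : Fin 2 → Plane → ℝ} (hf : MemH1 f Df) (hg : MemH1 g Dg) :
    ∫ x, ∑ k, (Df k x * u k x * g x + Dg k x * f x * u k x) = 0 := by
  have i1 : ∀ k, Integrable (fun x => Df k x * u k x * g x) volume := fun k =>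
    integrable_mul_mul (hf.memLp_grad k) (hu k).memLp_four hg.memLp_four
  have i2 : ∀ k, Integrable (fun x => Dg k x * f x * u k x) volume := fun k =>
    integrable_mul_mul (hg.memLp_grad k) hf.memLp_four (hu k).memLp_four
  have i3 : ∀ k, Integrable (fun x => Du k k x * f x * g x) volume := fun k =>
    integrable_mul_mul ((hu k).memLp_grad k) hf.memLp_four hg.memLp_four
  rw [integral_finsetSum _ fun k _ => (i1 k).fun_add (i2 k)]
  have e : ∀ k, ∫ x, (Df k x * u k x * g x + Dg k x * f x * u k x)
      = -∫ x, Du k k x * f x * g x := by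
    intro k
    rw [integral_add (i1 k) (i2 k), hf.integral_mul_mul_eq_neg (hu k) hg k]
    ring
  simp only [e]
  rw [Finset.sum_neg_distrib, ← integral_finsetSum _ fun k _ => i3 k, neg_eq_zero]
  refine integral_eq_zero_of_ae ?_
  filter_upwards [hdiv] with x hx
  simp only [← Finset.sum_mul, hx, zero_mul, Pi.zero_apply]

theorem inL1L2_trace_mul {N : ℕ} {F : ℝ → Plane → Mat N}
    (hF : ∀ i j, InL1L2 (fun t x => F t x i j)) (M : Mat N) :
    InL1L2 (fun t x => (F t x * M).trace) := by
  simp only [Matrix.trace, Matrix.diag_apply, Matrix.mul_apply]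
  refine InL1L2.sum _ fun i _ => InL1L2.sum _ fun j _ => ?_
  simpa only [mul_comm] using (hF i j).const_mul (M j i)

theorem memH1_trace_mul {N : ℕ} {Q : Plane → Mat N} {DQ : Fin 2 → Plane → Mat N}
    (h : ∀ i j, MemH1 (fun x => Q x i j) (fun k x => DQ k x i j)) (M : Mat N) :
    MemH1 (fun x => (Q x * M).trace) (fun k x => (DQ k x * M).trace) := by
  simp only [Matrix.trace, Matrix.diag_apply, Matrix.mul_apply]
  refine MemH1.sum _ fun i _ => MemH1.sum _ fun j _ => ?_
  simpa only [mul_comm] using (h i j).const_mul (M j i)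

theorem hasCompactSupport_mul_prod {θ : ℝ → ℝ} {η : Plane → ℝ} (hc : HasCompactSupport θ)
    (hcη : HasCompactSupport η) : HasCompactSupport (fun z : ℝ × Plane => θ z.1 * η z.2) := by
  refine HasCompactSupport.intro (hc.isCompact.prod hcη.isCompact) fun z hz => ?_
  by_contra h
  exact hz ⟨subset_tsupport _ (left_ne_zero_of_mul h), subset_tsupport _ (right_ne_zero_of_mul h)⟩

theorem contDiff_mul_prod {θ : ℝ → ℝ} {η : Plane → ℝ} (hθ : ContDiff ℝ ∞ θ)
    (hη : ContDiff ℝ ∞ η) : ContDiff ℝ ∞ (fun z : ℝ × Plane => θ z.1 * η z.2) :=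
  (hθ.comp contDiff_fst).mul (hη.comp contDiff_snd)

theorem isQTest_mul {N : ℕ} {M : Mat N} (hM : IsQTensor M) {θ : ℝ → ℝ} {η : Plane → ℝ}
    (hθ : ContDiff ℝ ∞ θ) (hcθ : HasCompactSupport θ) (hη : ContDiff ℝ ∞ η)
    (hcη : HasCompactSupport η) : IsQTest (fun t x => (θ t * η x) • M) := by
  refine ⟨fun i j => ?_, fun i j => ?_, fun t x => ⟨?_, ?_⟩⟩
  · simp only [Matrix.smul_apply, smul_eq_mul]
    exact (contDiff_mul_prod hθ hη).mul contDiff_const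
  · simp only [Matrix.smul_apply, smul_eq_mul]
    exact (hasCompactSupport_mul_prod hcθ hcη).mul_right
  · exact hM.1.smul _
  · rw [Matrix.trace_smul, hM.2, smul_zero]

theorem pd_const_mul_mul (c d : ℝ) {η : Plane → ℝ} (hη : Differentiable ℝ η) (k : Fin 2)
    (x : Plane) : pd k (fun y => c * η y * d) x = c * pd k η x * d := by
  have e : (fun y => c * η y * d) = fun y => (c * d) * η y := by funext y; ring
  simp only [pd]
  rw [e, fderiv_const_mul (hη x)]
  simp only [_root_.smul_apply, smul_eq_mul]
  ring

namespace WeakFlow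

variable {N : ℕ} (S : WeakFlow N)

theorem ae_memH1_Q : ∀ᵐ t ∂timeMeasure, ∀ i j,
    MemH1 (fun x => S.Q t x i j) (fun k x => S.DQ k t x i j) :=
  ae_all_iff.2 fun i => ae_all_iff.2 fun j => (S.inEnergy_Q i j).ae_memH1

theorem ae_memH1_DQ : ∀ᵐ t ∂timeMeasure, ∀ k i j,
    MemH1 (fun x => S.DQ k t x i j) (fun l x => S.D2Q k l t x i j) :=
  ae_all_iff.2 fun k => ae_all_iff.2 fun i => ae_all_iff.2 fun j => (S.inEnergy_DQ k i j).ae_memH1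

theorem ae_memH1_u : ∀ᵐ t ∂timeMeasure, ∀ α,
    MemH1 (fun x => S.u t x α) (fun β x => S.Du t x α β) :=
  ae_all_iff.2 fun α => (S.inEnergy_u α).ae_memH1

theorem ae_div : ∀ᵐ t ∂timeMeasure, ∀ᵐ x, ∑ k, S.Du t x k k = 0 := S.hu.div_free

/-- The `Q`-equation, tested with the product of a function of time, a function of space and a
constant `Q`-tensor. -/
theorem weak_Q {a b c Γ L : ℝ} {Qbar : Plane → Mat N}
    (hE : QEquation a b c Γ L Qbar S.Q S.D2Q S.u S.Du) {M : Mat N} (hM : IsQTensor M)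
    {η : Plane → ℝ} (hη : ContDiff ℝ ∞ η) (hcη : HasCompactSupport η) {θ : ℝ → ℝ}
    (hθ : ContDiff ℝ ∞ θ) (hcθ : HasCompactSupport θ) :
    (∫ t in Set.Ioi 0, deriv θ t * ∫ x, (S.Q t x * M).trace * η x)
      + (∫ t in Set.Ioi 0, θ t * ∫ x, (S.force a b c Γ L t x * M).trace * η x)
      = -∫ x, (Qbar x * (θ 0 * η x) • M).trace := by
  have h2 : MemLp η 2 (volume : Measure Plane) := hη.continuous.memLp_of_hasCompactSupport hcη
  have hηH := memH1_of_contDiff hη hcη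
  have hqM := inL1L2_trace_mul (fun i j => (S.inEnergy_Q i j).bound.inL2Loc.inL1L2) M
  have hbM := inL1L2_trace_mul (S.inL1L2_bulk a b c) M
  have hg1 : InL1L2 fun t x => ((S.force a b c Γ L t x - Γ • bulk a b c (S.Q t x)) * M).trace :=
    inL1L2_trace_mul (fun i j => by
      simpa only [Matrix.sub_apply, Matrix.smul_apply, smul_eq_mul] using
        (S.inL1L2_force a b c Γ L i j).sub ((S.inL1L2_bulk a b c i j).const_mul Γ)) M
  have hd : Continuous (deriv θ) := hθ.continuous_deriv (by simp)
  have key : ∀ᵐ t ∂volume.restrict (Set.Ioi (0 : ℝ)), ∫ x : Plane,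
        (-(S.Q t x * matDt (fun t x => (θ t * η x) • M) t x).trace
          - Γ * L * (lap S.D2Q t x * (θ t * η x) • M).trace
          - ∑ k, S.u t x k * (S.Q t x * matDx k (fun t x => (θ t * η x) • M) t x).trace
          - (pad N (vorticity S.Du t x) * S.Q t x * (θ t * η x) • M).trace
          + (S.Q t x * pad N (vorticity S.Du t x) * (θ t * η x) • M).trace)
      = -(deriv θ t * ∫ x, (S.Q t x * M).trace * η x)
        - θ t * ∫ x, ((S.force a b c Γ L t x - Γ • bulk a b c (S.Q t x)) * M).trace * η x := by
    filter_upwards [hqM.memLp, hg1.memLp, S.ae_memH1_Q, S.ae_memH1_u, S.ae_div]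
      with t m1 m2 m3 m4 m5
    have hT := integral_transport_add_eq_zero m4 m5 hηH (memH1_trace_mul m3 M)
    have e1 : ∀ x, matDt (fun t x => (θ t * η x) • M) t x = (deriv θ t * η x) • M := by
      intro x
      ext i j
      simp only [matDt, Matrix.smul_apply, smul_eq_mul]
      rw [deriv_mul_const_field, deriv_mul_const_field]
    have e2 : ∀ k x, matDx k (fun t x => (θ t * η x) • M) t x = (θ t * pd k η x) • M := by
      intro k x
      ext i j
      simp only [matDx, Matrix.smul_apply, smul_eq_mul]
      exact pd_const_mul_mul _ _ (hη.differentiable (by simp)) k x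
    have hi : Integrable (fun x => ∑ k, (pd k η x * S.u t x k * (S.Q t x * M).trace
        + (S.DQ k t x * M).trace * η x * S.u t x k)) volume :=
      integrable_finsetSum _ fun k _ =>
        (integrable_mul_mul (hηH.memLp_grad k) (m4 k).memLp_four
          (memH1_trace_mul m3 M).memLp_four).add
        (integrable_mul_mul ((memH1_trace_mul m3 M).memLp_grad k) hηH.memLp_four
          (m4 k).memLp_four)
    have i1 := (integrable_mul_two m1 h2).const_mul (deriv θ t)
    have i2 := (integrable_mul_two m2 h2).const_mul (θ t)
    rw [← integral_const_mul, ← integral_const_mul, ← integral_neg, ← integral_sub i1.fun_neg i2]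
    have e3 : ∫ x, θ t * ∑ k, (pd k η x * S.u t x k * (S.Q t x * M).trace
        + (S.DQ k t x * M).trace * η x * S.u t x k) = 0 := by
      rw [integral_const_mul, hT, mul_zero]
    rw [← sub_zero (∫ x, _ - _), ← e3, ← integral_sub (i1.fun_neg.sub' i2) (hi.const_mul _)]
    refine integral_congr_ae (.of_forall fun x => ?_)
    simp only [e1, e2, Matrix.mul_smul, Matrix.trace_smul, smul_eq_mul, force, transport, corot,
      Matrix.sub_mul, Matrix.add_mul, Matrix.smul_mul, Matrix.trace_sub, Matrix.trace_add,
      Fin.sum_univ_two]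
    ring
  have h := hE _ (isQTest_mul hM hθ hcθ hη hcη)
  rw [integral_congr_ae key] at h
  have j1 := hqM.integrableOn_mul_pairing h2 hd hcθ.deriv
  have j2 := hg1.integrableOn_mul_pairing h2 hθ.continuous hcθ
  have j3 := hbM.integrableOn_mul_pairing h2 hθ.continuous hcθ
  rw [integral_sub j1.fun_neg j2, integral_neg] at h
  have e4 : ∀ t, ∫ x, (bulk a b c (S.Q t x) * (θ t * η x) • M).trace
      = θ t * ∫ x, (bulk a b c (S.Q t x) * M).trace * η x := by
    intro t
    rw [← integral_const_mul]
    refine integral_congr_ae (.of_forall fun x => ?_)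
    simp only [Matrix.mul_smul, Matrix.trace_smul, smul_eq_mul]
    ring
  simp only [e4] at h
  have e5 : ∫ t in Set.Ioi 0, θ t * ∫ x, (S.force a b c Γ L t x * M).trace * η x
      = (∫ t in Set.Ioi 0, θ t *
          ∫ x, ((S.force a b c Γ L t x - Γ • bulk a b c (S.Q t x)) * M).trace * η x)
        + Γ * ∫ t in Set.Ioi 0, θ t * ∫ x, (bulk a b c (S.Q t x) * M).trace * η x := by
    rw [← integral_const_mul, ← integral_add j2 (j3.const_mul Γ)]
    refine integral_congr_ae ?_
    have t1 : ∀ᵐ t ∂volume.restrict (Set.Ioi (0 : ℝ)), _ := hg1.memLp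
    have t2 : ∀ᵐ t ∂volume.restrict (Set.Ioi (0 : ℝ)), _ := hbM.memLp
    filter_upwards [t1, t2] with t m1 m2
    have e6 : ∫ x, (S.force a b c Γ L t x * M).trace * η x
        = (∫ x, ((S.force a b c Γ L t x - Γ • bulk a b c (S.Q t x)) * M).trace * η x)
          + Γ * ∫ x, (bulk a b c (S.Q t x) * M).trace * η x := by
      rw [← integral_const_mul, ← integral_add (integrable_mul_two m1 h2)
        ((integrable_mul_two m2 h2).const_mul Γ)]
      refine integral_congr_ae (.of_forall fun x => ?_)
      simp only [Matrix.sub_mul, Matrix.smul_mul, Matrix.trace_sub, Matrix.trace_smul, smul_eq_mul]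
      ring
    rw [e6]; ring
  rw [e5]
  linarith

end WeakFlow

theorem integral_congr_ae_Ioc {H : Type*} [NormedAddCommGroup H] [NormedSpace ℝ H]
    {f g : ℝ → H} (h : ∀ᵐ t ∂timeMeasure, f t = g t) (t : ℝ) :
    ∫ s in Set.Ioc 0 t, f s = ∫ s in Set.Ioc 0 t, g s :=
  integral_congr_ae (ae_mono (restrict_Ioc_le_timeMeasure t) h)

/-- The energy identity for a path in a real Hilbert space that is a primitive. -/
theorem norm_sq_of_ae_eq_primitive {H : Type*} [NormedAddCommGroup H] [InnerProductSpace ℝ H]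
    [CompleteSpace H] {X Y : ℝ → H} (hY : ∀ T, IntegrableOn Y (Set.Ioc 0 T))
    (h : ∀ᵐ t ∂timeMeasure, X t = ∫ s in Set.Ioc 0 t, Y s) :
    (∀ T, IntegrableOn (fun t => (inner ℝ (X t) (Y t) : ℝ)) (Set.Ioc 0 T)) ∧
      ∀ᵐ t ∂timeMeasure, ‖X t‖ ^ 2 = 2 * ∫ s in Set.Ioc 0 t, (inner ℝ (X s) (Y s) : ℝ) := by
  have h' : ∀ᵐ t ∂timeMeasure, (inner ℝ (∫ s in Set.Ioc 0 t, Y s) (Y t) : ℝ)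
      = inner ℝ (X t) (Y t) := h.mono fun t ht => by rw [ht]
  refine ⟨fun T => (integrableOn_inner_primitive (hY T)).congr
    (ae_mono (restrict_Ioc_le_timeMeasure T) h'), ?_⟩
  filter_upwards [h] with t ht
  rw [ht, norm_sq_primitive (hY t), integral_congr_ae_Ioc h' t]

theorem inner_path_path {f g : ℝ → Plane → ℝ} {t : ℝ} (hf : MemLp (f t) 2 (volume : Measure Plane))
    (hg : MemLp (g t) 2 (volume : Measure Plane)) :
    inner ℝ (path f t) (path g t) = ∫ x, f t x * g t x := by
  rw [inner_L2R]
  refine integral_congr_ae ?_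
  filter_upwards [coeFn_path hf, coeFn_path hg] with x h1 h2
  rw [h1, h2]

/-- The orthogonal projection of the matrix unit `E_ij` on the `Q`-tensors. -/
def unitQTensor {N : ℕ} (i j : Fin N) : Mat N :=
  (1 / 2 : ℝ) • (Matrix.single i j 1 + Matrix.single j i 1)
    - ((if i = j then 1 else 0) / (N : ℝ)) • (1 : Mat N)

theorem isQTensor_unitQTensor {N : ℕ} (i j : Fin N) : IsQTensor (unitQTensor i j) := by
  have hN : (N : ℝ) ≠ 0 := by
    have := i.pos
    positivity
  constructor
  · simp only [Matrix.IsSymm, unitQTensor, Matrix.transpose_sub, Matrix.transpose_smul,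
      Matrix.transpose_add, Matrix.transpose_single, Matrix.transpose_one]
    rw [add_comm]
  · rw [unitQTensor, Matrix.trace_sub, Matrix.trace_smul, Matrix.trace_smul, Matrix.trace_add,
      Matrix.trace_one, Fintype.card_fin]
    by_cases h : i = j
    · subst h
      simp [hN]; norm_num
    · rw [Matrix.trace_single_eq_of_ne _ _ _ h, Matrix.trace_single_eq_of_ne _ _ _ (Ne.symm h)]
      simp [h]

theorem trace_mul_unitQTensor {N : ℕ} (A : Mat N) (i j : Fin N) :
    (A * unitQTensor i j).trace
      = 1 / 2 * (A j i + A i j) - (if i = j then 1 else 0) / (N : ℝ) * A.trace := by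
  rw [unitQTensor, Matrix.mul_sub, Matrix.trace_sub, Matrix.mul_smul, Matrix.mul_smul,
    Matrix.trace_smul, Matrix.trace_smul, Matrix.mul_one, Matrix.mul_add, Matrix.trace_add,
    Matrix.trace_mul_single, Matrix.trace_mul_single]
  simp

/-- The scalar product of matrices. -/
def frob {N : ℕ} (A B : Mat N) : ℝ := ∑ i, ∑ j, A i j * B i j

/-- Testing with `unitQTensor i j` extracts an entry of a `Q`-tensor. -/
theorem trace_mul_unitQTensor_of_isQTensor {N : ℕ} {A : Mat N} (hA : IsQTensor A) (i j : Fin N) :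
    (A * unitQTensor i j).trace = A i j := by
  rw [trace_mul_unitQTensor, hA.2, hA.1.apply]
  ring

/-- `Q`-tensors only see the projection of a matrix on the `Q`-tensors. -/
theorem sum_trace_mul_unitQTensor {N : ℕ} {A : Mat N} (hA : IsQTensor A) (B : Mat N) :
    ∑ i, ∑ j, (A * unitQTensor i j).trace * (B * unitQTensor i j).trace = frob B A := by
  simp only [trace_mul_unitQTensor_of_isQTensor hA, trace_mul_unitQTensor B]
  have e : ∀ i j, A i j * (1 / 2 * (B j i + B i j) - (if i = j then 1 else 0) / (N : ℝ) * B.trace)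
      = 1 / 2 * (B j i * A j i) + 1 / 2 * (B i j * A i j)
        - (if i = j then A i j else 0) * (B.trace / N) := by
    intro i j
    rw [← hA.1.apply i j]
    split_ifs <;> ring
  simp only [e, Finset.sum_sub_distrib, Finset.sum_add_distrib, ← Finset.mul_sum, ← Finset.sum_mul]
  have t : ∑ i, ∑ j, (if i = j then A i j else 0) = 0 := by
    simpa [Matrix.trace] using hA.2
  rw [t, Finset.sum_comm (f := fun i j => B j i * A j i), frob]
  ring

namespace WeakFlow

variable {N : ℕ} (S₁ S₂ : WeakFlow N)

theorem isQTensor_sub {A B : Mat N} (hA : IsQTensor A) (hB : IsQTensor B) : IsQTensor (A - B) :=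
  ⟨hA.1.sub hB.1, by rw [Matrix.trace_sub, hA.2, hB.2, sub_zero]⟩

/-- The energy identity for the difference of the tensors of two solutions with the same data. -/
theorem energy_identity_Q {a b c Γ L : ℝ} {Qbar : Plane → Mat N}
    (h₁ : QEquation a b c Γ L Qbar S₁.Q S₁.D2Q S₁.u S₁.Du)
    (h₂ : QEquation a b c Γ L Qbar S₂.Q S₂.D2Q S₂.u S₂.Du) :
    (∀ T, IntegrableOn (fun t => ∫ x, frob (S₁.force a b c Γ L t x - S₂.force a b c Γ L t x)
      (S₁.Q t x - S₂.Q t x)) (Set.Ioc 0 T)) ∧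
    ∀ᵐ t ∂timeMeasure, ∑ i, ∑ j, n2 (fun x => S₁.Q t x i j - S₂.Q t x i j) ^ 2
      = 2 * ∫ s in Set.Ioc 0 t, ∫ x, frob (S₁.force a b c Γ L s x - S₂.force a b c Γ L s x)
          (S₁.Q s x - S₂.Q s x) := by
  have hR : ∀ i j, InL1L2 fun t x => (S₁.Q t x - S₂.Q t x) i j := fun i j =>
    (S₁.inEnergy_Q i j).bound.inL2Loc.inL1L2.sub (S₂.inEnergy_Q i j).bound.inL2Loc.inL1L2
  have hG : ∀ i j, InL1L2 fun t x => (S₁.force a b c Γ L t x - S₂.force a b c Γ L t x) i j :=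
    fun i j => (S₁.inL1L2_force a b c Γ L i j).sub (S₂.inL1L2_force a b c Γ L i j)
  let r : Fin N → Fin N → ℝ → Plane → ℝ := fun i j t x =>
    ((S₁.Q t x - S₂.Q t x) * unitQTensor i j).trace
  let g : Fin N → Fin N → ℝ → Plane → ℝ := fun i j t x =>
    ((S₁.force a b c Γ L t x - S₂.force a b c Γ L t x) * unitQTensor i j).trace
  have hr : ∀ i j, InL1L2 (r i j) := fun i j => inL1L2_trace_mul hR _
  have hg : ∀ i j, InL1L2 (g i j) := fun i j => inL1L2_trace_mul hG _
  have hev : ∀ i j, ∀ᵐ t ∂timeMeasure, path (r i j) t = ∫ s in Set.Ioc 0 t, path (g i j) s := by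
    intro i j
    refine path_eq_primitive (hr i j) (hg i j) fun η hη hcη θ hθ hcθ => ?_
    have hM := isQTensor_unitQTensor i j
    have e₁ := S₁.weak_Q h₁ hM hη hcη hθ hcθ
    have e₂ := S₂.weak_Q h₂ hM hη hcη hθ hcθ
    have h2 : MemLp η 2 (volume : Measure Plane) := hη.continuous.memLp_of_hasCompactSupport hcη
    have hd : Continuous (deriv θ) := hθ.continuous_deriv (by simp)
    have sub : ∀ {A B : ℝ → Plane → Mat N} {ρ : ℝ → ℝ},
        (∀ i j, InL1L2 fun t x => A t x i j) → (∀ i j, InL1L2 fun t x => B t x i j) →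
        Continuous ρ → HasCompactSupport ρ →
        ∫ t in Set.Ioi 0, ρ t * ∫ x, ((A t x - B t x) * unitQTensor i j).trace * η x
          = (∫ t in Set.Ioi 0, ρ t * ∫ x, (A t x * unitQTensor i j).trace * η x)
            - ∫ t in Set.Ioi 0, ρ t * ∫ x, (B t x * unitQTensor i j).trace * η x := by
      intro A B ρ hA hB hρ hcρ
      have hA' := inL1L2_trace_mul hA (unitQTensor i j)
      have hB' := inL1L2_trace_mul hB (unitQTensor i j)
      rw [← integral_sub (hA'.integrableOn_mul_pairing h2 hρ hcρ)
        (hB'.integrableOn_mul_pairing h2 hρ hcρ)]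
      refine integral_congr_ae ?_
      have t1 : ∀ᵐ t ∂volume.restrict (Set.Ioi (0 : ℝ)), _ := hA'.memLp
      have t2 : ∀ᵐ t ∂volume.restrict (Set.Ioi (0 : ℝ)), _ := hB'.memLp
      filter_upwards [t1, t2] with t m1 m2
      rw [← mul_sub, ← integral_sub (integrable_mul_two m1 h2) (integrable_mul_two m2 h2)]
      simp only [Matrix.trace_sub, sub_mul]
    have hQ : ∀ S : WeakFlow N, ∀ i j, InL1L2 fun t x => S.Q t x i j := fun S i j =>
      (S.inEnergy_Q i j).bound.inL2Loc.inL1L2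
    rw [sub (hQ S₁) (hQ S₂) hd hcθ.deriv,
      sub (S₁.inL1L2_force a b c Γ L) (S₂.inL1L2_force a b c Γ L) hθ.continuous hcθ]
    linarith
  have hen := fun i j => norm_sq_of_ae_eq_primitive (hg i j).integrableOn_path (hev i j)
  have hall : ∀ᵐ t ∂timeMeasure, (∀ i j, MemLp (r i j t) 2 (volume : Measure Plane)) ∧
      (∀ i j, MemLp (g i j t) 2 (volume : Measure Plane)) ∧
      ∀ᵐ x, IsQTensor (S₁.Q t x - S₂.Q t x) := by
    filter_upwards [ae_all_iff.2 fun i => ae_all_iff.2 fun j => (hr i j).memLp,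
      ae_all_iff.2 fun i => ae_all_iff.2 fun j => (hg i j).memLp, S₁.hQ.qtensor, S₂.hQ.qtensor]
      with t m1 m2 q1 q2
    refine ⟨m1, m2, ?_⟩
    filter_upwards [q1, q2] with x h1 h2 using isQTensor_sub h1 h2
  have hsum : ∀ᵐ t ∂timeMeasure,
      ∑ i, ∑ j, (inner ℝ (path (r i j) t) (path (g i j) t) : ℝ)
        = ∫ x, frob (S₁.force a b c Γ L t x - S₂.force a b c Γ L t x) (S₁.Q t x - S₂.Q t x) := by
    filter_upwards [hall] with t ⟨m1, m2, q⟩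
    simp only [inner_path_path (m1 _ _) (m2 _ _)]
    have e : ∀ i, ∑ j, ∫ x, r i j t x * g i j t x = ∫ x, ∑ j, r i j t x * g i j t x := fun i =>
      (integral_finsetSum _ fun j _ => integrable_mul_two (m1 i j) (m2 i j)).symm
    rw [Finset.sum_congr rfl fun i _ => e i, ← integral_finsetSum _ fun i _ =>
      integrable_finsetSum _ fun j _ => integrable_mul_two (m1 i j) (m2 i j)]
    refine integral_congr_ae ?_
    filter_upwards [q] with x hx
    exact sum_trace_mul_unitQTensor hx _
  have hint : ∀ T, IntegrableOn (fun t => ∑ i, ∑ j,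
      (inner ℝ (path (r i j) t) (path (g i j) t) : ℝ)) (Set.Ioc 0 T) := fun T =>
    integrable_finsetSum _ fun i _ => integrable_finsetSum _ fun j _ => (hen i j).1 T
  refine ⟨fun T => (hint T).congr (ae_mono (restrict_Ioc_le_timeMeasure T) hsum), ?_⟩
  filter_upwards [hall, ae_all_iff.2 fun i => ae_all_iff.2 fun j => (hen i j).2]
    with t ⟨m1, m2, q⟩ he
  rw [← integral_congr_ae_Ioc hsum t, integral_finsetSum _ fun i _ =>
    integrable_finsetSum _ fun j _ => (hen i j).1 t]
  simp only [integral_finsetSum _ fun j _ => (hen _ j).1 t]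
  rw [Finset.mul_sum]
  refine Finset.sum_congr rfl fun i _ => ?_
  rw [Finset.mul_sum]
  refine Finset.sum_congr rfl fun j _ => ?_
  rw [← he i j, norm_path (m1 i j)]
  congr 1
  unfold n2
  congr 1
  refine eLpNorm_congr_ae ?_
  filter_upwards [q] with x hx
  exact (trace_mul_unitQTensor_of_isQTensor hx i j).symm

end WeakFlow

/-! ### The equation for the velocity and its energy identity in `H⁻¹` -/

theorem real_inner_L2C (f g : L2C) : (inner ℝ f g : ℝ) = (inner ℂ f g : ℂ).re := by
  rw [L2.inner_def, L2.inner_def, ← RCLike.re_to_complex, ← integral_re (L2.integrable_inner f g)]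
  rfl

theorem pd_comm {η : Plane → ℝ} (hη : ContDiff ℝ ∞ η) (k l : Fin 2) (x : Plane) :
    pd k (pd l η) x = pd l (pd k η) x := by
  have hs := (hη.contDiffAt (x := x)).isSymmSndFDerivAt (by
    rw [minSmoothness_of_isRCLikeNormedField]; exact WithTop.coe_le_coe.2 (le_top : (2 : ℕ∞) ≤ ⊤))
  have hd : DifferentiableAt ℝ (fderiv ℝ η) x :=
    (hη.fderiv_right (m := 1)
      (WithTop.coe_le_coe.2 (le_top : (1 + 1 : ℕ∞) ≤ ⊤))).differentiable (by simp) x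
  have e : ∀ k l, pd k (pd l η) x = fderiv ℝ (fderiv ℝ η) x (EuclideanSpace.single k 1)
      (EuclideanSpace.single l 1) := by
    intro k l
    unfold pd
    rw [fderiv_clm_apply hd (by fun_prop)]
    simp
  rw [e, e]
  exact hs _ _

theorem pd_neg (k : Fin 2) (η : Plane → ℝ) (x : Plane) :
    pd k (fun y => -η y) x = -pd k η x := by
  simp only [pd]
  rw [fderiv_fun_neg]
  simp

theorem isUTest_mul {p : Fin 2 → Plane → ℝ} (hp : ∀ α, ContDiff ℝ ∞ (p α))
    (hcp : ∀ α, HasCompactSupport (p α)) (hdiv : ∀ x, ∑ k, pd k (p k) x = 0) {θ : ℝ → ℝ}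
    (hθ : ContDiff ℝ ∞ θ) (hcθ : HasCompactSupport θ) :
    IsUTest (fun t x => WithLp.toLp 2 fun α => θ t * p α x) := by
  refine ⟨fun α => contDiff_mul_prod hθ (hp α), fun α => hasCompactSupport_mul_prod hcθ (hcp α),
    fun t x => ?_⟩
  have e : ∀ k, pd k (fun y => θ t * p k y) x = θ t * pd k (p k) x := by
    intro k
    simp only [pd]
    rw [fderiv_const_mul ((hp k).differentiable (by simp) x)]
    simp
  change ∑ k, pd k (fun y => θ t * p k y) x = 0
  simp only [e, ← Finset.mul_sum, hdiv, mul_zero]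

namespace WeakFlow

variable {N : ℕ} (S : WeakFlow N)

/-- `[Q, ΔQ]`. -/
def elastic (t : ℝ) (x : Plane) : Mat N := S.Q t x * lap S.D2Q t x - lap S.D2Q t x * S.Q t x

/-- The flux of momentum: the `u`-equation says that `∂ₜ u_α + ∂_β (stress α β)` is a gradient. -/
def stress (L ν : ℝ) (α β : Fin 2) (t : ℝ) (x : Plane) : ℝ :=
  S.u t x α * S.u t x β - ν * S.Du t x α β
    + L * (∑ i, ∑ j, S.DQ α t x i j * S.DQ β t x i j)
    - L * ∑ i, ∑ j, padCoef α β i j * S.elastic t x i j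

theorem inL1L2_elastic (i j : Fin N) : InL1L2 (fun t x => S.elastic t x i j) := by
  simp only [elastic, Matrix.sub_apply, Matrix.mul_apply, lap, Matrix.sum_apply, Finset.mul_sum,
    Finset.sum_mul]
  refine (InL1L2.sum _ fun k _ => InL1L2.sum _ fun m _ => ?_).sub
    (InL1L2.sum _ fun k _ => InL1L2.sum _ fun m _ => ?_)
  · exact (S.inL2Linfty_Q i m).mul_inL2Loc (S.hQ.bound_second k k m j)
  · simpa only [mul_comm] using (S.inL2Linfty_Q m j).mul_inL2Loc (S.hQ.bound_second k k i m)

theorem inL1L2_convective (ν : ℝ) (α β : Fin 2) :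
    InL1L2 (fun t x => S.u t x α * S.u t x β - ν * S.Du t x α β) :=
  ((S.inEnergy_u α).mul (S.inEnergy_u β)).sub (((S.hu.bound_grad α β).inL1L2).const_mul ν)

theorem inL1L2_elasticStress (α β : Fin 2) :
    InL1L2 (fun t x => (∑ i, ∑ j, S.DQ α t x i j * S.DQ β t x i j)
      - ∑ i, ∑ j, padCoef α β i j * S.elastic t x i j) :=
  (InL1L2.sum _ fun i _ => InL1L2.sum _ fun j _ =>
    (S.inEnergy_DQ α i j).mul (S.inEnergy_DQ β i j)).sub
    (InL1L2.sum _ fun i _ => InL1L2.sum _ fun j _ => (S.inL1L2_elastic i j).const_mul _)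

theorem stress_eq (L ν : ℝ) (α β : Fin 2) (t : ℝ) (x : Plane) :
    S.stress L ν α β t x = (S.u t x α * S.u t x β - ν * S.Du t x α β)
      + L * ((∑ i, ∑ j, S.DQ α t x i j * S.DQ β t x i j)
        - ∑ i, ∑ j, padCoef α β i j * S.elastic t x i j) := by
  rw [stress]; ring

theorem inL1L2_stress (L ν : ℝ) (α β : Fin 2) : InL1L2 (fun t x => S.stress L ν α β t x) := by
  simp only [stress_eq]
  exact (S.inL1L2_convective ν α β).add ((S.inL1L2_elasticStress α β).const_mul L)

/-- The pairing with a padded planar tensor, in terms of the planar entries. -/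
theorem sum_mul_pad (C : Mat N) (A : Mat 2) :
    ∑ i, ∑ j, C i j * pad N A i j
      = ∑ α, ∑ β, (∑ i, ∑ j, padCoef α β i j * C i j) * A α β := by
  simp only [pad_apply_eq_sum, Finset.mul_sum, Finset.sum_mul]
  rw [Finset.sum_congr rfl fun i _ => Finset.sum_comm, Finset.sum_comm]
  refine Finset.sum_congr rfl fun α _ => ?_
  rw [Finset.sum_congr rfl fun i _ => Finset.sum_comm, Finset.sum_comm]
  refine Finset.sum_congr rfl fun β _ => Finset.sum_congr rfl fun i _ =>
    Finset.sum_congr rfl fun j _ => ?_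
  ring

/-- The pairing of a tensor field with the gradient of a vector field, for tensors in `L¹ L²`. -/
theorem integral_sum_mul_pd {F : Fin 2 → Fin 2 → Plane → ℝ} {p : Fin 2 → Plane → ℝ}
    (hF : ∀ α β, MemLp (F α β) 2 (volume : Measure Plane)) (hp : ∀ α, ContDiff ℝ ∞ (p α))
    (hcp : ∀ α, HasCompactSupport (p α)) :
    ∫ x, ∑ α, ∑ β, F α β x * pd β (p α) x = ∑ α, ∑ β, ∫ x, F α β x * pd β (p α) x := by
  have hi : ∀ α β, Integrable (fun x => F α β x * pd β (p α) x) volume := fun α β =>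
    integrable_mul_two (hF α β) ((memH1_of_contDiff (hp α) (hcp α)).memLp_grad β)
  rw [integral_finsetSum _ fun α _ => integrable_finsetSum _ fun β _ => hi α β]
  exact Finset.sum_congr rfl fun α _ => integral_finsetSum _ fun β _ => hi α β

/-- The `u`-equation, tested with the product of a function of time and a solenoidal field. -/
theorem weak_u {L ν : ℝ} {ubar : Plane → Plane}
    (hE : UEquation L ν ubar S.Q S.DQ S.D2Q S.u S.Du) {p : Fin 2 → Plane → ℝ}
    (hp : ∀ α, ContDiff ℝ ∞ (p α)) (hcp : ∀ α, HasCompactSupport (p α))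
    (hdiv : ∀ x, ∑ k, pd k (p k) x = 0) {θ : ℝ → ℝ}
    (hθ : ContDiff ℝ ∞ θ) (hcθ : HasCompactSupport θ) :
    -(∑ α, ∫ t in Set.Ioi 0, deriv θ t * ∫ x, S.u t x α * p α x)
      - ∫ x, ∑ α, ubar x α * (θ 0 * p α x)
      = ∑ α, ∑ β, ∫ t in Set.Ioi 0, θ t * ∫ x, S.stress L ν α β t x * pd β (p α) x := by
  have hpH := fun α => memH1_of_contDiff (hp α) (hcp α)
  have hu := fun α => (S.inEnergy_u α).bound.inL2Loc.inL1L2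
  have hd : Continuous (deriv θ) := hθ.continuous_deriv (by simp)
  have hvg : ∀ t x α β, vecGrad (fun t x => WithLp.toLp 2 fun α => θ t * p α x) t x α β
      = θ t * pd β (p α) x := by
    intro t x α β
    change pd β (fun y => θ t * p α y) x = _
    simp only [pd]
    rw [fderiv_const_mul ((hp α).differentiable (by simp) x)]
    simp
  have key : ∀ᵐ t ∂volume.restrict (Set.Ioi (0 : ℝ)), ∫ x : Plane,
        (-(∑ α, S.u t x α * deriv (fun r => θ r * p α x) t)
          - (∑ α, ∑ β, S.u t x α * S.u t x β *
            vecGrad (fun t x => WithLp.toLp 2 fun α => θ t * p α x) t x β α)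
          + ν * ∑ α, ∑ β, S.Du t x α β *
            vecGrad (fun t x => WithLp.toLp 2 fun α => θ t * p α x) t x α β)
      = -(∑ α, deriv θ t * ∫ x, S.u t x α * p α x)
        - ∑ α, ∑ β, θ t * ∫ x, (S.u t x α * S.u t x β - ν * S.Du t x α β) * pd β (p α) x := by
    filter_upwards [S.ae_memH1_u, ae_all_iff.2 fun α => ae_all_iff.2 fun β =>
      (S.inL1L2_convective ν α β).memLp] with t m1 m2
    have i1 : ∀ α, Integrable (fun x => S.u t x α * p α x) volume := fun α =>
      integrable_mul_two (m1 α).memLp (hpH α).memLp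
    have i2 : ∀ α β, Integrable (fun x => (S.u t x α * S.u t x β - ν * S.Du t x α β) *
        pd β (p α) x) volume := fun α β => integrable_mul_two (m2 α β) ((hpH α).memLp_grad β)
    simp only [← Finset.mul_sum]
    rw [← integral_sum_mul_pd m2 hp hcp, ← integral_finsetSum _ fun α _ => i1 α,
      ← integral_const_mul, ← integral_const_mul, ← integral_neg, ← integral_sub
        ((integrable_finsetSum _ fun α _ => i1 α).const_mul _).fun_neg
        ((integrable_finsetSum _ fun α _ => integrable_finsetSum _ fun β _ => i2 α β).const_mul _)]
    refine integral_congr_ae (.of_forall fun x => ?_)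
    simp only [hvg, deriv_mul_const_field, Fin.sum_univ_two]
    ring
  have key2 : ∀ᵐ t ∂volume.restrict (Set.Ioi (0 : ℝ)), ∫ x : Plane,
        ((∑ α, ∑ β, (∑ i, ∑ j, S.DQ α t x i j * S.DQ β t x i j) *
            vecGrad (fun t x => WithLp.toLp 2 fun α => θ t * p α x) t x α β)
          - (∑ i, ∑ j, (S.Q t x * lap S.D2Q t x) i j *
            pad N (vecGrad (fun t x => WithLp.toLp 2 fun α => θ t * p α x) t x) i j)
          + ∑ i, ∑ j, (lap S.D2Q t x * S.Q t x) i j *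
            pad N (vecGrad (fun t x => WithLp.toLp 2 fun α => θ t * p α x) t x) i j)
      = ∑ α, ∑ β, θ t * ∫ x, ((∑ i, ∑ j, S.DQ α t x i j * S.DQ β t x i j)
        - ∑ i, ∑ j, padCoef α β i j * S.elastic t x i j) * pd β (p α) x := by
    filter_upwards [ae_all_iff.2 fun α => ae_all_iff.2 fun β =>
      (S.inL1L2_elasticStress α β).memLp] with t m2
    simp only [← Finset.mul_sum]
    rw [← integral_sum_mul_pd m2 hp hcp, ← integral_const_mul]
    refine integral_congr_ae (.of_forall fun x => ?_)
    simp only [sum_mul_pad, hvg, elastic, Matrix.sub_apply, mul_sub, Finset.sum_sub_distrib,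
      Fin.sum_univ_two]
    ring
  have h := hE _ (isUTest_mul hp hcp hdiv hθ hcθ)
  rw [integral_congr_ae key, integral_congr_ae key2] at h
  have j1 : ∀ α, IntegrableOn (fun t => deriv θ t * ∫ x, S.u t x α * p α x) (Set.Ioi 0) :=
    fun α => (hu α).integrableOn_mul_pairing (hpH α).memLp hd hcθ.deriv
  have j2 : ∀ α β, IntegrableOn (fun t => θ t *
      ∫ x, (S.u t x α * S.u t x β - ν * S.Du t x α β) * pd β (p α) x) (Set.Ioi 0) := fun α β =>
    (S.inL1L2_convective ν α β).integrableOn_mul_pairing ((hpH α).memLp_grad β) hθ.continuous hcθ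
  have j3 : ∀ α β, IntegrableOn (fun t => θ t *
      ∫ x, ((∑ i, ∑ j, S.DQ α t x i j * S.DQ β t x i j)
        - ∑ i, ∑ j, padCoef α β i j * S.elastic t x i j) * pd β (p α) x) (Set.Ioi 0) := fun α β =>
    (S.inL1L2_elasticStress α β).integrableOn_mul_pairing ((hpH α).memLp_grad β) hθ.continuous hcθ
  have e : ∀ α β, ∫ t in Set.Ioi 0, θ t * ∫ x, S.stress L ν α β t x * pd β (p α) x
      = (∫ t in Set.Ioi 0, θ t *
          ∫ x, (S.u t x α * S.u t x β - ν * S.Du t x α β) * pd β (p α) x)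
        + L * ∫ t in Set.Ioi 0, θ t * ∫ x, ((∑ i, ∑ j, S.DQ α t x i j * S.DQ β t x i j)
          - ∑ i, ∑ j, padCoef α β i j * S.elastic t x i j) * pd β (p α) x := by
    intro α β
    rw [← integral_const_mul, ← integral_add (j2 α β) ((j3 α β).const_mul L)]
    refine integral_congr_ae ?_
    have t1 : ∀ᵐ t ∂volume.restrict (Set.Ioi (0 : ℝ)), _ := (S.inL1L2_convective ν α β).memLp
    have t2 : ∀ᵐ t ∂volume.restrict (Set.Ioi (0 : ℝ)), _ := (S.inL1L2_elasticStress α β).memLp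
    filter_upwards [t1, t2] with t m1 m2
    have e6 : ∫ x, S.stress L ν α β t x * pd β (p α) x
        = (∫ x, (S.u t x α * S.u t x β - ν * S.Du t x α β) * pd β (p α) x)
          + L * ∫ x, ((∑ i, ∑ j, S.DQ α t x i j * S.DQ β t x i j)
            - ∑ i, ∑ j, padCoef α β i j * S.elastic t x i j) * pd β (p α) x := by
      rw [← integral_const_mul, ← integral_add (integrable_mul_two m1 ((hpH α).memLp_grad β))
        ((integrable_mul_two m2 ((hpH α).memLp_grad β)).const_mul L)]
      refine integral_congr_ae (.of_forall fun x => ?_)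
      simp only [stress_eq]
      ring
    rw [e6]
    ring
  rw [integral_sub (integrable_finsetSum _ fun α _ => j1 α).fun_neg
      (integrable_finsetSum _ fun α _ => integrable_finsetSum _ fun β _ => j2 α β),
    integral_neg, integral_finsetSum _ fun α _ => j1 α,
    integral_finsetSum _ fun α _ => integrable_finsetSum _ fun β _ => j2 α β,
    integral_finsetSum _ fun α _ => integrable_finsetSum _ fun β _ => j3 α β] at h
  simp only [integral_finsetSum _ fun β _ => j2 _ β, integral_finsetSum _ fun β _ => j3 _ β] at h
  simp only [e, Finset.sum_add_distrib, ← Finset.mul_sum]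
  linarith

end WeakFlow

/-- The Fourier transform of a solenoidal field is orthogonal to the frequency. -/
theorem sum_sym_mul_fourier_eq_zero {v : Fin 2 → L2R} {Dv : Fin 2 → Fin 2 → L2R}
    (h : ∀ α, HasWeakPartial α (v α) (Dv α α)) (hdiv : ∀ᵐ x, ∑ α, Dv α α x = 0) :
    ∀ᵐ ξ, ∑ α, sym α ξ * (𝓕 (toL2C (v α)) : L2C) ξ = 0 := by
  have h0 : ∑ α, Dv α α = 0 := by
    refine (Lp.eq_zero_iff_ae_eq_zero).2 ?_
    rw [Fin.sum_univ_two]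
    filter_upwards [Lp.coeFn_add (Dv 0 0) (Dv 1 1), hdiv] with x h1 h2
    rw [Fin.sum_univ_two] at h2
    rw [h1, Pi.add_apply, h2, Pi.zero_apply]
  have h1 : ∑ α, (𝓕 (toL2C (Dv α α)) : L2C) = 0 := by
    have : ∑ α, (𝓕 (toL2C (Dv α α)) : L2C)
        = Lp.fourierTransformₗᵢ Plane ℂ (toL2C (∑ α, Dv α α)) := by
      rw [map_sum, map_sum]; rfl
    rw [this, h0, map_zero, map_zero]
  have h2 := coeFn_sum_L2C Finset.univ fun α => (𝓕 (toL2C (Dv α α)) : L2C)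
  rw [h1] at h2
  filter_upwards [h2, Lp.coeFn_zero ℂ 2 (volume : Measure Plane),
    ae_all_iff.2 fun α => (h α).fourier] with ξ a1 a2 a3
  rw [a2, Pi.zero_apply] at a1
  rw [a1]
  exact Finset.sum_congr rfl fun α _ => (a3 α).symm

namespace WeakFlow

variable {N : ℕ} (S₁ S₂ : WeakFlow N)

/-- The difference of the velocities of two solutions. -/
def velDiff (α : Fin 2) (t : ℝ) (x : Plane) : ℝ := S₁.u t x α - S₂.u t x α

/-- The difference of the velocity gradients of two solutions. -/
def gradDiff (α β : Fin 2) (t : ℝ) (x : Plane) : ℝ := S₁.Du t x α β - S₂.Du t x α β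

theorem inL1L2_velDiff (α : Fin 2) : InL1L2 (velDiff S₁ S₂ α) :=
  (S₁.inEnergy_u α).bound.inL2Loc.inL1L2.sub (S₂.inEnergy_u α).bound.inL2Loc.inL1L2

theorem ae_memH1_velDiff : ∀ᵐ t ∂timeMeasure, ∀ α,
    MemH1 (velDiff S₁ S₂ α t) (fun β => gradDiff S₁ S₂ α β t) := by
  filter_upwards [S₁.ae_memH1_u, S₂.ae_memH1_u] with t h1 h2 α using (h1 α).sub (h2 α)

theorem ae_div_gradDiff : ∀ᵐ t ∂timeMeasure, ∀ᵐ x, ∑ k, gradDiff S₁ S₂ k k t x = 0 := by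
  filter_upwards [S₁.ae_div, S₂.ae_div] with t h1 h2
  filter_upwards [h1, h2] with x a1 a2
  simp only [gradDiff, Finset.sum_sub_distrib, a1, a2, sub_zero]

/-- The difference of the velocities is solenoidal, on the Fourier side. -/
theorem ae_fourier_velDiff : ∀ᵐ t ∂timeMeasure,
    ∀ᵐ ξ, ∑ α, sym α ξ * (𝓕 (toL2C (path (velDiff S₁ S₂ α) t)) : L2C) ξ = 0 := by
  filter_upwards [ae_memH1_velDiff S₁ S₂, ae_div_gradDiff S₁ S₂] with t h1 h2
  refine sum_sym_mul_fourier_eq_zero (Dv := fun α β => ((h1 α).memLp_grad β).toLp) (fun α => ?_) ?_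
  · rw [path_eq (h1 α).memLp]
    exact ((h1 α).weak α).toLp (h1 α).memLp ((h1 α).memLp_grad α)
  · filter_upwards [h2, ae_all_iff.2 fun α => ((h1 α).memLp_grad α).coeFn_toLp] with x a1 a2
    simp only [a2, a1]

/-- The energy identity in `H⁻¹` for the difference of the velocities of two solutions with the same
data. -/
theorem energy_identity_u {L ν : ℝ} {ubar : Plane → Plane}
    (h₁ : UEquation L ν ubar S₁.Q S₁.DQ S₁.D2Q S₁.u S₁.Du)
    (h₂ : UEquation L ν ubar S₂.Q S₂.DQ S₂.D2Q S₂.u S₂.Du) :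
    (∀ T, IntegrableOn (fun t => ∑ α : Fin 2 × Fin 2, (inner ℝ
      (path (fun t x => S₁.stress L ν α.1 α.2 t x - S₂.stress L ν α.1 α.2 t x) t)
      (resD α.2 (path (velDiff S₁ S₂ α.1) t)) : ℝ)) (Set.Ioc 0 T)) ∧
    ∀ᵐ t ∂timeMeasure,
      ∑ α, (inner ℝ (path (velDiff S₁ S₂ α) t) (res (path (velDiff S₁ S₂ α) t)) : ℝ)
      = 2 * ∫ s in Set.Ioc 0 t, ∑ α : Fin 2 × Fin 2, (inner ℝ
        (path (fun t x => S₁.stress L ν α.1 α.2 t x - S₂.stress L ν α.1 α.2 t x) s)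
        (resD α.2 (path (velDiff S₁ S₂ α.1) s)) : ℝ) := by
  let σ : Fin 2 → Fin 2 → ℝ → Plane → ℝ := fun α β t x =>
    S₁.stress L ν α β t x - S₂.stress L ν α β t x
  have hσ : ∀ α β, InL1L2 (σ α β) := fun α β =>
    (S₁.inL1L2_stress L ν α β).sub (S₂.inL1L2_stress L ν α β)
  have hv := inL1L2_velDiff S₁ S₂
  let z : ℝ → L2C := fun t => ∑ α, curlOp α (path (velDiff S₁ S₂ α) t)
  let Y : ℝ → L2C := fun t => -∑ α : Fin 2 × Fin 2, curlDivOp α.1 α.2 (path (σ α.1 α.2) t)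
  have hz : ∀ T, IntegrableOn z (Set.Ioc 0 T) := fun T =>
    integrable_finsetSum _ fun α _ => (curlOp α).integrable_comp ((hv α).integrableOn_path T)
  have hY : ∀ T, IntegrableOn Y (Set.Ioc 0 T) := fun T =>
    (integrable_finsetSum _ fun α _ =>
      (curlDivOp α.1 α.2).integrable_comp ((hσ α.1 α.2).integrableOn_path T)).fun_neg
  have hev : ∀ᵐ t ∂timeMeasure, z t = ∫ s in Set.Ioc 0 t, Y s := by
    refine ae_eq_primitive_of_forall_test hz hY fun θ hθ hcθ => ?_
    have hd : Continuous (deriv θ) := hθ.continuous_deriv (by simp)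
    have iV := fun α => integrableOn_Ioi_smul_of_hasCompactSupport
      (hv α).integrableOn_path hd hcθ.deriv
    have iS := fun α β => integrableOn_Ioi_smul_of_hasCompactSupport
      (hσ α β).integrableOn_path hθ.continuous hcθ
    have hop : ∑ α, curlOp α (∫ t in Set.Ioi 0, deriv θ t • path (velDiff S₁ S₂ α) t)
        = ∑ α : Fin 2 × Fin 2, curlDivOp α.1 α.2
          (∫ t in Set.Ioi 0, θ t • path (σ α.1 α.2) t) := by
      refine curlOp_eq_curlDivOp (V := fun α => ∫ t in Set.Ioi 0, deriv θ t •
        path (velDiff S₁ S₂ α) t) (S := fun α β => ∫ t in Set.Ioi 0, θ t • path (σ α β) t)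
        fun η hη hc => ?_
      -- the solenoidal field `∇^⊥ η`
      let p : Fin 2 → Plane → ℝ := ![fun y => -pd 1 η y, pd 0 η]
      have hp : ∀ α, ContDiff ℝ ∞ (p α) := by
        rw [Fin.forall_fin_two]
        exact ⟨(contDiff_pd hη 1).neg, contDiff_pd hη 0⟩
      have hcp : ∀ α, HasCompactSupport (p α) := by
        rw [Fin.forall_fin_two]
        exact ⟨(hasCompactSupport_pd hc 1).neg, hasCompactSupport_pd hc 0⟩
      have hdiv : ∀ x, ∑ k, pd k (p k) x = 0 := by
        intro x
        rw [Fin.sum_univ_two]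
        change pd 0 (fun y => -pd 1 η y) x + pd 1 (pd 0 η) x = 0
        rw [pd_neg, pd_comm hη 1 0]
        ring
      have hpH := fun α => memH1_of_contDiff (hp α) (hcp α)
      have e₁ := S₁.weak_u h₁ hp hcp hdiv hθ hcθ
      have e₂ := S₂.weak_u h₂ hp hcp hdiv hθ hcθ
      have sub : ∀ {f g : ℝ → Plane → ℝ} {ρ : ℝ → ℝ} {ζ : Plane → ℝ}, InL1L2 f → InL1L2 g →
          MemLp ζ 2 (volume : Measure Plane) → Continuous ρ → HasCompactSupport ρ →
          ∫ t in Set.Ioi 0, ρ t * ∫ x, (f t x - g t x) * ζ x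
            = (∫ t in Set.Ioi 0, ρ t * ∫ x, f t x * ζ x)
              - ∫ t in Set.Ioi 0, ρ t * ∫ x, g t x * ζ x := by
        intro f g ρ ζ hf hg hζ hρ hcρ
        rw [← integral_sub (hf.integrableOn_mul_pairing hζ hρ hcρ)
          (hg.integrableOn_mul_pairing hζ hρ hcρ)]
        refine integral_congr_ae ?_
        have t1 : ∀ᵐ t ∂volume.restrict (Set.Ioi (0 : ℝ)), _ := hf.memLp
        have t2 : ∀ᵐ t ∂volume.restrict (Set.Ioi (0 : ℝ)), _ := hg.memLp
        filter_upwards [t1, t2] with t m1 m2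
        rw [← mul_sub, ← integral_sub (integrable_mul_two m1 hζ) (integrable_mul_two m2 hζ)]
        simp only [sub_mul]
      have eV : ∀ α, ∫ x, (∫ t in Set.Ioi 0, deriv θ t • path (velDiff S₁ S₂ α) t : L2R) x * p α x
          = (∫ t in Set.Ioi 0, deriv θ t * ∫ x, S₁.u t x α * p α x)
            - ∫ t in Set.Ioi 0, deriv θ t * ∫ x, S₂.u t x α * p α x := by
        intro α
        rw [(hv α).integral_pairing (hpH α).memLp hd hcθ.deriv]
        exact sub (S₁.inEnergy_u α).bound.inL2Loc.inL1L2 (S₂.inEnergy_u α).bound.inL2Loc.inL1L2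
          (hpH α).memLp hd hcθ.deriv
      have eS : ∀ α β, ∫ x, (∫ t in Set.Ioi 0, θ t • path (σ α β) t : L2R) x * pd β (p α) x
          = (∫ t in Set.Ioi 0, θ t * ∫ x, S₁.stress L ν α β t x * pd β (p α) x)
            - ∫ t in Set.Ioi 0, θ t * ∫ x, S₂.stress L ν α β t x * pd β (p α) x := by
        intro α β
        rw [(hσ α β).integral_pairing ((hpH α).memLp_grad β) hθ.continuous hcθ]
        exact sub (S₁.inL1L2_stress L ν α β) (S₂.inL1L2_stress L ν α β)
          ((hpH α).memLp_grad β) hθ.continuous hcθ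
      have v0 := eV 0
      have v1 := eV 1
      have s00 := eS 0 0
      have s01 := eS 0 1
      have s10 := eS 1 0
      have s11 := eS 1 1
      simp only [Fin.sum_univ_two] at e₁ e₂ ⊢
      change (-∫ x, (∫ t in Set.Ioi 0, deriv θ t • path (velDiff S₁ S₂ 0) t : L2R) x * p 0 x)
        - ∫ x, (∫ t in Set.Ioi 0, deriv θ t • path (velDiff S₁ S₂ 1) t : L2R) x * p 1 x
        = ((∫ x, (∫ t in Set.Ioi 0, θ t • path (σ 0 0) t : L2R) x * pd 0 (p 0) x)
          + ∫ x, (∫ t in Set.Ioi 0, θ t • path (σ 1 0) t : L2R) x * pd 0 (p 1) x)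
        + ((∫ x, (∫ t in Set.Ioi 0, θ t • path (σ 0 1) t : L2R) x * pd 1 (p 0) x)
          + ∫ x, (∫ t in Set.Ioi 0, θ t • path (σ 1 1) t : L2R) x * pd 1 (p 1) x)
      rw [v0, v1, s00, s01, s10, s11]
      linarith
    have l1 : ∫ t in Set.Ioi 0, deriv θ t • z t
        = ∑ α, curlOp α (∫ t in Set.Ioi 0, deriv θ t • path (velDiff S₁ S₂ α) t) := by
      simp only [← ContinuousLinearMap.integral_comp_comm _ (iV _)]
      rw [← integral_finsetSum _ fun α _ => (curlOp α).integrable_comp (iV α)]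
      simp only [map_smul, z, Finset.smul_sum]
    have l2 : ∫ t in Set.Ioi 0, θ t • Y t
        = -∑ α : Fin 2 × Fin 2, curlDivOp α.1 α.2
          (∫ t in Set.Ioi 0, θ t • path (σ α.1 α.2) t) := by
      simp only [← ContinuousLinearMap.integral_comp_comm _ (iS _ _)]
      rw [← integral_finsetSum _ fun α _ => (curlDivOp α.1 α.2).integrable_comp (iS α.1 α.2),
        ← integral_neg]
      simp only [map_smul, Y, Finset.smul_sum, smul_neg]
    rw [l1, l2, hop, neg_neg]
  have hen := norm_sq_of_ae_eq_primitive hY hev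
  have hin : ∀ᵐ t ∂timeMeasure, (inner ℝ (z t) (Y t) : ℝ)
      = ∑ α : Fin 2 × Fin 2, (inner ℝ (path (σ α.1 α.2) t)
        (resD α.2 (path (velDiff S₁ S₂ α.1) t)) : ℝ) := by
    filter_upwards [ae_fourier_velDiff S₁ S₂] with t ht
    have := inner_curlOp_curlDivOp (fun α β => path (σ α β) t) ht
    rw [real_inner_comm, real_inner_L2C, inner_neg_left, Complex.neg_re, this, neg_neg]
  refine ⟨fun T => (hen.1 T).congr (ae_mono (restrict_Ioc_le_timeMeasure T) hin), ?_⟩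
  filter_upwards [hen.2, ae_fourier_velDiff S₁ S₂] with t h1 h2
  rw [← norm_sq_curlOp h2, ← integral_congr_ae_Ioc hin t]
  exact h1

end WeakFlow

/-! ### Terms controlled by the dissipation and the energy -/

/-- The quantities in which the terms of the energy balance are measured, as functions of time: the
dissipation `d`, the energy `e` and the coefficient `a` of the Gronwall inequality. -/
structure Scale where
  /-- the dissipation -/
  d : ℝ → ℝ
  /-- the energy -/
  e : ℝ → ℝ
  /-- the Gronwall coefficient -/
  a : ℝ → ℝ
  d_nonneg : ∀ t, 0 ≤ d t
  e_nonneg : ∀ t, 0 ≤ e t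
  one_le_a : ∀ t, 1 ≤ a t

namespace Scale

variable (s : Scale)

/-- `‖f‖₂² ≲ d + e`. -/
def Dissip (f : ℝ → Plane → ℝ) : Prop :=
  ∃ C : ℝ, 0 ≤ C ∧ ∀ᵐ t ∂timeMeasure, MemLp (f t) 2 (volume : Measure Plane) ∧
    n2 (f t) ^ 2 ≤ C * (s.d t + s.e t)

/-- `‖g‖₂² ≲ e` and `‖g‖₄⁴ ≲ e (d + e)`. -/
def Energy (g : ℝ → Plane → ℝ) : Prop :=
  ∃ C : ℝ, 0 ≤ C ∧ ∀ᵐ t ∂timeMeasure, MemLp (g t) 2 (volume : Measure Plane) ∧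
    MemLp (g t) 4 (volume : Measure Plane) ∧ n2 (g t) ^ 2 ≤ C * s.e t ∧
    n4 (g t) ^ 4 ≤ C * (s.e t * (s.d t + s.e t))

/-- `‖h‖₄⁴ ≲ a`. -/
def Coef4 (h : ℝ → Plane → ℝ) : Prop :=
  ∃ C : ℝ, 0 ≤ C ∧ ∀ᵐ t ∂timeMeasure, MemLp (h t) 4 (volume : Measure Plane) ∧
    n4 (h t) ^ 4 ≤ C * s.a t

/-- `‖f‖₂² ≲ a`. -/
def Coef2 (f : ℝ → Plane → ℝ) : Prop :=
  ∃ C : ℝ, 0 ≤ C ∧ ∀ᵐ t ∂timeMeasure, MemLp (f t) 2 (volume : Measure Plane) ∧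
    n2 (f t) ^ 2 ≤ C * s.a t

/-- The integral of `F` over space is bounded by `ε (d + e) + C(ε) a e` for every `ε > 0`. -/
structure Ctrl (F : ℝ → Plane → ℝ) : Prop where
  integrable : ∀ᵐ t ∂timeMeasure, Integrable (F t) (volume : Measure Plane)
  bound : ∀ ε : ℝ, 0 < ε → ∃ C : ℝ, 0 ≤ C ∧ ∀ᵐ t ∂timeMeasure,
    |∫ x, F t x| ≤ ε * (s.d t + s.e t) + C * (s.a t * s.e t)

variable {s}

theorem Ctrl.of_integral_eq {F G : ℝ → Plane → ℝ} (hF : s.Ctrl F)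
    (h : ∀ᵐ t ∂timeMeasure, Integrable (G t) (volume : Measure Plane) ∧
      ∫ x, G t x = ∫ x, F t x) : s.Ctrl G := by
  refine ⟨h.mono fun t ht => ht.1, fun ε hε => ?_⟩
  obtain ⟨C, hC, hb⟩ := hF.bound ε hε
  refine ⟨C, hC, ?_⟩
  filter_upwards [hb, h] with t h1 h2
  rw [h2.2]; exact h1

theorem Ctrl.congr {F G : ℝ → Plane → ℝ} (hF : s.Ctrl F)
    (h : ∀ᵐ t ∂timeMeasure, ∀ᵐ x, F t x = G t x) : s.Ctrl G := by
  refine hF.of_integral_eq ?_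
  filter_upwards [hF.integrable, h] with t h1 h2
  exact ⟨h1.congr h2, (integral_congr_ae h2).symm⟩

theorem ctrl_zero : s.Ctrl fun _ _ => 0 := by
  refine ⟨.of_forall fun _ => integrable_zero _ _ _, fun ε hε =>
    ⟨0, le_rfl, .of_forall fun t => ?_⟩⟩
  have := s.d_nonneg t
  have := s.e_nonneg t
  simp only [integral_zero, abs_zero, zero_mul, add_zero]
  positivity

theorem Ctrl.add {F G : ℝ → Plane → ℝ} (hF : s.Ctrl F) (hG : s.Ctrl G) :
    s.Ctrl fun t x => F t x + G t x := by
  refine ⟨?_, fun ε hε => ?_⟩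
  · filter_upwards [hF.integrable, hG.integrable] with t h1 h2 using h1.add h2
  · obtain ⟨C, hC, hb⟩ := hF.bound (ε / 2) (by positivity)
    obtain ⟨C', hC', hb'⟩ := hG.bound (ε / 2) (by positivity)
    refine ⟨C + C', by positivity, ?_⟩
    filter_upwards [hF.integrable, hG.integrable, hb, hb'] with t h1 h2 h3 h4
    rw [integral_add h1 h2]
    refine (abs_add_le _ _).trans ((add_le_add h3 h4).trans (le_of_eq ?_))
    ring

theorem Ctrl.const_mul {F : ℝ → Plane → ℝ} (hF : s.Ctrl F) (c : ℝ) :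
    s.Ctrl fun t x => c * F t x := by
  refine ⟨hF.integrable.mono fun t h => h.const_mul c, fun ε hε => ?_⟩
  obtain ⟨C, hC, hb⟩ := hF.bound (ε / (|c| + 1)) (by positivity)
  refine ⟨|c| * C, by positivity, ?_⟩
  filter_upwards [hb] with t h1
  rw [integral_const_mul, abs_mul]
  refine (mul_le_mul_of_nonneg_left h1 (abs_nonneg c)).trans ?_
  have hp : 0 ≤ s.d t + s.e t := add_nonneg (s.d_nonneg t) (s.e_nonneg t)
  have h2 : |c| * (ε / (|c| + 1)) ≤ ε := by
    rw [mul_div_assoc', div_le_iff₀ (by positivity)]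
    nlinarith [abs_nonneg c]
  nlinarith [mul_le_mul_of_nonneg_right h2 hp]

theorem Ctrl.neg {F : ℝ → Plane → ℝ} (hF : s.Ctrl F) : s.Ctrl fun t x => -F t x := by
  simpa using hF.const_mul (-1)

theorem Ctrl.sub {F G : ℝ → Plane → ℝ} (hF : s.Ctrl F) (hG : s.Ctrl G) :
    s.Ctrl fun t x => F t x - G t x := by
  simpa [sub_eq_add_neg] using hF.add hG.neg

theorem Ctrl.sum {ι : Type*} (T : Finset ι) {F : ι → ℝ → Plane → ℝ}
    (h : ∀ i ∈ T, s.Ctrl (F i)) : s.Ctrl fun t x => ∑ i ∈ T, F i t x := by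
  classical
  induction T using Finset.induction_on with
  | empty => simpa using ctrl_zero
  | insert i T hi ih =>
    simp only [Finset.sum_insert hi]
    exact (h i (Finset.mem_insert_self i T)).add
      (ih fun j hj => h j (Finset.mem_insert_of_mem hj))

/-- Young's inequality in the form in which it is used for the trilinear terms. -/
theorem le_of_pow_four_le {X p q C ε : ℝ} (hp : 0 ≤ p) (hq : 0 ≤ q) (hC : 0 ≤ C) (hε : 0 < ε)
    (h : X ^ 4 ≤ C * (p ^ 3 * q) ∨ X ^ 4 ≤ C * (p ^ 2 * q ^ 2)) :
    X ≤ ε * p + (C / ε ^ 3 + (C + 1) / ε) * q := by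
  set K : ℝ := C / ε ^ 3 + (C + 1) / ε with hK
  have hK0 : 0 ≤ K := by positivity
  have hR : 0 ≤ ε * p + K * q := by positivity
  have hexp : (ε * p + K * q) ^ 4 = (ε * p) ^ 4 + 4 * (ε * p) ^ 3 * (K * q)
      + 6 * (ε * p) ^ 2 * (K * q) ^ 2 + 4 * (ε * p) * (K * q) ^ 3 + (K * q) ^ 4 := by ring
  have hpow : X ^ 4 ≤ (ε * p + K * q) ^ 4 := by
    rw [hexp]
    have n1 : 0 ≤ (ε * p) ^ 4 := by positivity
    have n2 : 0 ≤ 4 * (ε * p) ^ 3 * (K * q) := by positivity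
    have n3 : 0 ≤ 6 * (ε * p) ^ 2 * (K * q) ^ 2 := by positivity
    have n4 : 0 ≤ 4 * (ε * p) * (K * q) ^ 3 := by positivity
    have n5 : 0 ≤ (K * q) ^ 4 := by positivity
    rcases h with h | h
    · have h1 : C ≤ ε ^ 3 * K := by
        have : ε ^ 3 * (C / ε ^ 3) = C := by field_simp
        have h2 : 0 ≤ ε ^ 3 * ((C + 1) / ε) := by positivity
        rw [hK, mul_add]; linarith
      have h3 := mul_le_mul_of_nonneg_right h1 (by positivity : 0 ≤ p ^ 3 * q)
      nlinarith
    · have h1 : C + 1 ≤ ε * K := by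
        have : ε * ((C + 1) / ε) = C + 1 := by field_simp
        have h2 : 0 ≤ ε * (C / ε ^ 3) := by positivity
        rw [hK, mul_add]; linarith
      have h2 : C ≤ (ε * K) ^ 2 := by nlinarith
      have h3 := mul_le_mul_of_nonneg_right h2 (by positivity : 0 ≤ p ^ 2 * q ^ 2)
      nlinarith
  by_contra hlt
  rw [not_le] at hlt
  exact absurd hpow (not_le.2 (pow_lt_pow_left₀ hlt hR (by norm_num)))

theorem Ctrl.of_bound {F : ℝ → Plane → ℝ} {X : ℝ → ℝ} {C : ℝ} (hC : 0 ≤ C)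
    (h : ∀ᵐ t ∂timeMeasure, Integrable (F t) (volume : Measure Plane) ∧ |∫ x, F t x| ≤ X t ∧
      (X t ^ 4 ≤ C * ((s.d t + s.e t) ^ 3 * (s.a t * s.e t)) ∨
        X t ^ 4 ≤ C * ((s.d t + s.e t) ^ 2 * (s.a t * s.e t) ^ 2))) : s.Ctrl F := by
  refine ⟨h.mono fun t ht => ht.1, fun ε hε => ⟨C / ε ^ 3 + (C + 1) / ε, by positivity, ?_⟩⟩
  filter_upwards [h] with t ht
  have := s.d_nonneg t
  have := s.e_nonneg t
  have := s.one_le_a t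
  exact ht.2.1.trans (le_of_pow_four_le (by positivity) (by positivity) hC hε ht.2.2)

/-- Trilinear terms with one factor in the dissipation and one in the energy. -/
theorem Dissip.ctrl {f g h : ℝ → Plane → ℝ} (hf : s.Dissip f) (hg : s.Energy g)
    (hh : s.Coef4 h) : s.Ctrl fun t x => f t x * g t x * h t x := by
  obtain ⟨C₁, hC₁, h₁⟩ := hf
  obtain ⟨C₂, hC₂, h₂⟩ := hg
  obtain ⟨C₃, hC₃, h₃⟩ := hh
  refine Ctrl.of_bound (X := fun t => n2 (f t) * (n4 (g t) * n4 (h t)))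
    (C := C₁ ^ 2 * C₂ * C₃) (by positivity) ?_
  filter_upwards [h₁, h₂, h₃] with t ⟨m1, b1⟩ ⟨_, m2, _, b2⟩ ⟨m3, b3⟩
  refine ⟨integrable_mul_mul m1 m2 m3, abs_integral_mul_mul_le m1 m2 m3, Or.inl ?_⟩
  have := s.d_nonneg t
  have := s.e_nonneg t
  have := s.one_le_a t
  have := n2_nonneg (f t)
  have := n4_nonneg (g t)
  have := n4_nonneg (h t)
  calc (n2 (f t) * (n4 (g t) * n4 (h t))) ^ 4
      = (n2 (f t) ^ 2) ^ 2 * (n4 (g t) ^ 4 * n4 (h t) ^ 4) := by ring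
    _ ≤ (C₁ * (s.d t + s.e t)) ^ 2 * ((C₂ * (s.e t * (s.d t + s.e t))) * (C₃ * s.a t)) := by
        gcongr
    _ = _ := by ring

/-- Trilinear terms with two factors in the energy. -/
theorem Coef2.ctrl {f g h : ℝ → Plane → ℝ} (hf : s.Coef2 f) (hg : s.Energy g)
    (hh : s.Energy h) : s.Ctrl fun t x => f t x * g t x * h t x := by
  obtain ⟨C₁, hC₁, h₁⟩ := hf
  obtain ⟨C₂, hC₂, h₂⟩ := hg
  obtain ⟨C₃, hC₃, h₃⟩ := hh
  refine Ctrl.of_bound (X := fun t => n2 (f t) * (n4 (g t) * n4 (h t)))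
    (C := C₁ ^ 2 * C₂ * C₃) (by positivity) ?_
  filter_upwards [h₁, h₂, h₃] with t ⟨m1, b1⟩ ⟨_, m2, _, b2⟩ ⟨_, m3, _, b3⟩
  refine ⟨integrable_mul_mul m1 m2 m3, abs_integral_mul_mul_le m1 m2 m3, Or.inr ?_⟩
  have := s.d_nonneg t
  have := s.e_nonneg t
  have := s.one_le_a t
  have := n2_nonneg (f t)
  have := n4_nonneg (g t)
  have := n4_nonneg (h t)
  calc (n2 (f t) * (n4 (g t) * n4 (h t))) ^ 4
      = (n2 (f t) ^ 2) ^ 2 * (n4 (g t) ^ 4 * n4 (h t) ^ 4) := by ring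
    _ ≤ (C₁ * s.a t) ^ 2 * ((C₂ * (s.e t * (s.d t + s.e t)))
          * (C₃ * (s.e t * (s.d t + s.e t)))) := by gcongr
    _ = _ := by ring

theorem Energy.ctrl {g h : ℝ → Plane → ℝ} (hg : s.Energy g) (hh : s.Energy h) :
    s.Ctrl fun t x => g t x * h t x := by
  obtain ⟨C₂, hC₂, h₂⟩ := hg
  obtain ⟨C₃, hC₃, h₃⟩ := hh
  refine Ctrl.of_bound (X := fun t => n2 (g t) * n2 (h t))
    (C := C₂ ^ 2 * C₃ ^ 2) (by positivity) ?_
  filter_upwards [h₂, h₃] with t ⟨m2, _, b2, _⟩ ⟨m3, _, b3, _⟩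
  refine ⟨integrable_mul_two m2 m3, abs_integral_mul_le m2 m3, Or.inr ?_⟩
  have hd := s.d_nonneg t
  have he := s.e_nonneg t
  have ha := s.one_le_a t
  have := n2_nonneg (g t)
  have := n2_nonneg (h t)
  calc (n2 (g t) * n2 (h t)) ^ 4 = (n2 (g t) ^ 2) ^ 2 * (n2 (h t) ^ 2) ^ 2 := by ring
    _ ≤ (C₂ * s.e t) ^ 2 * (C₃ * s.e t) ^ 2 := by gcongr
    _ = C₂ ^ 2 * C₃ ^ 2 * ((0 + s.e t) ^ 2 * (1 * s.e t) ^ 2) := by ring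
    _ ≤ C₂ ^ 2 * C₃ ^ 2 * ((s.d t + s.e t) ^ 2 * (s.a t * s.e t) ^ 2) := by gcongr

theorem Coef4.mul {f g : ℝ → Plane → ℝ} (hf : s.Coef4 f) (hg : s.Coef4 g) :
    s.Coef2 fun t x => f t x * g t x := by
  obtain ⟨C₁, hC₁, h₁⟩ := hf
  obtain ⟨C₂, hC₂, h₂⟩ := hg
  refine ⟨C₁ + C₂, by positivity, ?_⟩
  filter_upwards [h₁, h₂] with t ⟨m1, b1⟩ ⟨m2, b2⟩
  refine ⟨memLp_mul_four m1 m2, ?_⟩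
  have h := n2_mul_le m1 m2
  have h0 := n2_nonneg fun x => f t x * g t x
  calc n2 (fun x => f t x * g t x) ^ 2 ≤ (n4 (f t) * n4 (g t)) ^ 2 := by gcongr
    _ ≤ n4 (f t) ^ 4 + n4 (g t) ^ 4 := by
        nlinarith [sq_nonneg (n4 (f t) ^ 2 - n4 (g t) ^ 2), sq_nonneg (n4 (f t) ^ 2),
          sq_nonneg (n4 (g t) ^ 2)]
    _ ≤ _ := by linarith

theorem Coef2.add {f g : ℝ → Plane → ℝ} (hf : s.Coef2 f) (hg : s.Coef2 g) :
    s.Coef2 fun t x => f t x + g t x := by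
  obtain ⟨C₁, hC₁, h₁⟩ := hf
  obtain ⟨C₂, hC₂, h₂⟩ := hg
  refine ⟨2 * (C₁ + C₂), by positivity, ?_⟩
  filter_upwards [h₁, h₂] with t ⟨m1, b1⟩ ⟨m2, b2⟩
  refine ⟨m1.add m2, ?_⟩
  have h := n2_add_le m1 m2
  have h0 := n2_nonneg fun x => f t x + g t x
  calc n2 (fun x => f t x + g t x) ^ 2 ≤ (n2 (f t) + n2 (g t)) ^ 2 := by gcongr
    _ ≤ 2 * (n2 (f t) ^ 2 + n2 (g t) ^ 2) := add_sq_le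
    _ ≤ _ := by linarith

theorem exists_ladyWeight_bound : ∃ K : ℝ, 0 ≤ K ∧ ∀ {f : ℝ → Plane → ℝ}
    {Df : Fin 2 → ℝ → Plane → ℝ} {t : ℝ}, MemH1 (f t) (fun k => Df k t) →
      n4 (f t) ^ 4 ≤ K * ladyWeight f Df t := by
  obtain ⟨K, hK, hlad⟩ := exists_ladyzhenskaya
  refine ⟨K ^ 2, by positivity, fun {f Df t} h => ?_⟩
  have h1 := (hlad _ _ h).2
  have h2 := n4_nonneg (f t)
  calc n4 (f t) ^ 4 = (n4 (f t) ^ 2) ^ 2 := by ring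
    _ ≤ (K * (n2 (f t) * ∑ k, n2 (Df k t))) ^ 2 := by gcongr
    _ = _ := by rw [ladyWeight]; ring

theorem energy_of_memH1 {g : ℝ → Plane → ℝ} {Dg : Fin 2 → ℝ → Plane → ℝ} {C : ℝ} (hC : 0 ≤ C)
    (h : ∀ᵐ t ∂timeMeasure, MemH1 (g t) (fun k => Dg k t) ∧ n2 (g t) ^ 2 ≤ C * s.e t ∧
      ∀ k, n2 (Dg k t) ^ 2 ≤ C * s.d t) : s.Energy g := by
  obtain ⟨K, hK, hlad⟩ := exists_ladyWeight_bound
  refine ⟨C + K * (C * (4 * C)), by positivity, ?_⟩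
  filter_upwards [h] with t ⟨h1, h2, h3⟩
  have hd := s.d_nonneg t
  have he := s.e_nonneg t
  refine ⟨h1.memLp, h1.memLp_four, h2.trans ?_, (hlad h1).trans ?_⟩
  · nlinarith [mul_nonneg (mul_nonneg hK (mul_nonneg hC hC)) he]
  · have h4 : (∑ k, n2 (Dg k t)) ^ 2 ≤ 4 * C * s.d t := by
      rw [Fin.sum_univ_two]
      refine add_sq_le.trans ?_
      linarith [h3 0, h3 1]
    calc K * ladyWeight g Dg t = K * (n2 (g t) ^ 2 * (∑ k, n2 (Dg k t)) ^ 2) := by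
          rw [ladyWeight]; ring
      _ ≤ K * ((C * s.e t) * (4 * C * s.d t)) := by gcongr
      _ = K * (C * (4 * C)) * (s.e t * (s.d t + 0)) := by ring
      _ ≤ (C + K * (C * (4 * C))) * (s.e t * (s.d t + s.e t)) := by
          gcongr
          linarith

end Scale

/-! ### The resolvent of the velocity gradient -/

theorem memH1_res (g : L2R) : MemH1 (res g) (fun k => resD k g) :=
  ⟨Lp.memLp _, fun _ => Lp.memLp _, fun k => hasWeakPartial_res k g⟩

theorem memH1_resD (k : Fin 2) (g : L2R) : MemH1 (resD k g) (fun l => resDD k l g) :=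
  ⟨Lp.memLp _, fun _ => Lp.memLp _, fun l => hasWeakPartial_resD k l g⟩

theorem coeFn_res_sub_laplacian (g : L2R) : ∀ᵐ x, ∑ k, resDD k k g x = res g x - g x := by
  have h := res_sub_laplacian g
  have h1 : res g - g = ∑ k, resDD k k g := by rw [sub_eq_iff_eq_add, ← sub_eq_iff_eq_add', h]
  rw [Fin.sum_univ_two] at h1
  filter_upwards [Lp.coeFn_sub (res g) g, Lp.coeFn_add (resDD 0 0 g) (resDD 1 1 g)] with x a1 a2
  rw [Fin.sum_univ_two]
  rw [h1, a2] at a1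
  exact a1

/-- The norm of `H⁻¹` in terms of the resolvent. -/
theorem inner_res_self (g : L2R) : inner ℝ g (res g) = ‖res g‖ ^ 2 + ∑ k, ‖resD k g‖ ^ 2 := by
  have h1 : ∀ k, inner ℝ (resDD k k g) (res g) = -‖resD k g‖ ^ 2 := by
    intro k
    rw [inner_L2R, (memH1_resD k g).integral_mul_eq_neg (memH1_res g) k, ← inner_L2R,
      real_inner_self_eq_norm_sq]
  have h2 : inner ℝ (res g - ∑ k, resDD k k g) (res g) = ‖res g‖ ^ 2 + ∑ k, ‖resD k g‖ ^ 2 := by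
    rw [inner_sub_left, sum_inner, real_inner_self_eq_norm_sq]
    simp only [h1, Finset.sum_neg_distrib, sub_neg_eq_add]
  rwa [res_sub_laplacian g] at h2

/-- Moving the Laplacian from `R` to the resolvent of `G`: up to terms with at most one derivative
on each factor, `∫ ΔR (1 - Δ)⁻¹G Q = -∫ R G Q`. -/
theorem integral_laplacian_mul_res {R Q : Plane → ℝ} {DR DQ : Fin 2 → Plane → ℝ}
    {D2R : Fin 2 → Fin 2 → Plane → ℝ} (hR : MemH1 R DR) (hDR : ∀ k, MemH1 (DR k) (D2R k))
    (hQ : MemH1 Q DQ) (G : L2R) :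
    ∫ x, ((∑ k, D2R k k x) * res G x * Q x + G x * R x * Q x)
      = ∫ x, (Q x * R x * res G x
        + ∑ k, (resD k G x * R x * DQ k x - DR k x * res G x * DQ k x)) := by
  have hP := memH1_res G
  have hP4 := hP.memLp_four
  have hQ4 := hQ.memLp_four
  have hR4 := hR.memLp_four
  have i1 : ∀ k, Integrable (fun x => D2R k k x * res G x * Q x) volume := fun k =>
    integrable_mul_mul ((hDR k).memLp_grad k) hP4 hQ4
  have i2 : Integrable (fun x => G x * R x * Q x) volume :=
    integrable_mul_mul (Lp.memLp G) hR4 hQ4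
  have i3 : Integrable (fun x => Q x * R x * res G x) volume :=
    integrable_mul_mul hQ.memLp hR4 hP4
  have i4 : ∀ k, Integrable (fun x => resD k G x * R x * DQ k x) volume := fun k => by
    have := integrable_mul_mul (hQ.memLp_grad k) (memH1_resD k G).memLp_four hR4
    refine this.congr (.of_forall fun x => ?_)
    simp only; ring
  have i5 : ∀ k, Integrable (fun x => DR k x * res G x * DQ k x) volume := fun k => by
    have := integrable_mul_mul (hQ.memLp_grad k) hP4 (hDR k).memLp_four
    refine this.congr (.of_forall fun x => ?_)
    simp only; ring
  have i6 : ∀ k, Integrable (fun x => resDD k k G x * R x * Q x) volume := fun k =>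
    integrable_mul_mul (Lp.memLp _) hR4 hQ4
  have e1 : ∀ k, ∫ x, D2R k k x * res G x * Q x
      = (∫ x, resDD k k G x * R x * Q x) + (∫ x, resD k G x * R x * DQ k x)
        - ∫ x, DR k x * res G x * DQ k x := by
    intro k
    have h1 := (hDR k).integral_mul_mul_eq_neg hP hQ k
    have h2 := hR.integral_mul_mul_eq_neg (memH1_resD k G) hQ k
    have c1 : ∫ x, resD k G x * DR k x * Q x = ∫ x, DR k x * resD k G x * Q x :=
      integral_congr_ae (.of_forall fun x => by ring)
    have c2 : ∫ x, DQ k x * DR k x * res G x = ∫ x, DR k x * res G x * DQ k x :=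
      integral_congr_ae (.of_forall fun x => by ring)
    have c3 : ∫ x, DQ k x * R x * resD k G x = ∫ x, resD k G x * R x * DQ k x :=
      integral_congr_ae (.of_forall fun x => by ring)
    rw [h1, c1, h2, c2, c3]
    ring
  have e2 : ∑ k, ∫ x, resDD k k G x * R x * Q x
      = (∫ x, Q x * R x * res G x) - ∫ x, G x * R x * Q x := by
    rw [← integral_finsetSum _ fun k _ => i6 k, ← integral_sub i3 i2]
    refine integral_congr_ae ?_
    filter_upwards [coeFn_res_sub_laplacian G] with x hx
    simp only [← Finset.sum_mul, hx]
    ring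
  simp only [Finset.sum_mul]
  rw [integral_add (integrable_finsetSum _ fun k _ => i1 k) i2,
    integral_finsetSum _ fun k _ => i1 k,
    integral_add i3 (integrable_finsetSum _ fun k _ => (i4 k).sub' (i5 k)),
    integral_finsetSum _ fun k _ => (i4 k).sub' (i5 k)]
  simp only [e1, integral_sub (i4 _) (i5 _), Finset.sum_sub_distrib, Finset.sum_add_distrib] at *
  rw [e2]
  ring

namespace WeakFlow

variable {N : ℕ}

/-- The coefficient of the Gronwall inequality contributed by one solution. -/
def weight (S : WeakFlow N) (t : ℝ) : ℝ :=
  (∑ α, ladyWeight (fun t x => S.u t x α) (fun β t x => S.Du t x α β) t)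
    + (∑ k, ∑ i, ∑ j, ladyWeight (fun t x => S.DQ k t x i j) (fun l t x => S.D2Q k l t x i j) t)
    + (∑ i, ∑ j, ladyWeight (fun t x => S.Q t x i j) (fun l t x => S.DQ l t x i j) t)
    + (∑ i, ∑ j, n2 (fun x => S.Q t x i j) * n2 (fun x => S.Q t x i j))
    + ∑ k, ∑ i, ∑ j, n2 (fun x => S.D2Q k k t x i j) * n2 (fun x => S.D2Q k k t x i j)

theorem timeLp_weight (S : WeakFlow N) : TimeLp 1 S.weight := by
  refine ((((TimeLp.sum _ fun α _ => (S.inEnergy_u α).timeLp_ladyWeight).add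
    (TimeLp.sum _ fun k _ => TimeLp.sum _ fun i _ => TimeLp.sum _ fun j _ =>
      (S.inEnergy_DQ k i j).timeLp_ladyWeight)).add
    (TimeLp.sum _ fun i _ => TimeLp.sum _ fun j _ => (S.inEnergy_Q i j).timeLp_ladyWeight)).add
    (TimeLp.sum _ fun i _ => TimeLp.sum _ fun j _ => ?_)).add
    (TimeLp.sum _ fun k _ => TimeLp.sum _ fun i _ => TimeLp.sum _ fun j _ => ?_)
  · exact (S.hQ.bound_zero i j).inL2Loc.timeLp.mul (S.hQ.bound_zero i j).inL2Loc.timeLp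
  · exact (S.hQ.bound_second k k i j).timeLp.mul (S.hQ.bound_second k k i j).timeLp

theorem weight_bounds (S : WeakFlow N) (t : ℝ) :
    0 ≤ S.weight t
    ∧ (∀ α, ladyWeight (fun t x => S.u t x α) (fun β t x => S.Du t x α β) t ≤ S.weight t)
    ∧ (∀ k i j, ladyWeight (fun t x => S.DQ k t x i j) (fun l t x => S.D2Q k l t x i j) t
        ≤ S.weight t)
    ∧ (∀ i j, ladyWeight (fun t x => S.Q t x i j) (fun l t x => S.DQ l t x i j) t ≤ S.weight t)
    ∧ (∀ i j, n2 (fun x => S.Q t x i j) ^ 2 ≤ S.weight t)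
    ∧ ∀ k i j, n2 (fun x => S.D2Q k k t x i j) ^ 2 ≤ S.weight t := by
  have p1 : ∀ α, 0 ≤ ladyWeight (fun t x => S.u t x α) (fun β t x => S.Du t x α β) t := fun _ =>
    ladyWeight_nonneg _ _ _
  have p2 : ∀ k i j, 0 ≤ ladyWeight (fun t x => S.DQ k t x i j)
    (fun l t x => S.D2Q k l t x i j) t := fun _ _ _ => ladyWeight_nonneg _ _ _
  have p3 : ∀ i j, 0 ≤ ladyWeight (fun t x => S.Q t x i j) (fun l t x => S.DQ l t x i j) t :=
    fun _ _ => ladyWeight_nonneg _ _ _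
  have p4 : ∀ i j, 0 ≤ n2 (fun x => S.Q t x i j) * n2 (fun x => S.Q t x i j) := fun _ _ =>
    mul_self_nonneg _
  have p5 : ∀ k i j, 0 ≤ n2 (fun x => S.D2Q k k t x i j) * n2 (fun x => S.D2Q k k t x i j) :=
    fun _ _ _ => mul_self_nonneg _
  have s1 := Finset.sum_nonneg fun α (_ : α ∈ Finset.univ) => p1 α
  have s2 := Finset.sum_nonneg fun k (_ : k ∈ Finset.univ) =>
    Finset.sum_nonneg fun i (_ : i ∈ Finset.univ) =>
      Finset.sum_nonneg fun j (_ : j ∈ Finset.univ) => p2 k i j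
  have s3 := Finset.sum_nonneg fun i (_ : i ∈ Finset.univ) =>
      Finset.sum_nonneg fun j (_ : j ∈ Finset.univ) => p3 i j
  have s4 := Finset.sum_nonneg fun i (_ : i ∈ Finset.univ) =>
      Finset.sum_nonneg fun j (_ : j ∈ Finset.univ) => p4 i j
  have s5 := Finset.sum_nonneg fun k (_ : k ∈ Finset.univ) =>
    Finset.sum_nonneg fun i (_ : i ∈ Finset.univ) =>
      Finset.sum_nonneg fun j (_ : j ∈ Finset.univ) => p5 k i j
  have two : ∀ {f : Fin N → Fin N → ℝ}, (∀ i j, 0 ≤ f i j) → ∀ i j, f i j ≤ ∑ i, ∑ j, f i j :=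
    fun {f} hf i j => (Finset.single_le_sum (fun j _ => hf i j) (Finset.mem_univ j)).trans
      (Finset.single_le_sum (f := fun i => ∑ j, f i j)
        (fun i _ => Finset.sum_nonneg fun j _ => hf i j) (Finset.mem_univ i))
  have three : ∀ {f : Fin 2 → Fin N → Fin N → ℝ}, (∀ k i j, 0 ≤ f k i j) →
      ∀ k i j, f k i j ≤ ∑ k, ∑ i, ∑ j, f k i j := fun {f} hf k i j =>
    (two (hf k) i j).trans (Finset.single_le_sum (f := fun k => ∑ i, ∑ j, f k i j)
      (fun k _ => Finset.sum_nonneg fun i _ => Finset.sum_nonneg fun j _ => hf k i j)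
      (Finset.mem_univ k))
  unfold weight
  refine ⟨by linarith, fun α => ?_, fun k i j => ?_, fun i j => ?_, fun i j => ?_, fun k i j => ?_⟩
  · linarith [Finset.single_le_sum (fun α _ => p1 α) (Finset.mem_univ α)]
  · linarith [three p2 k i j]
  · linarith [two p3 i j]
  · linarith [two p4 i j, sq (n2 fun x => S.Q t x i j)]
  · linarith [three p5 k i j, sq (n2 fun x => S.D2Q k k t x i j)]

end WeakFlow

theorem integral_mul_self_eq {f : Plane → ℝ} (hf : MemLp f 2 (volume : Measure Plane)) :
    ∫ x, f x * f x = n2 f ^ 2 := by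
  have h : inner ℝ (hf.toLp f) (hf.toLp f) = ∫ x, f x * f x := by
    rw [inner_L2R]
    refine integral_congr_ae ?_
    filter_upwards [hf.coeFn_toLp] with x hx
    rw [hx]
  rw [← h, real_inner_self_eq_norm_sq, Lp.norm_toLp, n2]

/-! ### The energy balance for the difference of two solutions -/

namespace WeakFlow

variable {N : ℕ} (S₁ S₂ : WeakFlow N)

/-- The entries of the difference of the tensors of two solutions. -/
def tenDiff (i j : Fin N) (t : ℝ) (x : Plane) : ℝ := S₁.Q t x i j - S₂.Q t x i j

/-- The first derivatives of `tenDiff`. -/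
def tenDiffD (k : Fin 2) (i j : Fin N) (t : ℝ) (x : Plane) : ℝ := S₁.DQ k t x i j - S₂.DQ k t x i j

/-- The second derivatives of `tenDiff`. -/
def tenDiffDD (k l : Fin 2) (i j : Fin N) (t : ℝ) (x : Plane) : ℝ :=
  S₁.D2Q k l t x i j - S₂.D2Q k l t x i j

/-- The gradient `∂_β w_α` of `w = (1 - Δ)⁻¹ (u₁ - u₂)`. -/
def resGrad (α β : Fin 2) (t : ℝ) : L2R := res (path (gradDiff S₁ S₂ α β) t)

/-- The second derivatives `∂_k ∂_β w_α` of `w = (1 - Δ)⁻¹ (u₁ - u₂)`. -/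
def resGradD (k α β : Fin 2) (t : ℝ) : L2R := resD k (path (gradDiff S₁ S₂ α β) t)

/-- Dissipation, energy and Gronwall coefficient of a pair of solutions. -/
def scale : Scale where
  d t := (∑ k, ∑ i, ∑ j, n2 (tenDiffD S₁ S₂ k i j t) ^ 2)
    + ∑ α, ∑ β, (‖resGrad S₁ S₂ α β t‖ ^ 2 + ∑ k, ‖resGradD S₁ S₂ k α β t‖ ^ 2)
  e t := (∑ i, ∑ j, n2 (tenDiff S₁ S₂ i j t) ^ 2)
    + ∑ α, (‖res (path (velDiff S₁ S₂ α) t)‖ ^ 2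
      + ∑ β, ‖resD β (path (velDiff S₁ S₂ α) t)‖ ^ 2)
  a t := 1 + S₁.weight t + S₂.weight t
  d_nonneg t := by positivity
  e_nonneg t := by positivity
  one_le_a t := by linarith [(S₁.weight_bounds t).1, (S₂.weight_bounds t).1]

theorem ae_memH1_tenDiff : ∀ᵐ t ∂timeMeasure, ∀ i j,
    MemH1 (tenDiff S₁ S₂ i j t) (fun k => tenDiffD S₁ S₂ k i j t) := by
  filter_upwards [S₁.ae_memH1_Q, S₂.ae_memH1_Q] with t h1 h2 i j using (h1 i j).sub (h2 i j)

theorem ae_memH1_tenDiffD : ∀ᵐ t ∂timeMeasure, ∀ k i j,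
    MemH1 (tenDiffD S₁ S₂ k i j t) (fun l => tenDiffDD S₁ S₂ k l i j t) := by
  filter_upwards [S₁.ae_memH1_DQ, S₂.ae_memH1_DQ] with t h1 h2 k i j
    using (h1 k i j).sub (h2 k i j)

/-- The resolvent commutes with the derivatives of `u₁ - u₂`. -/
theorem ae_resD_velDiff : ∀ᵐ t ∂timeMeasure, ∀ α β,
    resD β (path (velDiff S₁ S₂ α) t) = resGrad S₁ S₂ α β t ∧
      resDD β β (path (velDiff S₁ S₂ α) t) = resGradD S₁ S₂ β α β t := by
  filter_upwards [ae_memH1_velDiff S₁ S₂] with t h α β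
  have hw : HasWeakPartial β (path (velDiff S₁ S₂ α) t) (path (gradDiff S₁ S₂ α β) t) := by
    rw [path_eq (h α).memLp, path_eq ((h α).memLp_grad β)]
    exact ((h α).weak β).toLp (h α).memLp ((h α).memLp_grad β)
  exact ⟨(res_weakPartial hw).symm, (resD_weakPartial hw).symm⟩

theorem single_le_sum₂ {ι κ : Type*} [Fintype ι] [Fintype κ] {f : ι → κ → ℝ}
    (hf : ∀ i j, 0 ≤ f i j) (i : ι) (j : κ) : f i j ≤ ∑ i, ∑ j, f i j :=
  (Finset.single_le_sum (fun j _ => hf i j) (Finset.mem_univ j)).trans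
    (Finset.single_le_sum (f := fun i => ∑ j, f i j)
      (fun i _ => Finset.sum_nonneg fun j _ => hf i j) (Finset.mem_univ i))

theorem scale_bounds (t : ℝ) :
    (∀ k i j, n2 (tenDiffD S₁ S₂ k i j t) ^ 2 ≤ (scale S₁ S₂).d t)
    ∧ (∀ α β k, ‖resGradD S₁ S₂ k α β t‖ ^ 2 ≤ (scale S₁ S₂).d t)
    ∧ (∀ i j, n2 (tenDiff S₁ S₂ i j t) ^ 2 ≤ (scale S₁ S₂).e t)
    ∧ (∀ α, ‖res (path (velDiff S₁ S₂ α) t)‖ ^ 2 ≤ (scale S₁ S₂).e t)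
    ∧ ∀ α β, ‖resD β (path (velDiff S₁ S₂ α) t)‖ ^ 2 ≤ (scale S₁ S₂).e t := by
  have p1 : 0 ≤ ∑ k, ∑ i, ∑ j, n2 (tenDiffD S₁ S₂ k i j t) ^ 2 := by positivity
  have p2 : 0 ≤ ∑ α, ∑ β, (‖resGrad S₁ S₂ α β t‖ ^ 2
    + ∑ k, ‖resGradD S₁ S₂ k α β t‖ ^ 2) := by positivity
  have p3 : 0 ≤ ∑ i, ∑ j, n2 (tenDiff S₁ S₂ i j t) ^ 2 := by positivity
  have p4 : 0 ≤ ∑ α, (‖res (path (velDiff S₁ S₂ α) t)‖ ^ 2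
      + ∑ β, ‖resD β (path (velDiff S₁ S₂ α) t)‖ ^ 2) := by positivity
  have q : ∀ α, ‖res (path (velDiff S₁ S₂ α) t)‖ ^ 2
      + ∑ β, ‖resD β (path (velDiff S₁ S₂ α) t)‖ ^ 2
      ≤ ∑ α, (‖res (path (velDiff S₁ S₂ α) t)‖ ^ 2
        + ∑ β, ‖resD β (path (velDiff S₁ S₂ α) t)‖ ^ 2) := fun α =>
    Finset.single_le_sum (f := fun α => ‖res (path (velDiff S₁ S₂ α) t)‖ ^ 2
        + ∑ β, ‖resD β (path (velDiff S₁ S₂ α) t)‖ ^ 2) (fun α _ => by positivity)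
      (Finset.mem_univ α)
  unfold scale
  refine ⟨fun k i j => ?_, fun α β k => ?_, fun i j => ?_, fun α => ?_, fun α β => ?_⟩
  · have h1 := single_le_sum₂ (f := fun i j => n2 (tenDiffD S₁ S₂ k i j t) ^ 2)
      (fun i j => sq_nonneg _) i j
    have h2 := Finset.single_le_sum (f := fun k => ∑ i, ∑ j, n2 (tenDiffD S₁ S₂ k i j t) ^ 2)
      (fun k _ => by positivity) (Finset.mem_univ k)
    simp only at h1 h2 ⊢
    linarith
  · have h1 := single_le_sum₂ (f := fun α β => ‖resGrad S₁ S₂ α β t‖ ^ 2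
      + ∑ k, ‖resGradD S₁ S₂ k α β t‖ ^ 2) (fun α β => by positivity) α β
    have h2 := Finset.single_le_sum (f := fun k => ‖resGradD S₁ S₂ k α β t‖ ^ 2)
      (fun k _ => by positivity) (Finset.mem_univ k)
    simp only at h1 h2 ⊢
    linarith [sq_nonneg ‖resGrad S₁ S₂ α β t‖]
  · have h1 := single_le_sum₂ (f := fun i j => n2 (tenDiff S₁ S₂ i j t) ^ 2)
      (fun i j => sq_nonneg _) i j
    simp only at h1 ⊢
    linarith
  · have h1 := q α
    have h2 : 0 ≤ ∑ β, ‖resD β (path (velDiff S₁ S₂ α) t)‖ ^ 2 := by positivity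
    simp only
    linarith
  · have h1 := q α
    have h2 := Finset.single_le_sum (f := fun β => ‖resD β (path (velDiff S₁ S₂ α) t)‖ ^ 2)
      (fun k _ => by positivity) (Finset.mem_univ β)
    simp only at h2 ⊢
    linarith [sq_nonneg ‖res (path (velDiff S₁ S₂ α) t)‖]

theorem energy_tenDiff (i j : Fin N) : (scale S₁ S₂).Energy (tenDiff S₁ S₂ i j) := by
  refine Scale.energy_of_memH1 (Dg := fun k => tenDiffD S₁ S₂ k i j) (C := 1) zero_le_one ?_
  filter_upwards [ae_memH1_tenDiff S₁ S₂] with t h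
  have hb := scale_bounds S₁ S₂ t
  exact ⟨h i j, by rw [one_mul]; exact hb.2.2.1 i j, fun k => by rw [one_mul]; exact hb.1 k i j⟩

theorem energy_resGrad (α β : Fin 2) :
    (scale S₁ S₂).Energy (fun t x => resGrad S₁ S₂ α β t x) := by
  refine Scale.energy_of_memH1 (Dg := fun k t x => resGradD S₁ S₂ k α β t x) (C := 1)
    zero_le_one ?_
  filter_upwards [ae_resD_velDiff S₁ S₂] with t h
  have hb := scale_bounds S₁ S₂ t
  refine ⟨memH1_res _, ?_, fun k => ?_⟩
  · rw [one_mul]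
    change ‖resGrad S₁ S₂ α β t‖ ^ 2 ≤ _
    rw [← (h α β).1]
    exact hb.2.2.2.2 α β
  · rw [one_mul]
    exact hb.2.1 α β k

theorem dissip_tenDiffD (k : Fin 2) (i j : Fin N) :
    (scale S₁ S₂).Dissip (tenDiffD S₁ S₂ k i j) := by
  refine ⟨1, zero_le_one, ?_⟩
  filter_upwards [ae_memH1_tenDiff S₁ S₂] with t h
  have hb := scale_bounds S₁ S₂ t
  have := (scale S₁ S₂).e_nonneg t
  exact ⟨(h i j).memLp_grad k, by linarith [hb.1 k i j]⟩

theorem dissip_resGradD (k α β : Fin 2) :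
    (scale S₁ S₂).Dissip (fun t x => resGradD S₁ S₂ k α β t x) := by
  refine ⟨1, zero_le_one, .of_forall fun t => ⟨Lp.memLp _, ?_⟩⟩
  have hb := scale_bounds S₁ S₂ t
  have := (scale S₁ S₂).e_nonneg t
  change ‖resGradD S₁ S₂ k α β t‖ ^ 2 ≤ _
  linarith [hb.2.1 α β k]

theorem dissip_velDiff (α : Fin 2) : (scale S₁ S₂).Dissip (velDiff S₁ S₂ α) := by
  refine ⟨9, by norm_num, ?_⟩
  filter_upwards [(inL1L2_velDiff S₁ S₂ α).memLp, ae_resD_velDiff S₁ S₂] with t h1 h2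
  refine ⟨h1, ?_⟩
  have hb := scale_bounds S₁ S₂ t
  have he := (scale S₁ S₂).e_nonneg t
  have hd := (scale S₁ S₂).d_nonneg t
  have hv := res_sub_laplacian (path (velDiff S₁ S₂ α) t)
  simp only [(h2 α _).2, Fin.sum_univ_two] at hv
  have hn := norm_sub_le (res (path (velDiff S₁ S₂ α) t))
    (resGradD S₁ S₂ 0 α 0 t + resGradD S₁ S₂ 1 α 1 t)
  rw [hv, norm_path h1] at hn
  have hn2 := norm_add_le (resGradD S₁ S₂ 0 α 0 t) (resGradD S₁ S₂ 1 α 1 t)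
  have b1 := hb.2.2.2.1 α
  have b2 := hb.2.1 α 0 0
  have b3 := hb.2.1 α 1 1
  have hle := hn.trans (add_le_add le_rfl hn2)
  have h0 := n2_nonneg (velDiff S₁ S₂ α t)
  calc n2 (velDiff S₁ S₂ α t) ^ 2 ≤ (‖res (path (velDiff S₁ S₂ α) t)‖
        + (‖resGradD S₁ S₂ 0 α 0 t‖ + ‖resGradD S₁ S₂ 1 α 1 t‖)) ^ 2 := by gcongr
    _ ≤ 2 * (‖res (path (velDiff S₁ S₂ α) t)‖ ^ 2
        + 2 * (‖resGradD S₁ S₂ 0 α 0 t‖ ^ 2 + ‖resGradD S₁ S₂ 1 α 1 t‖ ^ 2)) :=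
      add_sq_le.trans (by gcongr; exact add_sq_le)
    _ ≤ _ := by linarith

/-- The bounds on the coefficients, for either solution. -/
theorem coef_bounds {S : WeakFlow N} {s : Scale} (h : ∀ t, S.weight t ≤ s.a t) :
    (∀ α, s.Coef4 fun t x => S.u t x α) ∧ (∀ k i j, s.Coef4 fun t x => S.DQ k t x i j)
    ∧ (∀ i j, s.Coef4 fun t x => S.Q t x i j) ∧ (∀ i j, s.Coef2 fun t x => S.Q t x i j)
    ∧ ∀ i j, s.Coef2 fun t x => lap S.D2Q t x i j := by
  obtain ⟨K, hK, hlad⟩ := Scale.exists_ladyWeight_bound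
  refine ⟨fun α => ⟨K, hK, ?_⟩, fun k i j => ⟨K, hK, ?_⟩, fun i j => ⟨K, hK, ?_⟩,
    fun i j => ⟨1, zero_le_one, ?_⟩, fun i j => ?_⟩
  · filter_upwards [S.ae_memH1_u] with t ht
    exact ⟨(ht α).memLp_four, (hlad (f := fun t x => S.u t x α)
      (Df := fun β t x => S.Du t x α β) (ht α)).trans
      (mul_le_mul_of_nonneg_left (((S.weight_bounds t).2.1 α).trans (h t)) hK)⟩
  · filter_upwards [S.ae_memH1_DQ] with t ht
    exact ⟨(ht k i j).memLp_four, (hlad (f := fun t x => S.DQ k t x i j)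
      (Df := fun l t x => S.D2Q k l t x i j) (ht k i j)).trans
      (mul_le_mul_of_nonneg_left (((S.weight_bounds t).2.2.1 k i j).trans (h t)) hK)⟩
  · filter_upwards [S.ae_memH1_Q] with t ht
    exact ⟨(ht i j).memLp_four, (hlad (f := fun t x => S.Q t x i j)
      (Df := fun l t x => S.DQ l t x i j) (ht i j)).trans
      (mul_le_mul_of_nonneg_left (((S.weight_bounds t).2.2.2.1 i j).trans (h t)) hK)⟩
  · filter_upwards [S.ae_memH1_Q] with t ht
    rw [one_mul]
    exact ⟨(ht i j).memLp, ((S.weight_bounds t).2.2.2.2.1 i j).trans (h t)⟩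
  · have hk : ∀ k, s.Coef2 fun t x => S.D2Q k k t x i j := by
      intro k
      refine ⟨1, zero_le_one, ?_⟩
      filter_upwards [S.ae_memH1_DQ] with t ht
      rw [one_mul]
      exact ⟨(ht k i j).memLp_grad k, ((S.weight_bounds t).2.2.2.2.2 k i j).trans (h t)⟩
    simp only [lap, Matrix.sum_apply, Fin.sum_univ_two]
    exact (hk 0).add (hk 1)

theorem weight_le_scale (t : ℝ) :
    S₁.weight t ≤ (scale S₁ S₂).a t ∧ S₂.weight t ≤ (scale S₁ S₂).a t := by
  have h1 := (S₁.weight_bounds t).1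
  have h2 := (S₂.weight_bounds t).1
  unfold scale
  constructor <;> (simp only; linarith)

end WeakFlow

namespace WeakFlow

variable {N : ℕ} (S₁ S₂ : WeakFlow N)

/-- All coefficients that involve the first solution are bounded by the Gronwall coefficient. -/
theorem coef_bounds_left : (∀ α, (scale S₁ S₂).Coef4 fun t x => S₁.u t x α)
    ∧ (∀ k i j, (scale S₁ S₂).Coef4 fun t x => S₁.DQ k t x i j)
    ∧ (∀ i j, (scale S₁ S₂).Coef4 fun t x => S₁.Q t x i j)
    ∧ (∀ i j, (scale S₁ S₂).Coef2 fun t x => S₁.Q t x i j)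
    ∧ ∀ i j, (scale S₁ S₂).Coef2 fun t x => lap S₁.D2Q t x i j :=
  coef_bounds fun t => (weight_le_scale S₁ S₂ t).1

/-- All coefficients that involve the second solution are bounded by the Gronwall coefficient. -/
theorem coef_bounds_right : (∀ α, (scale S₁ S₂).Coef4 fun t x => S₂.u t x α)
    ∧ (∀ k i j, (scale S₁ S₂).Coef4 fun t x => S₂.DQ k t x i j)
    ∧ (∀ i j, (scale S₁ S₂).Coef4 fun t x => S₂.Q t x i j)
    ∧ (∀ i j, (scale S₁ S₂).Coef2 fun t x => S₂.Q t x i j)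
    ∧ ∀ i j, (scale S₁ S₂).Coef2 fun t x => lap S₂.D2Q t x i j :=
  coef_bounds fun t => (weight_le_scale S₁ S₂ t).2

/-- The transport terms; the part in which `R` is transported by `u₁` drops out. -/
theorem ctrl_transport : (scale S₁ S₂).Ctrl fun t x =>
    frob (S₁.transport t x - S₂.transport t x) (S₁.Q t x - S₂.Q t x) := by
  have h1 : ∀ i j, (scale S₁ S₂).Ctrl fun t x =>
      ∑ k, tenDiffD S₁ S₂ k i j t x * S₁.u t x k * tenDiff S₁ S₂ i j t x := by
    intro i j
    refine Scale.ctrl_zero.of_integral_eq ?_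
    filter_upwards [ae_memH1_tenDiff S₁ S₂, S₁.ae_memH1_u, S₁.ae_div] with t m1 m2 m3
    have i1 : ∀ k, Integrable (fun x => tenDiffD S₁ S₂ k i j t x * S₁.u t x k *
        tenDiff S₁ S₂ i j t x) volume := fun k =>
      integrable_mul_mul ((m1 i j).memLp_grad k) (m2 k).memLp_four (m1 i j).memLp_four
    have hz := integral_transport_add_eq_zero m2 m3 (m1 i j) (m1 i j)
    have e : ∀ x, ∑ k, (tenDiffD S₁ S₂ k i j t x * S₁.u t x k * tenDiff S₁ S₂ i j t x
        + tenDiffD S₁ S₂ k i j t x * tenDiff S₁ S₂ i j t x * S₁.u t x k)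
        = 2 * ∑ k, tenDiffD S₁ S₂ k i j t x * S₁.u t x k * tenDiff S₁ S₂ i j t x := by
      intro x
      rw [Finset.mul_sum]
      exact Finset.sum_congr rfl fun k _ => by ring
    simp only [e] at hz
    rw [integral_const_mul] at hz
    refine ⟨integrable_finsetSum _ fun k _ => i1 k, ?_⟩
    rw [integral_zero]
    linarith
  have h2 : ∀ i j, (scale S₁ S₂).Ctrl fun t x =>
      ∑ k, velDiff S₁ S₂ k t x * tenDiff S₁ S₂ i j t x * S₂.DQ k t x i j := fun i j =>
    Scale.Ctrl.sum _ fun k _ => (dissip_velDiff S₁ S₂ k).ctrl (energy_tenDiff S₁ S₂ i j)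
      ((coef_bounds_right S₁ S₂).2.1 k i j)
  have h3 := Scale.Ctrl.sum Finset.univ fun i _ => Scale.Ctrl.sum Finset.univ fun j _ =>
    (h1 i j).add (h2 i j)
  refine h3.congr (.of_forall fun t => .of_forall fun x => ?_)
  refine Finset.sum_congr rfl fun i _ => Finset.sum_congr rfl fun j _ => ?_
  simp only [transport, Matrix.sub_apply, Matrix.sum_apply, Matrix.smul_apply, smul_eq_mul,
    tenDiff, tenDiffD, velDiff]
  simp only [Fin.sum_univ_two]
  ring

/-- `A² - B² = (A - B) A + B (A - B)`, entrywise. -/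
theorem mul_self_sub_apply (A B : Mat N) (i j : Fin N) :
    (A * A) i j - (B * B) i j = ∑ m, ((A - B) i m * A m j + B i m * (A - B) m j) := by
  simp only [Matrix.mul_apply, ← Finset.sum_sub_distrib, Matrix.sub_apply]
  exact Finset.sum_congr rfl fun m _ => by ring

/-- The terms of order zero. -/
theorem ctrl_bulk (a b c : ℝ) : (scale S₁ S₂).Ctrl fun t x =>
    frob (bulk a b c (S₁.Q t x) - bulk a b c (S₂.Q t x)) (S₁.Q t x - S₂.Q t x) := by
  obtain ⟨-, -, h14, h12, -⟩ := coef_bounds_left S₁ S₂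
  obtain ⟨-, -, h24, h22, -⟩ := coef_bounds_right S₁ S₂
  have hR := energy_tenDiff S₁ S₂
  have hM : ∀ i j k l, (scale S₁ S₂).Ctrl fun t x =>
      ((S₁.Q t x * S₁.Q t x) i j - (S₂.Q t x * S₂.Q t x) i j) * tenDiff S₁ S₂ k l t x := by
    intro i j k l
    refine (Scale.Ctrl.sum Finset.univ fun m _ => ((h12 m j).ctrl (hR i m) (hR k l)).add
      ((h22 i m).ctrl (hR m j) (hR k l))).congr (.of_forall fun t => .of_forall fun x => ?_)
    rw [mul_self_sub_apply, Finset.sum_mul]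
    refine Finset.sum_congr rfl fun m _ => ?_
    simp only [tenDiff, Matrix.sub_apply]
    ring
  have hM2 : ∀ i j k l, (scale S₁ S₂).Ctrl fun t x =>
      ((S₁.Q t x * S₁.Q t x) i j - (S₂.Q t x * S₂.Q t x) i j) * S₂.Q t x k l
        * tenDiff S₁ S₂ k l t x := by
    intro i j k l
    refine (Scale.Ctrl.sum Finset.univ fun m _ =>
      (((h14 m j).mul (h24 k l)).ctrl (hR i m) (hR k l)).add
      (((h24 i m).mul (h24 k l)).ctrl (hR m j) (hR k l))).congr
      (.of_forall fun t => .of_forall fun x => ?_)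
    rw [mul_self_sub_apply, Finset.sum_mul, Finset.sum_mul]
    refine Finset.sum_congr rfl fun m _ => ?_
    simp only [tenDiff, Matrix.sub_apply]
    ring
  have hT : ∀ k l, (scale S₁ S₂).Ctrl fun t x =>
      (S₁.Q t x * S₁.Q t x).trace * tenDiff S₁ S₂ k l t x * tenDiff S₁ S₂ k l t x := by
    intro k l
    refine (Scale.Ctrl.sum Finset.univ fun i _ => Scale.Ctrl.sum Finset.univ fun m _ =>
      ((h14 i m).mul (h14 m i)).ctrl (hR k l) (hR k l)).congr
      (.of_forall fun t => .of_forall fun x => ?_)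
    simp only [Matrix.trace, Matrix.diag_apply, Matrix.mul_apply, Finset.sum_mul]
  have h := Scale.Ctrl.sum Finset.univ fun i _ => Scale.Ctrl.sum Finset.univ fun j _ =>
    ((((hR i j).ctrl (hR i j)).const_mul (-a)).add (((hM i j i j).sub
      ((Scale.Ctrl.sum Finset.univ fun k _ => hM k k i j).const_mul
        ((1 : Mat N) i j / 2))).const_mul b)).sub
          (((hT i j).add (Scale.Ctrl.sum Finset.univ fun k _ => hM2 k k i j)).const_mul c)
  refine h.congr (.of_forall fun t => .of_forall fun x => ?_)
  refine Finset.sum_congr rfl fun i _ => Finset.sum_congr rfl fun j _ => ?_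
  simp only [bulk, Matrix.sub_apply, Matrix.add_apply, Matrix.neg_apply, Matrix.smul_apply,
    smul_eq_mul, tenDiff, ← Finset.sum_mul, Finset.sum_sub_distrib, Matrix.trace, Matrix.diag_apply]
  ring

/-- The convective part of the stress. -/
theorem ctrl_convective (α β : Fin 2) : (scale S₁ S₂).Ctrl fun t x =>
    (S₁.u t x α * S₁.u t x β - S₂.u t x α * S₂.u t x β) * resGrad S₁ S₂ α β t x := by
  refine (((dissip_velDiff S₁ S₂ α).ctrl (energy_resGrad S₁ S₂ α β)
    ((coef_bounds_left S₁ S₂).1 β)).add ((dissip_velDiff S₁ S₂ β).ctrl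
    (energy_resGrad S₁ S₂ α β) ((coef_bounds_right S₁ S₂).1 α))).congr
    (.of_forall fun t => .of_forall fun x => ?_)
  simp only [velDiff]
  ring

/-- The part `∇Q ⊙ ∇Q` of the stress. -/
theorem ctrl_ericksen (α β : Fin 2) : (scale S₁ S₂).Ctrl fun t x =>
    ((∑ i, ∑ j, S₁.DQ α t x i j * S₁.DQ β t x i j) - ∑ i, ∑ j, S₂.DQ α t x i j * S₂.DQ β t x i j)
      * resGrad S₁ S₂ α β t x := by
  refine (Scale.Ctrl.sum Finset.univ fun i _ => Scale.Ctrl.sum Finset.univ fun j _ =>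
    ((dissip_tenDiffD S₁ S₂ α i j).ctrl (energy_resGrad S₁ S₂ α β)
    ((coef_bounds_left S₁ S₂).2.1 β i j)).add ((dissip_tenDiffD S₁ S₂ β i j).ctrl
    (energy_resGrad S₁ S₂ α β) ((coef_bounds_right S₁ S₂).2.1 α i j))).congr
    (.of_forall fun t => .of_forall fun x => ?_)
  simp only [← Finset.sum_sub_distrib, Finset.sum_mul]
  refine Finset.sum_congr rfl fun i _ => Finset.sum_congr rfl fun j _ => ?_
  simp only [tenDiffD]
  ring

/-- `[A, B] = AB - BA`. -/
def comm (A B : Mat N) : Mat N := A * B - B * A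

/-- The terms `[R, ΔQ₁] : ∇w`. -/
theorem ctrl_comm_lap (α β : Fin 2) (i j : Fin N) : (scale S₁ S₂).Ctrl fun t x =>
    comm (S₁.Q t x - S₂.Q t x) (lap S₁.D2Q t x) i j * resGrad S₁ S₂ α β t x := by
  have hl := (coef_bounds_left S₁ S₂).2.2.2.2
  have hR := energy_tenDiff S₁ S₂
  have hw := energy_resGrad S₁ S₂ α β
  refine (Scale.Ctrl.sum Finset.univ fun m _ => ((hl m j).ctrl (hR i m) hw).sub
    ((hl i m).ctrl (hR m j) hw)).congr (.of_forall fun t => .of_forall fun x => ?_)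
  simp only [comm, Matrix.sub_apply, Matrix.mul_apply, ← Finset.sum_sub_distrib, Finset.sum_mul]
  refine Finset.sum_congr rfl fun m _ => ?_
  simp only [tenDiff]
  ring

/-- The terms `[Q₂, ΔR] : ∇w` cannot be estimated by themselves. After integration by parts and
`-Δ∇w = ∇(u₁ - u₂) - ∇w` they produce the terms `[Q₂, R] : ∇(u₁ - u₂)`, which cancel in the energy
balance. -/
theorem ctrl_laplacian (α β : Fin 2) (i j k l : Fin N) : (scale S₁ S₂).Ctrl fun t x =>
    (∑ q, tenDiffDD S₁ S₂ q q i j t x) * resGrad S₁ S₂ α β t x * S₂.Q t x k l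
      + path (gradDiff S₁ S₂ α β) t x * tenDiff S₁ S₂ i j t x * S₂.Q t x k l := by
  have hR := energy_tenDiff S₁ S₂ i j
  have hw := energy_resGrad S₁ S₂ α β
  obtain ⟨-, hD, -, hQ, -⟩ := coef_bounds_right S₁ S₂
  refine ((hQ k l).ctrl hR hw |>.add (Scale.Ctrl.sum Finset.univ fun q _ =>
    ((dissip_resGradD S₁ S₂ q α β).ctrl hR (hD q k l)).sub
    ((dissip_tenDiffD S₁ S₂ q i j).ctrl hw (hD q k l)))).of_integral_eq ?_
  filter_upwards [ae_memH1_tenDiff S₁ S₂, ae_memH1_tenDiffD S₁ S₂, S₂.ae_memH1_Q]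
    with t m1 m2 m3
  refine ⟨?_, integral_laplacian_mul_res (m1 i j) (fun q => m2 q i j) (m3 k l)
    (path (gradDiff S₁ S₂ α β) t)⟩
  refine Integrable.add ?_ ?_
  · simp only [Finset.sum_mul]
    exact integrable_finsetSum _ fun q _ => integrable_mul_mul ((m2 q i j).memLp_grad q)
      (memH1_res _).memLp_four (m3 k l).memLp_four
  · exact integrable_mul_mul (Lp.memLp _) (m1 i j).memLp_four (m3 k l).memLp_four

/-- `ctrl_laplacian` for commutators. -/
theorem ctrl_comm_laplacian (α β : Fin 2) (i j : Fin N) : (scale S₁ S₂).Ctrl fun t x =>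
    comm (S₂.Q t x) (lap S₁.D2Q t x - lap S₂.D2Q t x) i j * resGrad S₁ S₂ α β t x
      + comm (S₂.Q t x) (S₁.Q t x - S₂.Q t x) i j * path (gradDiff S₁ S₂ α β) t x := by
  refine (Scale.Ctrl.sum Finset.univ fun m _ => (ctrl_laplacian S₁ S₂ α β m j i m).sub
    (ctrl_laplacian S₁ S₂ α β i m m j)).congr (.of_forall fun t => .of_forall fun x => ?_)
  simp only [comm, Matrix.sub_apply, Matrix.mul_apply, ← Finset.sum_sub_distrib, Finset.sum_mul,
    ← Finset.sum_add_distrib]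
  refine Finset.sum_congr rfl fun m _ => ?_
  simp only [tenDiff, tenDiffDD, lap, Matrix.sum_apply, Fin.sum_univ_two]
  ring

end WeakFlow

/-! ### The cancellation between the two equations -/

theorem frob_add_left {N : ℕ} (A B C : Mat N) : frob (A + B) C = frob A C + frob B C := by
  simp only [frob, Matrix.add_apply, add_mul, Finset.sum_add_distrib]

theorem frob_sub_left {N : ℕ} (A B C : Mat N) : frob (A - B) C = frob A C - frob B C := by
  simp only [frob, Matrix.sub_apply, sub_mul, Finset.sum_sub_distrib]

theorem frob_smul_left {N : ℕ} (r : ℝ) (A C : Mat N) : frob (r • A) C = r * frob A C := by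
  simp only [frob, Matrix.smul_apply, smul_eq_mul, Finset.mul_sum, mul_assoc]

theorem frob_eq_trace {N : ℕ} (A B : Mat N) : frob A B = (A * B.transpose).trace := by
  simp only [frob, Matrix.trace, Matrix.diag_apply, Matrix.mul_apply, Matrix.transpose_apply]

theorem pad_vorticity {N : ℕ} (Du : ℝ → Plane → Mat 2) (t : ℝ) (x : Plane) :
    pad N (vorticity Du t x) = (1 / 2 : ℝ) • (pad N (Du t x) - (pad N (Du t x)).transpose) := by
  ext i j
  simp only [pad, vorticity, Matrix.smul_apply, Matrix.sub_apply, Matrix.transpose_apply,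
    smul_eq_mul]
  split_ifs with h h' h'
  · rfl
  · exact absurd h.symm h'
  · exact absurd h'.symm h
  · ring

theorem pad_sub {N : ℕ} (A B : Mat 2) : pad N (A - B) = pad N A - pad N B := by
  ext i j
  simp only [pad, Matrix.sub_apply]
  split_ifs <;> simp

namespace WeakFlow

variable {N : ℕ}

theorem frob_comm_self (A : Mat N) {R : Mat N} (hR : R.IsSymm) : frob (comm A R) R = 0 := by
  rw [frob_eq_trace, comm, hR.eq, sub_mul, Matrix.trace_sub, Matrix.trace_mul_comm (A * R),
    mul_assoc, sub_self]

/-- The corotational terms of the `Q`-equation and the antisymmetric stress are adjoint. -/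
theorem frob_comm_antisymm {Q R : Mat N} (hQ : Q.IsSymm) (hR : R.IsSymm) (P : Mat N) :
    frob (comm ((1 / 2 : ℝ) • (P - P.transpose)) Q) R = -frob (comm Q R) P := by
  have h1 : (P.transpose * Q * R).trace = (R * Q * P).trace := by
    rw [← Matrix.trace_transpose]
    simp only [Matrix.transpose_mul, Matrix.transpose_transpose, hQ.eq, hR.eq, mul_assoc]
  have h2 : (Q * P.transpose * R).trace = (R * P * Q).trace := by
    rw [← Matrix.trace_transpose]
    simp only [Matrix.transpose_mul, Matrix.transpose_transpose, hQ.eq, hR.eq, mul_assoc]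
  have h3 : (Q * R * P.transpose).trace = (P * R * Q).trace := by
    rw [← Matrix.trace_transpose]
    simp only [Matrix.transpose_mul, Matrix.transpose_transpose, hQ.eq, hR.eq, mul_assoc]
  have h4 : (R * Q * P.transpose).trace = (P * Q * R).trace := by
    rw [← Matrix.trace_transpose]
    simp only [Matrix.transpose_mul, Matrix.transpose_transpose, hQ.eq, hR.eq, mul_assoc]
  have c1 : (R * Q * P).trace = (P * R * Q).trace := by
    rw [Matrix.trace_mul_comm, mul_assoc]
  have c2 : (R * P * Q).trace = (P * Q * R).trace := by
    rw [mul_assoc, Matrix.trace_mul_comm]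
  have c3 : (Q * P * R).trace = (P * R * Q).trace := by
    rw [mul_assoc, Matrix.trace_mul_comm]
  rw [frob_eq_trace, frob_eq_trace]
  simp only [comm, sub_mul, mul_sub, smul_mul_assoc, mul_smul_comm, Matrix.trace_sub,
    Matrix.trace_smul, hR.eq, smul_eq_mul, h1, h2, h3, h4, c1, c2, c3]
  ring

variable (S₁ S₂ : WeakFlow N)

/-- The space density of the right-hand side of the energy balance. -/
def balance (a b c Γ L ν : ℝ) (t : ℝ) (x : Plane) : ℝ :=
  L * frob (S₁.force a b c Γ L t x - S₂.force a b c Γ L t x) (S₁.Q t x - S₂.Q t x)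
    + ∑ α, ∑ β, (S₁.stress L ν α β t x - S₂.stress L ν α β t x) * resGrad S₁ S₂ α β t x

/-- The part of `balance` that gives rise to the dissipation. -/
def principal (Γ L ν : ℝ) (t : ℝ) (x : Plane) : ℝ :=
  Γ * L ^ 2 * frob (lap S₁.D2Q t x - lap S₂.D2Q t x) (S₁.Q t x - S₂.Q t x)
    - ν * ∑ α, ∑ β, gradDiff S₁ S₂ α β t x * resGrad S₁ S₂ α β t x

theorem corot_eq (S : WeakFlow N) (t : ℝ) (x : Plane) :
    S.corot t x = comm (pad N (vorticity S.Du t x)) (S.Q t x) := rfl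

/-- With `R = Q₁ - Q₂`, the corotational terms are `[Ω₁, R] · R + [Ω₁ - Ω₂, Q₂] · R`. The first
vanishes and the second is the pairing of `∇(u₁ - u₂)` with `-[Q₂, R]`. -/
theorem frob_corot_sub {t : ℝ} {x : Plane} (h₁ : (S₁.Q t x).IsSymm) (h₂ : (S₂.Q t x).IsSymm) :
    frob (S₁.corot t x - S₂.corot t x) (S₁.Q t x - S₂.Q t x)
      = -∑ α, ∑ β, (∑ i, ∑ j, padCoef α β i j * comm (S₂.Q t x) (S₁.Q t x - S₂.Q t x) i j)
          * gradDiff S₁ S₂ α β t x := by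
  have hR := h₁.sub h₂
  have e : S₁.corot t x - S₂.corot t x
      = comm (pad N (vorticity S₁.Du t x)) (S₁.Q t x - S₂.Q t x)
        + comm ((1 / 2 : ℝ) • (pad N (S₁.Du t x - S₂.Du t x)
          - (pad N (S₁.Du t x - S₂.Du t x)).transpose)) (S₂.Q t x) := by
    have : (1 / 2 : ℝ) • (pad N (S₁.Du t x - S₂.Du t x)
        - (pad N (S₁.Du t x - S₂.Du t x)).transpose)
        = pad N (vorticity S₁.Du t x) - pad N (vorticity S₂.Du t x) := by
      rw [pad_vorticity, pad_vorticity, pad_sub, Matrix.transpose_sub, ← smul_sub]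
      congr 1
      abel
    rw [this, corot_eq, corot_eq]
    simp only [comm, mul_sub, sub_mul]
    abel
  rw [e, frob_add_left, frob_comm_self _ hR, frob_comm_antisymm h₂ hR, zero_add, frob, sum_mul_pad]
  rfl

/-- The stresses paired with `∇w`, where `w = (1 - Δ)⁻¹ (u₁ - u₂)`. The pairing of `[Q₂, R]` with
`∇(u₁ - u₂)` is subtracted and added, in order to combine `[Q₂, ΔR] : ∇w` with it as in
`ctrl_laplacian`. -/
theorem stress_sub_mul (L ν : ℝ) (α β : Fin 2) (t : ℝ) (x : Plane) :
    (S₁.stress L ν α β t x - S₂.stress L ν α β t x) * resGrad S₁ S₂ α β t x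
      = (S₁.u t x α * S₁.u t x β - S₂.u t x α * S₂.u t x β) * resGrad S₁ S₂ α β t x
        - ν * (gradDiff S₁ S₂ α β t x * resGrad S₁ S₂ α β t x)
        + L * (((∑ i, ∑ j, S₁.DQ α t x i j * S₁.DQ β t x i j)
          - ∑ i, ∑ j, S₂.DQ α t x i j * S₂.DQ β t x i j) * resGrad S₁ S₂ α β t x)
        - L * (∑ i, ∑ j, padCoef α β i j *
            (comm (S₁.Q t x - S₂.Q t x) (lap S₁.D2Q t x) i j * resGrad S₁ S₂ α β t x
            + (comm (S₂.Q t x) (lap S₁.D2Q t x - lap S₂.D2Q t x) i j * resGrad S₁ S₂ α β t x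
            + comm (S₂.Q t x) (S₁.Q t x - S₂.Q t x) i j * path (gradDiff S₁ S₂ α β) t x)))
        + L * ((∑ i, ∑ j, padCoef α β i j * comm (S₂.Q t x) (S₁.Q t x - S₂.Q t x) i j)
            * path (gradDiff S₁ S₂ α β) t x) := by
  have e : ∀ i j, S₁.elastic t x i j - S₂.elastic t x i j
      = comm (S₁.Q t x - S₂.Q t x) (lap S₁.D2Q t x) i j
        + comm (S₂.Q t x) (lap S₁.D2Q t x - lap S₂.D2Q t x) i j := by
    intro i j
    have hm : S₁.elastic t x - S₂.elastic t x
        = comm (S₁.Q t x - S₂.Q t x) (lap S₁.D2Q t x)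
          + comm (S₂.Q t x) (lap S₁.D2Q t x - lap S₂.D2Q t x) := by
      simp only [elastic, comm, mul_sub, sub_mul]
      abel
    exact congrFun (congrFun hm i) j
  have e2 : (∑ i, ∑ j, padCoef α β i j * S₁.elastic t x i j)
      - ∑ i, ∑ j, padCoef α β i j * S₂.elastic t x i j
      = (∑ i, ∑ j, padCoef α β i j * comm (S₁.Q t x - S₂.Q t x) (lap S₁.D2Q t x) i j)
        + ∑ i, ∑ j, padCoef α β i j * comm (S₂.Q t x) (lap S₁.D2Q t x - lap S₂.D2Q t x) i j := by
    simp only [← Finset.sum_sub_distrib, ← Finset.sum_add_distrib, ← mul_sub, e, mul_add]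
  simp only [mul_add (padCoef _ _ _ _), Finset.sum_add_distrib, ← mul_assoc, ← Finset.sum_mul]
  unfold stress gradDiff
  linear_combination (-L * resGrad S₁ S₂ α β t x) * e2

theorem frob_force_sub (a b c Γ L t : ℝ) (x : Plane) :
    frob (S₁.force a b c Γ L t x - S₂.force a b c Γ L t x) (S₁.Q t x - S₂.Q t x)
      = Γ * L * frob (lap S₁.D2Q t x - lap S₂.D2Q t x) (S₁.Q t x - S₂.Q t x)
        - frob (S₁.transport t x - S₂.transport t x) (S₁.Q t x - S₂.Q t x)
        + frob (S₁.corot t x - S₂.corot t x) (S₁.Q t x - S₂.Q t x)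
        + Γ * frob (bulk a b c (S₁.Q t x) - bulk a b c (S₂.Q t x)) (S₁.Q t x - S₂.Q t x) := by
  rw [← frob_smul_left, ← frob_smul_left, ← frob_sub_left, ← frob_add_left, ← frob_add_left]
  congr 1
  simp only [force, smul_sub]
  abel

/-- All terms of the energy balance other than the dissipation are controlled. The terms of highest
order, `[Ω₁ - Ω₂, Q₂] · R` and `[Q₂, R] : ∇(u₁ - u₂)`, cancel. -/
theorem ctrl_balance (a b c Γ L ν : ℝ) : (scale S₁ S₂).Ctrl fun t x =>
    balance S₁ S₂ a b c Γ L ν t x - principal S₁ S₂ Γ L ν t x := by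
  have h := (((ctrl_transport S₁ S₂).const_mul (-L)).add
    ((ctrl_bulk S₁ S₂ a b c).const_mul (L * Γ))).add
    (Scale.Ctrl.sum Finset.univ fun α _ => Scale.Ctrl.sum Finset.univ fun β _ =>
      ((ctrl_convective S₁ S₂ α β).add ((ctrl_ericksen S₁ S₂ α β).const_mul L)).sub
      ((Scale.Ctrl.sum Finset.univ fun i _ => Scale.Ctrl.sum Finset.univ fun j _ =>
        ((ctrl_comm_lap S₁ S₂ α β i j).add (ctrl_comm_laplacian S₁ S₂ α β i j)).const_mul
          (padCoef α β i j)).const_mul L))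
  refine h.congr ?_
  filter_upwards [S₁.hQ.qtensor, S₂.hQ.qtensor, ae_memH1_velDiff S₁ S₂] with t q1 q2 hv
  have hg : ∀ᵐ x, ∀ α β, path (gradDiff S₁ S₂ α β) t x = gradDiff S₁ S₂ α β t x :=
    ae_all_iff.2 fun α => ae_all_iff.2 fun β => coeFn_path ((hv α).memLp_grad β)
  filter_upwards [q1, q2, hg] with x s1 s2 g
  unfold balance principal
  rw [frob_force_sub, frob_corot_sub S₁ S₂ s1.1 s2.1]
  simp only [stress_sub_mul, g, Finset.sum_sub_distrib, Finset.sum_add_distrib, ← Finset.mul_sum]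
  ring

end WeakFlow

/-! ### The Gronwall argument -/

/-- The Gronwall inequality for a function which agrees with a primitive almost everywhere. -/
theorem ae_eq_zero_of_primitive {X Y a : ℝ → ℝ} (hX : ∀ᵐ t ∂timeMeasure, 0 ≤ X t)
    (hY : ∀ T, IntegrableOn Y (Set.Ioc 0 T)) (ha : ∀ T, IntegrableOn a (Set.Ioc 0 T))
    (ha0 : ∀ t, 0 ≤ a t) (h : ∀ᵐ t ∂timeMeasure, X t = ∫ s in Set.Ioc 0 t, Y s)
    (hle : ∀ᵐ t ∂timeMeasure, Y t ≤ a t * X t) : ∀ᵐ t ∂timeMeasure, X t = 0 := by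
  have haX : ∀ T, IntegrableOn (fun t => a t * X t) (Set.Ioc 0 T) := by
    intro T
    have hc := continuousOn_primitive_Ioc (hY T)
    obtain ⟨C, hC⟩ := isCompact_Icc.exists_bound_of_continuousOn hc
    have hi : IntegrableOn (fun t => a t * ∫ s in Set.Ioc 0 t, Y s) (Set.Ioc 0 T) := by
      refine Integrable.mul_bdd (c := C) (ha T)
        ((hc.mono Set.Ioc_subset_Icc_self).aestronglyMeasurable measurableSet_Ioc) ?_
      filter_upwards [ae_restrict_mem measurableSet_Ioc] with t ht
        using hC t (Set.Ioc_subset_Icc_self ht)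
    refine hi.congr ?_
    filter_upwards [ae_mono (restrict_Ioc_le_timeMeasure T) h] with t ht
    rw [ht]
  refine ae_eq_zero_of_le_integral hX ha ha0 haX ?_
  filter_upwards [h] with t ht
  rw [ht]
  exact integral_mono_ae (hY t) (haX t) (ae_mono (restrict_Ioc_le_timeMeasure t) hle)

namespace WeakFlow

variable {N : ℕ} (S₁ S₂ : WeakFlow N)

/-- The right-hand side of the energy balance as a space integral. -/
theorem integral_balance (a b c Γ L ν : ℝ) : ∀ᵐ t ∂timeMeasure,
    Integrable (balance S₁ S₂ a b c Γ L ν t) (volume : Measure Plane) ∧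
    ∫ x, balance S₁ S₂ a b c Γ L ν t x
      = L * (∫ x, frob (S₁.force a b c Γ L t x - S₂.force a b c Γ L t x) (S₁.Q t x - S₂.Q t x))
        + ∑ α : Fin 2 × Fin 2, (inner ℝ
          (path (fun t x => S₁.stress L ν α.1 α.2 t x - S₂.stress L ν α.1 α.2 t x) t)
          (resD α.2 (path (velDiff S₁ S₂ α.1) t)) : ℝ) := by
  have hG : ∀ᵐ t ∂timeMeasure, ∀ i j, MemLp
      (fun x => (S₁.force a b c Γ L t x - S₂.force a b c Γ L t x) i j) 2 (volume : Measure Plane) :=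
    ae_all_iff.2 fun i => ae_all_iff.2 fun j =>
      ((S₁.inL1L2_force a b c Γ L i j).sub (S₂.inL1L2_force a b c Γ L i j)).memLp
  have hσ : ∀ᵐ t ∂timeMeasure, ∀ α β, MemLp
      (fun x => S₁.stress L ν α β t x - S₂.stress L ν α β t x) 2 (volume : Measure Plane) :=
    ae_all_iff.2 fun α => ae_all_iff.2 fun β =>
      ((S₁.inL1L2_stress L ν α β).sub (S₂.inL1L2_stress L ν α β)).memLp
  filter_upwards [hG, hσ, ae_memH1_tenDiff S₁ S₂, ae_resD_velDiff S₁ S₂] with t g s r hr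
  have i1 : Integrable (fun x => frob (S₁.force a b c Γ L t x - S₂.force a b c Γ L t x)
      (S₁.Q t x - S₂.Q t x)) (volume : Measure Plane) :=
    integrable_finsetSum _ fun i _ => integrable_finsetSum _ fun j _ =>
      integrable_mul_two (g i j) (r i j).memLp
  have i2 : ∀ α β, Integrable (fun x => (S₁.stress L ν α β t x - S₂.stress L ν α β t x)
      * resGrad S₁ S₂ α β t x) (volume : Measure Plane) := fun α β =>
    integrable_mul_two (s α β) (Lp.memLp _)
  have i3 : Integrable (fun x => ∑ α, ∑ β, (S₁.stress L ν α β t x - S₂.stress L ν α β t x)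
      * resGrad S₁ S₂ α β t x) (volume : Measure Plane) :=
    integrable_finsetSum _ fun α _ => integrable_finsetSum _ fun β _ => i2 α β
  refine ⟨(i1.const_mul L).add i3, ?_⟩
  unfold balance
  rw [integral_add (i1.const_mul L) i3, integral_const_mul, Fintype.sum_prod_type,
    integral_finsetSum _ fun α _ => integrable_finsetSum _ fun β _ => i2 α β]
  congr 1
  refine Finset.sum_congr rfl fun α _ => ?_
  rw [integral_finsetSum _ fun β _ => i2 α β]
  refine Finset.sum_congr rfl fun β _ => ?_
  rw [(hr α β).1, inner_L2R]
  refine integral_congr_ae ?_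
  filter_upwards [coeFn_path (f := fun t x => S₁.stress L ν α β t x - S₂.stress L ν α β t x)
    (s α β)] with x hx
  rw [hx]

/-- The principal part yields minus the dissipation: `∫ ΔR · R = -‖∇R‖²`, and the pairing of
`∇(u₁ - u₂)` with its resolvent is `‖∇w‖² + ‖∇²w‖²`. -/
theorem integral_principal (Γ L ν : ℝ) : ∀ᵐ t ∂timeMeasure,
    Integrable (principal S₁ S₂ Γ L ν t) (volume : Measure Plane) ∧
    ∫ x, principal S₁ S₂ Γ L ν t x
      = -(Γ * L ^ 2 * ∑ k, ∑ i, ∑ j, n2 (tenDiffD S₁ S₂ k i j t) ^ 2)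
        - ν * ∑ α, ∑ β, (‖resGrad S₁ S₂ α β t‖ ^ 2 + ∑ k, ‖resGradD S₁ S₂ k α β t‖ ^ 2) := by
  filter_upwards [ae_memH1_tenDiff S₁ S₂, ae_memH1_tenDiffD S₁ S₂, ae_memH1_velDiff S₁ S₂]
    with t m1 m2 m3
  have i1 : ∀ k i j, Integrable (fun x => tenDiffDD S₁ S₂ k k i j t x * tenDiff S₁ S₂ i j t x)
      (volume : Measure Plane) := fun k i j =>
    integrable_mul_two ((m2 k i j).memLp_grad k) (m1 i j).memLp
  have i2 : ∀ α β, Integrable (fun x => gradDiff S₁ S₂ α β t x * resGrad S₁ S₂ α β t x)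
      (volume : Measure Plane) := fun α β =>
    integrable_mul_two ((m3 α).memLp_grad β) (Lp.memLp _)
  have e1 : ∀ x, frob (lap S₁.D2Q t x - lap S₂.D2Q t x) (S₁.Q t x - S₂.Q t x)
      = ∑ k, ∑ i, ∑ j, tenDiffDD S₁ S₂ k k i j t x * tenDiff S₁ S₂ i j t x := by
    intro x
    unfold frob
    rw [Finset.sum_comm]
    simp only [Fin.sum_univ_two, ← Finset.sum_add_distrib]
    rw [Finset.sum_comm]
    refine Finset.sum_congr rfl fun i _ => Finset.sum_congr rfl fun j _ => ?_
    simp only [lap, tenDiff, tenDiffDD, Matrix.sub_apply, Matrix.sum_apply]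
    simp only [Fin.sum_univ_two]
    ring
  have i3 : Integrable (fun x => ∑ k, ∑ i, ∑ j, tenDiffDD S₁ S₂ k k i j t x
      * tenDiff S₁ S₂ i j t x) (volume : Measure Plane) :=
    integrable_finsetSum _ fun k _ => integrable_finsetSum _ fun i _ =>
      integrable_finsetSum _ fun j _ => i1 k i j
  have i4 : Integrable (fun x => ∑ α, ∑ β, gradDiff S₁ S₂ α β t x * resGrad S₁ S₂ α β t x)
      (volume : Measure Plane) :=
    integrable_finsetSum _ fun α _ => integrable_finsetSum _ fun β _ => i2 α β
  have j1 : ∀ k i j, ∫ x, tenDiffDD S₁ S₂ k k i j t x * tenDiff S₁ S₂ i j t x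
      = -n2 (tenDiffD S₁ S₂ k i j t) ^ 2 := by
    intro k i j
    rw [(m2 k i j).integral_mul_eq_neg (m1 i j) k, integral_mul_self_eq (m2 k i j).memLp]
  have j2 : ∀ α β, ∫ x, gradDiff S₁ S₂ α β t x * resGrad S₁ S₂ α β t x
      = ‖resGrad S₁ S₂ α β t‖ ^ 2 + ∑ k, ‖resGradD S₁ S₂ k α β t‖ ^ 2 := by
    intro α β
    rw [resGrad, show (∑ k, ‖resGradD S₁ S₂ k α β t‖ ^ 2)
      = ∑ k, ‖resD k (path (gradDiff S₁ S₂ α β) t)‖ ^ 2 from rfl, ← inner_res_self, inner_L2R]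
    refine integral_congr_ae ?_
    filter_upwards [coeFn_path ((m3 α).memLp_grad β)] with x hx
    rw [hx]
  unfold principal
  simp only [e1]
  refine ⟨(i3.const_mul _).sub (i4.const_mul _), ?_⟩
  rw [integral_sub (i3.const_mul _) (i4.const_mul _), integral_const_mul, integral_const_mul,
    integral_finsetSum _ fun k _ => integrable_finsetSum _ fun i _ =>
      integrable_finsetSum _ fun j _ => i1 k i j,
    integral_finsetSum _ fun α _ => integrable_finsetSum _ fun β _ => i2 α β]
  have k1 : ∀ k, ∫ x, ∑ i, ∑ j, tenDiffDD S₁ S₂ k k i j t x * tenDiff S₁ S₂ i j t x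
      = -∑ i, ∑ j, n2 (tenDiffD S₁ S₂ k i j t) ^ 2 := by
    intro k
    rw [integral_finsetSum _ fun i _ => integrable_finsetSum _ fun j _ => i1 k i j]
    simp only [integral_finsetSum _ fun j _ => i1 k _ j, j1, Finset.sum_neg_distrib]
  have k2 : ∀ α, ∫ x, ∑ β, gradDiff S₁ S₂ α β t x * resGrad S₁ S₂ α β t x
      = ∑ β, (‖resGrad S₁ S₂ α β t‖ ^ 2 + ∑ k, ‖resGradD S₁ S₂ k α β t‖ ^ 2) := by
    intro α
    rw [integral_finsetSum _ fun β _ => i2 α β]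
    simp only [j2]
  simp only [k1, k2, Finset.sum_neg_distrib, mul_neg]

/-- The dissipation absorbs the controlled terms. -/
theorem exists_integral_balance_le (a b c : ℝ) {Γ L ν : ℝ} (hΓ : 0 < Γ) (hL : 0 < L) (hν : 0 < ν) :
    ∃ C : ℝ, 0 ≤ C ∧ ∀ᵐ t ∂timeMeasure, ∫ x, balance S₁ S₂ a b c Γ L ν t x
      ≤ C * ((scale S₁ S₂).a t * (scale S₁ S₂).e t) := by
  set m := min (Γ * L ^ 2) ν
  have hm : 0 < m := lt_min (by positivity) hν
  obtain ⟨C, hC, hb⟩ := (ctrl_balance S₁ S₂ a b c Γ L ν).bound m hm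
  refine ⟨m + C, by positivity, ?_⟩
  filter_upwards [hb, integral_balance S₁ S₂ a b c Γ L ν, integral_principal S₁ S₂ Γ L ν]
    with t h1 h2 h3
  rw [integral_sub h2.1 h3.1] at h1
  have he := (scale S₁ S₂).e_nonneg t
  have hae := mul_le_mul_of_nonneg_right ((scale S₁ S₂).one_le_a t) he
  have p1 : 0 ≤ ∑ k, ∑ i, ∑ j, n2 (tenDiffD S₁ S₂ k i j t) ^ 2 := by positivity
  have p2 : 0 ≤ ∑ α, ∑ β, (‖resGrad S₁ S₂ α β t‖ ^ 2
    + ∑ k, ‖resGradD S₁ S₂ k α β t‖ ^ 2) := by positivity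
  have hd : ∫ x, principal S₁ S₂ Γ L ν t x ≤ -(m * (scale S₁ S₂).d t) := by
    rw [h3.2]
    change _ ≤ -(m * (_ + _))
    have q1 := mul_le_mul_of_nonneg_right (min_le_left (Γ * L ^ 2) ν) p1
    have q2 := mul_le_mul_of_nonneg_right (min_le_right (Γ * L ^ 2) ν) p2
    rw [mul_add]
    linarith
  have h4 := (abs_le.1 h1).2
  have h5 := mul_le_mul_of_nonneg_left hae hm.le
  linarith

/-- Two solutions with the same data have vanishing relative energy. -/
theorem ae_energy_eq_zero {a b c Γ L ν : ℝ} (hΓ : 0 < Γ) (hL : 0 < L) (hν : 0 < ν)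
    {Qbar : Plane → Mat N} {ubar : Plane → Plane}
    (hQ₁ : QEquation a b c Γ L Qbar S₁.Q S₁.D2Q S₁.u S₁.Du)
    (hQ₂ : QEquation a b c Γ L Qbar S₂.Q S₂.D2Q S₂.u S₂.Du)
    (hu₁ : UEquation L ν ubar S₁.Q S₁.DQ S₁.D2Q S₁.u S₁.Du)
    (hu₂ : UEquation L ν ubar S₂.Q S₂.DQ S₂.D2Q S₂.u S₂.Du) :
    ∀ᵐ t ∂timeMeasure, (scale S₁ S₂).e t = 0 := by
  obtain ⟨iQ, eQ⟩ := energy_identity_Q S₁ S₂ hQ₁ hQ₂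
  obtain ⟨iu, eu⟩ := energy_identity_u S₁ S₂ hu₁ hu₂
  obtain ⟨C, hC, hb⟩ := exists_integral_balance_le S₁ S₂ a b c hΓ hL hν
  set m := min L 1
  have hm : 0 < m := lt_min hL one_pos
  let X : ℝ → ℝ := fun t => L * (∑ i, ∑ j, n2 (tenDiff S₁ S₂ i j t) ^ 2)
    + ∑ α, (inner ℝ (path (velDiff S₁ S₂ α) t) (res (path (velDiff S₁ S₂ α) t)) : ℝ)
  have hXe : ∀ t, m * (scale S₁ S₂).e t ≤ X t := by
    intro t
    have p1 : 0 ≤ ∑ i, ∑ j, n2 (tenDiff S₁ S₂ i j t) ^ 2 := by positivity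
    have p2 : 0 ≤ ∑ α, (‖res (path (velDiff S₁ S₂ α) t)‖ ^ 2
      + ∑ β, ‖resD β (path (velDiff S₁ S₂ α) t)‖ ^ 2) := by positivity
    have q1 := mul_le_mul_of_nonneg_right (min_le_left L 1) p1
    have q2 := mul_le_mul_of_nonneg_right (min_le_right L 1) p2
    simp only [X, inner_res_self]
    change m * (_ + _) ≤ _
    rw [mul_add]
    linarith
  have hX0 : ∀ t, 0 ≤ X t := fun t =>
    (mul_nonneg hm.le ((scale S₁ S₂).e_nonneg t)).trans (hXe t)
  have hz := ae_eq_zero_of_primitive (X := X) (a := fun t => 2 * (C / m) * (scale S₁ S₂).a t)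
    (.of_forall hX0)
    (fun T => (((iQ T).const_mul L).add (iu T)).const_mul 2) (fun T => ?_) (fun t => ?_) ?_ ?_
  · filter_upwards [hz] with t ht
    have h1 := hXe t
    rw [ht] at h1
    exact le_antisymm (nonpos_of_mul_nonpos_right h1 hm) ((scale S₁ S₂).e_nonneg t)
  · exact ((((timeLp_const 1 1).add S₁.timeLp_weight).add S₂.timeLp_weight).integrableOn
      T).const_mul (2 * (C / m))
  · have := (scale S₁ S₂).one_le_a t
    positivity
  · filter_upwards [eQ, eu] with t h1 h2
    have h1' : ∑ i, ∑ j, n2 (tenDiff S₁ S₂ i j t) ^ 2 = _ := h1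
    simp only [X, Pi.add_apply]
    rw [h1', h2, integral_const_mul, integral_add ((iQ t).const_mul L) (iu t), integral_const_mul]
    ring
  · filter_upwards [hb, integral_balance S₁ S₂ a b c Γ L ν] with t h1 h2
    rw [h2.2] at h1
    have ha := (scale S₁ S₂).one_le_a t
    have h3 : (scale S₁ S₂).e t ≤ X t / m := (le_div_iff₀' hm).2 (hXe t)
    have h4 : C * ((scale S₁ S₂).a t * (scale S₁ S₂).e t)
        ≤ C * ((scale S₁ S₂).a t * (X t / m)) := by gcongr
    have h5 := h1.trans h4
    simp only [Pi.add_apply]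
    calc _ ≤ 2 * (C * ((scale S₁ S₂).a t * (X t / m))) := by linarith
      _ = _ := by ring

end WeakFlow

theorem eq_zero_of_weakPartial_zero {k : Fin 2} {f g : L2R} (h : HasWeakPartial k f g)
    (hf : f = 0) : g = 0 := by
  refine L2R_ext_test fun η hη hc => ?_
  have h0 : ∀ φ : Plane → ℝ, ∫ x, (0 : L2R) x * φ x = 0 := fun φ => by
    refine integral_eq_zero_of_ae ?_
    filter_upwards [Lp.coeFn_zero ℝ 2 (volume : Measure Plane)] with x hx
    rw [hx, Pi.zero_apply, zero_mul]
  have h1 := h.2.2 η hη hc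
  rw [hf, h0] at h1
  rw [h0]
  linarith

/-- The resolvent is injective. -/
theorem eq_zero_of_res_eq_zero {g : L2R} (h : res g = 0) : g = 0 := by
  have h1 : ∀ k, resD k g = 0 := fun k => eq_zero_of_weakPartial_zero (hasWeakPartial_res k g) h
  have h2 : ∀ k, resDD k k g = 0 := fun k =>
    eq_zero_of_weakPartial_zero (hasWeakPartial_resD k k g) (h1 k)
  rw [← res_sub_laplacian g]
  simp only [h, h2, Finset.sum_const_zero, sub_zero]

namespace WeakFlow

variable {N : ℕ} (S₁ S₂ : WeakFlow N)

/-- The energy of a difference vanishes only if the two solutions agree. -/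
theorem ae_eq_of_energy_eq_zero (h : ∀ᵐ t ∂timeMeasure, (scale S₁ S₂).e t = 0) :
    ∀ᵐ t ∂timeMeasure,
      (∀ᵐ x : Plane, S₁.Q t x = S₂.Q t x) ∧ (∀ᵐ x : Plane, S₁.u t x = S₂.u t x) := by
  filter_upwards [h, ae_memH1_tenDiff S₁ S₂, ae_memH1_velDiff S₁ S₂] with t h0 m1 m2
  obtain ⟨-, -, b1, b2, -⟩ := scale_bounds S₁ S₂ t
  rw [h0] at b1 b2
  constructor
  · have hz : ∀ i j, ∀ᵐ x, tenDiff S₁ S₂ i j t x = 0 := by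
      intro i j
      have h1 : n2 (tenDiff S₁ S₂ i j t) = 0 := pow_eq_zero_iff two_ne_zero |>.1
        (le_antisymm (b1 i j) (sq_nonneg _))
      have h2 := ((ENNReal.toReal_eq_zero_iff _).1 h1).resolve_right (m1 i j).memLp.2.ne
      exact (eLpNorm_eq_zero_iff (m1 i j).memLp.1 two_ne_zero).1 h2
    filter_upwards [ae_all_iff.2 fun i => ae_all_iff.2 fun j => hz i j] with x hx
    ext i j
    exact sub_eq_zero.1 (hx i j)
  · have hz : ∀ α, ∀ᵐ x, velDiff S₁ S₂ α t x = 0 := by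
      intro α
      have h1 : res (path (velDiff S₁ S₂ α) t) = 0 := norm_eq_zero.1
        (pow_eq_zero_iff two_ne_zero |>.1 (le_antisymm (b2 α) (sq_nonneg _)))
      filter_upwards [coeFn_path (m2 α).memLp, Lp.coeFn_zero ℝ 2 (volume : Measure Plane)]
        with x a1 a2
      rw [← a1, eq_zero_of_res_eq_zero h1, a2, Pi.zero_apply]
    filter_upwards [ae_all_iff.2 hz] with x hx
    ext α
    exact sub_eq_zero.1 (hx α)

end WeakFlow

end

theorem mainTheorem3 {N : ℕ} (hN : N = 2 ∨ N = 3)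
    (a b c Γ L ν : ℝ) (hc : 0 < c) (hΓ : 0 < Γ) (hL : 0 < L) (hν : 0 < ν)
    (s : ℝ) (hs : 1 < s)
    (Qbar : Plane → Mat N) (ubar : Plane → Plane)
    (hQbar_tensor : ∀ᵐ x : Plane, IsQTensor (Qbar x))
    (hQbar : ∀ i j, MemHs (s + 1) (fun x => Qbar x i j))
    (hubar : ∀ α, MemHs s (fun x => ubar x α))
    (hubar_div : WeakDivFree ubar)
    (Q₁ : ℝ → Plane → Mat N) (u₁ : ℝ → Plane → Plane)
    (hweak : IsWeakSolution a b c Γ L ν Qbar ubar Q₁ u₁)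
    (Q₂ : ℝ → Plane → Mat N) (u₂ : ℝ → Plane → Plane)
    (hstrong : IsStrongSolution s a b c Γ L ν Qbar ubar Q₂ u₂) :
    ∀ᵐ t ∂timeMeasure,
      (∀ᵐ x : Plane, Q₁ t x = Q₂ t x) ∧ (∀ᵐ x : Plane, u₁ t x = u₂ t x) := by
  obtain ⟨DQ₁, D2Q₁, Du₁, hQ₁, hu₁, eQ₁, eu₁⟩ := hweak
  obtain ⟨DQ₂, D2Q₂, Du₂, hQ₂, hu₂, eQ₂, eu₂⟩ := hstrong.solves
  let S₁ : WeakFlow N := ⟨Q₁, DQ₁, D2Q₁, u₁, Du₁, hQ₁, hu₁⟩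
  let S₂ : WeakFlow N := ⟨Q₂, DQ₂, D2Q₂, u₂, Du₂, hQ₂, hu₂⟩
  exact WeakFlow.ae_eq_of_energy_eq_zero S₁ S₂
    (WeakFlow.ae_energy_eq_zero S₁ S₂ hΓ hL hν eQ₁ eQ₂ eu₁ eu₂)
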